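/- Let $N>2$ be an integer, $1<p<N$ and $R>0$. Let $f:\mathbb R\setminus\{0\}\to\mathbb R$ be odd and locally Lipschitz, and assume: (H1) there are $l>p-1$ and a locally Lipschitz $g_1:\mathbb R\to\mathbb R$ with $f(u)=|u|^{l-1}u+g_1(u)$ for all sufficiently large $|u|$ and $\lim_{u\to\infty}|g_1(u)|/|u|^{l}=0$; (H2) there are $0<m<1$ and a locally Lipschitz $g_2:\mathbb R\to\mathbb R$ with $g_2(0)=0$ and $f(u)=-\frac{1}{|u|^{m-1}u}+g_2(u)$ for all sufficiently small $|u|>0$; (H3) there is $\beta>0$ with $f(\beta)=0$, $f<0$ on $(0,\beta)$ and $f>0$ on $(\beta,\infty)$; (H4) $K:[R,\infty)\to(0,\infty)$ is $C^1$ and there are constants $K_0,K_1>0$ and $\alpha_1\le\alpha$ with $N+\frac{m(N-p)}{p-1}<\alpha_1\le\alpha<2(N-1)$ such that $\frac{rK'(r)}{K(r)}>-\frac{(N-1)p}{p-1}$ and $\frac{K_0}{r^{\alpha}}\le K(r)\le\frac{K_1}{r^{\alpha_1}}$ for all $r\ge R$. Then there is an integer $n_0\ge 0$ such that for every integer $n\ge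 n_0$ the problem $\Delta_p u+K(|x|)f(u)=0$ on $\mathbb R^N\setminus B_R$, $u=0$ on $\partial B_R$, $u\to0$ as $|x|\to\infty$ (where $\Delta_p u=\nabla\cdot(|\nabla u|^{p-2}\nabla u)$ and $B_R$ is the ball of radius $R$ centred at the origin) has a radial solution $u=u(r)$, $r=|x|$, with exactly $n$ zeros on $(R,\infty)$. Here a radial solution is a function $u\in C^1[R,\infty)$ such that $|u|^{-m}\in L^1_{loc}[R,\infty)$ (in particular $u\neq0$ almost everywhere), $u(R)=0$, $\lim_{r\to\infty}u(r)=0$, and $$r^{N-1}|u'(r)|^{p-2}u'(r)=R^{N-1}|u'(R)|^{p-2}u'(R)-\int_R^r t^{N-1}K(t)f(u(t))\,dt\qquad\text{for all } r\ge R,$$ where $|s|^{p-2}s$ is read as $0$ at $s=0$, and the integral converges absolutely. -/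

import Mathlib

open Set Filter Topology MeasureTheory

/-- `f` is odd and locally Lipschitz on `ℝ \ {0}`. The value `f 0` is irrelevant. -/
def OddLocLipschitz (f : ℝ → ℝ) : Prop :=
  (∀ u : ℝ, u ≠ 0 → f (-u) = -f u) ∧ LocallyLipschitzOn ({0}ᶜ : Set ℝ) f

/-- `f u = |u|^(l-1) u + g u` for large `|u|`, with `g` locally Lipschitz on `ℝ`
and `|g u| / |u|^l → 0` as `u → ∞`. -/
def PowerAtInfinity (f : ℝ → ℝ) (l : ℝ) : Prop :=
  ∃ g : ℝ → ℝ, LocallyLipschitz g ∧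
    (∃ M : ℝ, ∀ u : ℝ, M < |u| → f u = |u| ^ (l - 1) * u + g u) ∧
    Tendsto (fun u : ℝ => |g u| / |u| ^ l) atTop (𝓝 0)

/-- `f u = -1 / (|u|^(m-1) u) + g u` for small `u ≠ 0`, with `g` locally Lipschitz on `ℝ`
and `g 0 = 0`. -/
def SingularAtZero (f : ℝ → ℝ) (m : ℝ) : Prop :=
  ∃ g : ℝ → ℝ, LocallyLipschitz g ∧ g 0 = 0 ∧
    ∃ δ : ℝ, 0 < δ ∧
      ∀ u : ℝ, u ≠ 0 → |u| < δ → f u = -(1 / (|u| ^ (m - 1) * u)) + g u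

/-- `f` has a unique positive zero `β`, with `f < 0` on `(0, β)` and `f > 0` on `(β, ∞)`. -/
def UniquePositiveZero (f : ℝ → ℝ) : Prop :=
  ∃ β : ℝ, 0 < β ∧ f β = 0 ∧ (∀ u ∈ Ioo 0 β, f u < 0) ∧ (∀ u ∈ Ioi β, 0 < f u)

/-- `K` is positive and `C¹` on `[R, ∞)`, satisfies `r K' / K > -(N-1) p / (p-1)` there, and
`K₀ r^(-α) ≤ K ≤ K₁ r^(-α₁)` for some positive constants `K₀, K₁`. -/
def WeightCondition (N : ℕ) (p R α α₁ : ℝ) (K : ℝ → ℝ) : Prop :=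
  ContDiffOn ℝ 1 K (Ici R) ∧ (∀ r ∈ Ici R, 0 < K r) ∧
    (∀ r ∈ Ici R, -(((N : ℝ) - 1) * p / (p - 1)) < r * derivWithin K (Ici R) r / K r) ∧
    ∃ K₀ K₁ : ℝ, 0 < K₀ ∧ 0 < K₁ ∧
      ∀ r ∈ Ici R, K₀ / r ^ α ≤ K r ∧ K r ≤ K₁ / r ^ α₁

/-- `Φ_p(x) = |x|^(p-2) x`. -/
noncomputable def pPhi (p x : ℝ) : ℝ := |x| ^ (p - 2) * x

/-- `u ∈ C¹[R, ∞)` is a radial solution, in the integrated sense, of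
`Δ_p u + K(|x|) f(u) = 0` outside the ball of radius `R` in `ℝ^N`, `u = 0` on its boundary and
`u → 0` at infinity. Since `1 / |u|^m` is to be read as `∞` where `u = 0`, its local
integrability includes that `u ≠ 0` almost everywhere. -/
structure IsRadialSolution (N : ℕ) (p R m : ℝ) (f K u : ℝ → ℝ) : Prop where
  contDiffOn : ContDiffOn ℝ 1 u (Ici R)
  ae_ne_zero : ∀ᵐ r ∂(volume.restrict (Ici R)), u r ≠ 0
  locallyIntegrableOn : LocallyIntegrableOn (fun r => 1 / |u r| ^ m) (Ici R)
  intervalIntegrable : ∀ r ∈ Ici R,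
    IntervalIntegrable (fun t => t ^ ((N : ℝ) - 1) * K t * f (u t)) volume R r
  integral_eq : ∀ r ∈ Ici R,
    r ^ ((N : ℝ) - 1) * pPhi p (derivWithin u (Ici R) r) =
      R ^ ((N : ℝ) - 1) * pPhi p (derivWithin u (Ici R) R) -
        ∫ t in R..r, t ^ ((N : ℝ) - 1) * K t * f (u t)
  boundary : u R = 0
  tendsto_zero : Tendsto u atTop (𝓝 0)

/-!
With `t = r ^ (-(N - p) / (p - 1))` a radial solution becomes a solution `v` of
`v' = |w| ^ (κ - 1) * w`, `w' = -h t * f v` on `(0, T]` with `κ = 1 / (p - 1)`, and the conditions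
at infinity and on `∂B_R` become `v 0 = 0` and `v T = 0`. The lower bound on `α₁` makes
`h t * f v` integrable at `t = 0` as long as `v` has positive slope there, and the lower bound on
`r * K' / K` makes `h` nonincreasing.

The singularities of `h` and `f` and the degeneracy of the `p`-Laplacian are cut off at scale
`1 / M`, and one shoots with the initial slope `a = w 0`. Since `h` is nonincreasing, the energy
`|w| ^ (κ + 1) / ((κ + 1) * h) + F v`, with `F` the primitive of `f`, is nondecreasing, while its
product with `h` can only grow by a bounded amount because `F` is bounded below. As `F ≤ 0` on
`[-β, β]`, this bounds `|w|` from above, and away from `0` where `|v| ≤ β`, uniformly in `M`: zeros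
of `v` are simple and a fixed distance apart. Superlinearity of `f` makes `v` oscillate quickly when
`a` is large. A polar angle of `(w, v)` counts the zeros, so by the intermediate value theorem in
`a` some slope gives `v T = 0` with exactly `n` zeros inside, where the number of zeros for `a = 1`
determines `n₀`. The uniform bounds carry solution and zeros to the limit `M → ∞` along an
ultrafilter.
-/

/-! ### Regularization of an odd function and mean value estimates -/

section Lipschitz

lemma lipschitzOnWith_mul_of_abs_le {X : Type*} [PseudoMetricSpace X] {s : Set X} {f g : X → ℝ}
    {K L A B : NNReal} (hf : LipschitzOnWith K f s) (hg : LipschitzOnWith L g s)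
    (hfA : ∀ x ∈ s, |f x| ≤ A) (hgB : ∀ x ∈ s, |g x| ≤ B) :
    LipschitzOnWith (K * B + A * L) (fun x => f x * g x) s := by
  refine LipschitzOnWith.of_dist_le_mul fun x hx y hy => ?_
  have hfxy := hf.dist_le_mul x hx y hy
  have hgxy := hg.dist_le_mul x hx y hy
  rw [Real.dist_eq] at hfxy hgxy ⊢
  push_cast
  calc |f x * g x - f y * g y| = |(f x - f y) * g x + f y * (g x - g y)| := by ring_nf
    _ ≤ |f x - f y| * |g x| + |f y| * |g x - g y| := by
      simpa only [abs_mul] using abs_add_le ((f x - f y) * g x) (f y * (g x - g y))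
    _ ≤ K * dist x y * B + A * (L * dist x y) := by
      gcongr
      · exact hgB x hx
      · exact hfA y hy
    _ = (K * B + A * L) * dist x y := by ring

lemma locallyLipschitzOn_rpow_const (κ : ℝ) :
    LocallyLipschitzOn (Ioi 0) (fun x : ℝ => x ^ κ) :=
  ContDiffOn.locallyLipschitzOn (convex_Ioi 0) fun _ hx =>
    (Real.contDiffAt_rpow_const_of_ne (ne_of_gt hx)).contDiffWithinAt

lemma exists_lipschitzOnWith_abs_le {s : Set ℝ} {g : ℝ → ℝ} (hg : LocallyLipschitzOn s g)
    (hs : IsCompact s) :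
    ∃ L B : NNReal, LipschitzOnWith L g s ∧ ∀ x ∈ s, |g x| ≤ B := by
  obtain ⟨L, hL⟩ := hg.exists_lipschitzOnWith_of_compact hs
  obtain ⟨B, hB⟩ := hs.exists_bound_of_continuousOn hg.continuousOn
  exact ⟨L, B.toNNReal, hL, fun x hx => (hB x hx).trans (Real.le_coe_toNNReal B)⟩

lemma exists_lipschitzOnWith_div_self {s : Set ℝ} {g : ℝ → ℝ} (hs : IsCompact s)
    (hs0 : s ⊆ Ioi 0) (hg : LocallyLipschitzOn s g) :
    ∃ L B : NNReal, LipschitzOnWith L (fun x => g x / x) s ∧ ∀ x ∈ s, |g x / x| ≤ B := by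
  have hinv : LocallyLipschitzOn s (fun x : ℝ => x⁻¹) := by
    simpa only [Real.rpow_neg_one] using (locallyLipschitzOn_rpow_const (-1)).mono hs0
  obtain ⟨L₁, B₁, hL₁, hB₁⟩ := exists_lipschitzOnWith_abs_le hg hs
  obtain ⟨L₂, B₂, hL₂, hB₂⟩ := exists_lipschitzOnWith_abs_le hinv hs
  refine ⟨L₁ * B₂ + B₁ * L₂, B₁ * B₂, ?_, fun x hx => ?_⟩
  · simpa only [div_eq_mul_inv] using lipschitzOnWith_mul_of_abs_le hL₁ hL₂ hB₁ hB₂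
  · rw [div_eq_mul_inv, abs_mul]
    exact_mod_cast mul_le_mul (hB₁ x hx) (hB₂ x hx) (abs_nonneg _) B₁.2

end Lipschitz

/-- Odd regularization of a function `g` on `(0, ∞)`, equal to `g` on `[M⁻¹, M]`, linear near `0`
and constant near `∞`. It makes the singular shooting problem globally Lipschitz; the formula
multiplies the odd truncation of `x` by an even truncation of `g x / x`. -/
noncomputable def regularize (g : ℝ → ℝ) (M x : ℝ) : ℝ :=
  max (-M) (min M x) * (g (max M⁻¹ (min M |x|)) / max M⁻¹ (min M |x|))

section Regularize

variable {g : ℝ → ℝ} {M x : ℝ}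

lemma inv_le_self_of_one_le (hM : 1 ≤ M) : M⁻¹ ≤ M :=
  (inv_le_one_of_one_le₀ hM).trans hM

lemma regularize_odd (hM : 1 ≤ M) : (regularize g M).Odd := by
  intro x
  unfold regularize
  rw [abs_neg, ← neg_mul]
  congr 1
  grind

lemma regularize_zero (hM : 1 ≤ M) : regularize g M 0 = 0 :=
  (regularize_odd hM).map_zero

lemma regularize_of_mem (hM : 1 ≤ M) (hx : x ∈ Icc M⁻¹ M) : regularize g M x = g x := by
  have hx0 : 0 < x := (inv_pos.2 (by linarith)).trans_le hx.1
  have hclamp : max (-M) (min M x) = x := by grind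
  have hclamp_abs : max M⁻¹ (min M |x|) = x := by rw [abs_of_pos hx0]; grind
  rw [regularize, hclamp, hclamp_abs, mul_div_cancel₀ _ hx0.ne']

lemma regularize_of_mem_Icc_zero_inv (hM : 1 ≤ M) (hx : x ∈ Icc 0 M⁻¹) :
    regularize g M x = x * (g M⁻¹ * M) := by
  have hinv := inv_le_self_of_one_le hM
  have hclamp : max (-M) (min M x) = x := by grind
  have hclamp_abs : max M⁻¹ (min M |x|) = M⁻¹ := by rw [abs_of_nonneg hx.1]; grind
  rw [regularize, hclamp, hclamp_abs, div_inv_eq_mul]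

lemma regularize_of_ge (hM : 1 ≤ M) (hx : M ≤ x) : regularize g M x = g M := by
  have hinv := inv_le_self_of_one_le hM
  have hclamp : max (-M) (min M x) = M := by grind
  have hclamp_abs : max M⁻¹ (min M |x|) = M := by rw [abs_of_nonneg (by linarith)]; grind
  rw [regularize, hclamp, hclamp_abs, mul_div_cancel₀ _ (by linarith)]

lemma exists_lipschitzWith_regularize (hg : LocallyLipschitzOn (Ioi 0) g) (hM : 1 ≤ M) :
    ∃ L B : NNReal, LipschitzWith L (regularize g M) ∧ ∀ x, |regularize g M x| ≤ B := by
  have hM0 : 0 ≤ M := by linarith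
  have hsub : Icc M⁻¹ M ⊆ Ioi 0 := fun x hx => (inv_pos.2 (by linarith)).trans_le hx.1
  obtain ⟨L, B, hL, hB⟩ := exists_lipschitzOnWith_div_self isCompact_Icc hsub (hg.mono hsub)
  have hclamp : LipschitzWith 1 fun x => max (-M) (min M x) :=
    (LipschitzWith.id.const_min M).const_max (-M)
  have hclamp_abs : LipschitzWith 1 fun x : ℝ => max M⁻¹ (min M |x|) :=
    (lipschitzWith_one_norm.const_min M).const_max M⁻¹
  have hclamp_le : ∀ x, |max (-M) (min M x)| ≤ M.toNNReal := fun x => by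
    rw [Real.coe_toNNReal M hM0]
    exact abs_le.2 ⟨le_max_left _ _, max_le (by linarith) (min_le_left _ _)⟩
  have hmem : ∀ x, max M⁻¹ (min M |x|) ∈ Icc M⁻¹ M := fun x =>
    ⟨le_max_left _ _, max_le (inv_le_self_of_one_le hM) (min_le_left _ _)⟩
  have hquot := hL.comp hclamp_abs.lipschitzOnWith fun x (_ : x ∈ univ) => hmem x
  refine ⟨_, M.toNNReal * B, lipschitzOnWith_univ.1 (lipschitzOnWith_mul_of_abs_le
    hclamp.lipschitzOnWith hquot (fun x _ => hclamp_le x) fun x _ => hB _ (hmem x)), fun x => ?_⟩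
  rw [regularize, abs_mul]
  exact_mod_cast mul_le_mul (hclamp_le x) (hB _ (hmem x)) (abs_nonneg _) M.toNNReal.2

lemma continuous_regularize (hg : LocallyLipschitzOn (Ioi 0) g) (hM : 1 ≤ M) :
    Continuous (regularize g M) :=
  let ⟨_, _, hL, _⟩ := exists_lipschitzWith_regularize hg hM
  hL.continuous

lemma monotoneOn_regularize (hM : 1 ≤ M) (hg : MonotoneOn g (Icc M⁻¹ M)) (hg0 : 0 ≤ g M⁻¹) :
    MonotoneOn (regularize g M) (Ici 0) := by
  have hM0 : 0 < M := by linarith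
  have hinv := inv_le_self_of_one_le hM
  have hlin : MonotoneOn (regularize g M) (Icc 0 M⁻¹) := fun x hx y hy hxy => by
    rw [regularize_of_mem_Icc_zero_inv hM hx, regularize_of_mem_Icc_zero_inv hM hy]
    gcongr
  have hmid : MonotoneOn (regularize g M) (Icc M⁻¹ M) :=
    hg.congr fun x hx => (regularize_of_mem hM hx).symm
  have hconst : MonotoneOn (regularize g M) (Ici M) := fun x hx y hy _ => by
    rw [regularize_of_ge hM hx, regularize_of_ge hM hy]
  have hright := hmid.union_right hconst (isGreatest_Icc hinv) isLeast_Ici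
  rw [Icc_union_Ici_eq_Ici hinv] at hright
  simpa only [Icc_union_Ici_eq_Ici (inv_pos.2 hM0).le] using
    hlin.union_right hright (isGreatest_Icc (inv_pos.2 hM0).le) isLeast_Ici

lemma regularize_nonneg (hM : 1 ≤ M) (hg : MonotoneOn g (Icc M⁻¹ M)) (hg0 : 0 ≤ g M⁻¹)
    (hx : 0 ≤ x) : 0 ≤ regularize g M x :=
  (regularize_zero hM).symm.le.trans (monotoneOn_regularize hM hg hg0 self_mem_Ici hx hx)

lemma regularize_pos (hM : 1 ≤ M) (hg : MonotoneOn g (Icc M⁻¹ M)) (hg0 : 0 < g M⁻¹)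
    (hx : 0 < x) : 0 < regularize g M x := by
  have hM0 : 0 < M := by linarith
  have hmin : 0 < min x M⁻¹ := lt_min hx (inv_pos.2 hM0)
  calc 0 < min x M⁻¹ * (g M⁻¹ * M) := by positivity
    _ = regularize g M (min x M⁻¹) :=
      (regularize_of_mem_Icc_zero_inv hM ⟨hmin.le, min_le_right _ _⟩).symm
    _ ≤ regularize g M x := monotoneOn_regularize hM hg hg0.le hmin.le hx.le (min_le_left _ _)

lemma regularize_le (hM : 1 ≤ M) (hg : MonotoneOn g (Ici M⁻¹)) (hx : M⁻¹ ≤ x) :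
    regularize g M x ≤ g x := by
  rcases le_total x M with h | h
  · rw [regularize_of_mem hM ⟨hx, h⟩]
  · rw [regularize_of_ge hM h]
    exact hg (inv_le_self_of_one_le hM) hx h

lemma abs_regularize (hM : 1 ≤ M) (hg : MonotoneOn g (Icc M⁻¹ M)) (hg0 : 0 ≤ g M⁻¹) (x : ℝ) :
    |regularize g M x| = regularize g M |x| := by
  rcases abs_cases x with ⟨h, hx⟩ | ⟨h, hx⟩
  · rw [h, abs_of_nonneg (regularize_nonneg hM hg hg0 hx)]
  · rw [h, ← abs_neg, ← regularize_odd hM x,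
      abs_of_nonneg (regularize_nonneg hM hg hg0 (neg_nonneg.2 hx.le))]

end Regularize

section MeanValue

variable {g g' : ℝ → ℝ} {a b B : ℝ}

lemma le_of_hasDerivAt_nonneg (hab : a ≤ b) (hc : ContinuousOn g (Icc a b))
    (hd : ∀ t ∈ Ioo a b, HasDerivAt g (g' t) t) (h : ∀ t ∈ Ioo a b, 0 ≤ g' t) : g a ≤ g b := by
  rw [← interior_Icc] at hd h
  exact monotoneOn_of_hasDerivWithinAt_nonneg (convex_Icc a b) hc
    (fun t ht => (hd t ht).hasDerivWithinAt) h (left_mem_Icc.2 hab) (right_mem_Icc.2 hab) hab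

lemma sub_le_of_hasDerivAt_le (hab : a ≤ b) (hc : ContinuousOn g (Icc a b))
    (hd : ∀ t ∈ Ioo a b, HasDerivAt g (g' t) t) (h : ∀ t ∈ Ioo a b, g' t ≤ B) :
    g b - g a ≤ B * (b - a) := by
  rw [← interior_Icc] at hd h
  exact (convex_Icc a b).image_sub_le_mul_sub_of_deriv_le hc
    (fun t ht => (hd t ht).differentiableAt.differentiableWithinAt)
    (fun t ht => (hd t ht).deriv.trans_le (h t ht)) a (left_mem_Icc.2 hab) b
    (right_mem_Icc.2 hab) hab

lemma le_sub_of_le_hasDerivAt (hab : a ≤ b) (hc : ContinuousOn g (Icc a b))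
    (hd : ∀ t ∈ Ioo a b, HasDerivAt g (g' t) t) (h : ∀ t ∈ Ioo a b, B ≤ g' t) :
    B * (b - a) ≤ g b - g a := by
  have hneg := sub_le_of_hasDerivAt_le hab hc.neg (fun t ht => (hd t ht).neg)
    fun t ht => neg_le_neg (h t ht)
  simp only [Pi.neg_apply] at hneg
  linarith

lemma abs_sub_le_of_abs_hasDerivAt_le (hab : a ≤ b) (hc : ContinuousOn g (Icc a b))
    (hd : ∀ t ∈ Ioo a b, HasDerivAt g (g' t) t) (h : ∀ t ∈ Ioo a b, |g' t| ≤ B) :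
    |g b - g a| ≤ B * (b - a) := by
  have hle := sub_le_of_hasDerivAt_le hab hc hd fun t ht => (abs_le.1 (h t ht)).2
  have hge := le_sub_of_le_hasDerivAt hab hc hd fun t ht => (abs_le.1 (h t ht)).1
  exact abs_le.2 ⟨by linarith, hle⟩

lemma sub_zero_le_of_hasDerivAt_le_rpow {c σ : ℝ} (hσ : 0 < σ) (hb : 0 ≤ b)
    (hc : ContinuousOn g (Icc 0 b)) (hd : ∀ t ∈ Ioo 0 b, HasDerivAt g (g' t) t)
    (h : ∀ t ∈ Ioo 0 b, g' t ≤ c * t ^ (σ - 1)) : g b - g 0 ≤ c / σ * b ^ σ := by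
  have hdiff := sub_le_of_hasDerivAt_le (g := fun t => g t - c / σ * t ^ σ) (B := 0) hb
    (hc.sub (continuous_const.mul (Real.continuous_rpow_const hσ.le)).continuousOn)
    (fun t ht => (hd t ht).sub
      ((Real.hasDerivAt_rpow_const (Or.inl ht.1.ne')).const_mul (c / σ)))
    fun t ht => by
      rw [← mul_assoc, div_mul_cancel₀ _ hσ.ne']
      linarith [h t ht]
  rw [Real.zero_rpow hσ.ne'] at hdiff
  linarith

end MeanValue

lemma forall_lt_of_forall_Ico_lt {g : ℝ → ℝ} {a b c : ℝ} (hc : ContinuousOn g (Icc a b))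
    (hstep : ∀ τ ∈ Icc a b, (∀ s ∈ Ico a τ, c < g s) → c < g τ) :
    ∀ t ∈ Icc a b, c < g t := by
  by_contra! hcon
  obtain ⟨t, ht, hgt⟩ := hcon
  have hcompact : IsCompact (Icc a b ∩ g ⁻¹' Iic c) :=
    isCompact_Icc.of_isClosed_subset (hc.preimage_isClosed_of_isClosed isClosed_Icc isClosed_Iic)
      inter_subset_left
  obtain ⟨τ, hτ, hmin⟩ := hcompact.exists_isLeast ⟨t, ht, hgt⟩
  refine (hstep τ hτ.1 fun s hs => ?_).not_ge hτ.2
  by_contra! hgs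
  exact (hmin ⟨⟨hs.1, hs.2.le.trans hτ.1.2⟩, hgs⟩).not_gt hs.2

lemma integral_zero_neg_of_odd {φ : ℝ → ℝ} (h : φ.Odd) (x : ℝ) :
    ∫ s in (0 : ℝ)..(-x), φ s = ∫ s in (0 : ℝ)..x, φ s := by
  have hneg := intervalIntegral.integral_comp_neg (a := 0) (b := x) φ
  simp only [h _, intervalIntegral.integral_neg, neg_zero] at hneg
  rw [intervalIntegral.integral_symm, ← hneg, neg_neg]

lemma integral_zero_abs_of_odd {φ : ℝ → ℝ} (h : φ.Odd) (x : ℝ) :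
    ∫ s in (0 : ℝ)..|x|, φ s = ∫ s in (0 : ℝ)..x, φ s := by
  rcases abs_choice x with hx | hx <;> rw [hx]
  exact integral_zero_neg_of_odd h x

/-! ### The regularized shooting problem and its energy -/

/-- Data of the singular initial value problem `v' = |w| ^ (κ - 1) * w`, `w' = -h t * f v`,
`v 0 = 0` on `(0, T]`, to which the radial problem reduces under the substitution
`t = r ^ (-(N - p) / (p - 1))`. Both `f` at `0` and the weight `h` at `0` may be singular, with
exponents `m` and `q`; the values `f 0` and `h 0` are irrelevant. -/
structure ShootingData where
  (κ m q T β A C : ℝ)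
  (f h h' : ℝ → ℝ)
  κ_pos : 0 < κ
  m_pos : 0 < m
  q_nonneg : 0 ≤ q
  q_add_m_lt_one : q + m < 1
  T_pos : 0 < T
  β_pos : 0 < β
  A_pos : 0 < A
  C_pos : 0 < C
  f_odd : ∀ x, x ≠ 0 → f (-x) = -f x
  f_lip : LocallyLipschitzOn (Ioi 0) f
  f_nonpos : ∀ x, 0 < x → x ≤ β → f x ≤ 0
  f_nonneg : ∀ x, β ≤ x → 0 ≤ f x
  f_bound : ∀ x, 0 < x → x ≤ β → |f x| ≤ C * x ^ (-m)
  f_super : Tendsto (fun x => f x / x ^ (1 / κ)) atTop atTop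
  h_pos : ∀ t ∈ Ioc 0 T, 0 < h t
  h_cont : ContinuousOn h (Ioc 0 T)
  h_deriv : ∀ t ∈ Ioo 0 T, HasDerivAt h (h' t) t
  h'_nonpos : ∀ t ∈ Ioo 0 T, h' t ≤ 0
  h_bound : ∀ t ∈ Ioc 0 T, h t ≤ A * t ^ (-q)

namespace ShootingData

variable (D : ShootingData)

/-- The regularization of `w ↦ |w| ^ (κ - 1) * w`, giving `v'` in terms of `w`. -/
noncomputable def velocity (M : ℝ) : ℝ → ℝ := regularize (fun x => x ^ D.κ) M

/-- The regularization of the nonlinearity `f`. -/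
noncomputable def force (M : ℝ) : ℝ → ℝ := regularize D.f M

/-- The weight `h`, frozen on `(-∞, M⁻¹]` to remove its singularity at `0`. -/
noncomputable def weight (M t : ℝ) : ℝ := D.h (max t M⁻¹)

/-- The primitive of `velocity`, the kinetic part of the energy. -/
noncomputable def kinetic (M x : ℝ) : ℝ := ∫ s in (0 : ℝ)..x, D.velocity M s

/-- The primitive of `force`, the potential part of the energy. -/
noncomputable def potential (M x : ℝ) : ℝ := ∫ s in (0 : ℝ)..x, D.force M s

/-- The regularization parameter `M` is so large that `β` lies in `[M⁻¹, M]` and `M⁻¹ ≤ T`. -/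
structure Admissible (M : ℝ) : Prop where
  two_le : 2 ≤ M
  β_le : D.β ≤ M
  inv_le_β : M⁻¹ ≤ D.β
  inv_le_T : M⁻¹ ≤ D.T

lemma m_lt_one : D.m < 1 := by linarith [D.q_add_m_lt_one, D.q_nonneg]

lemma monotoneOn_rpow_κ : MonotoneOn (fun x : ℝ => x ^ D.κ) (Ici 0) :=
  Real.monotoneOn_rpow_Ici_of_exponent_nonneg D.κ_pos.le

lemma eventually_admissible : ∀ᶠ M in atTop, D.Admissible M := by
  have h := tendsto_inv_atTop_zero (𝕜 := ℝ)
  filter_upwards [eventually_ge_atTop 2, eventually_ge_atTop D.β,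
    h.eventually_le_const D.β_pos, h.eventually_le_const D.T_pos] with M h2 hβ hinvβ hinvT
  exact ⟨h2, hβ, hinvβ, hinvT⟩

variable {D} {M x y : ℝ}

namespace Admissible

variable (hM : D.Admissible M)
include hM

lemma one_le : 1 ≤ M := by linarith [hM.two_le]

lemma pos : 0 < M := by linarith [hM.two_le]

lemma inv_pos : 0 < M⁻¹ := _root_.inv_pos.2 hM.pos

lemma inv_le_one : M⁻¹ ≤ 1 := inv_le_one_of_one_le₀ hM.one_le

lemma inv_le_half : M⁻¹ ≤ 1 / 2 := by
  rw [one_div]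
  exact inv_anti₀ two_pos hM.two_le

lemma monotoneOn_rpow_κ_Icc : MonotoneOn (fun x : ℝ => x ^ D.κ) (Icc M⁻¹ M) :=
  D.monotoneOn_rpow_κ.mono fun _ hx => hM.inv_pos.le.trans hx.1

lemma inv_rpow_κ_pos : 0 < M⁻¹ ^ D.κ := Real.rpow_pos_of_pos hM.inv_pos _

lemma continuous_velocity : Continuous (D.velocity M) :=
  continuous_regularize (locallyLipschitzOn_rpow_const _) hM.one_le

lemma continuous_force : Continuous (D.force M) := continuous_regularize D.f_lip hM.one_le

lemma velocity_neg (x : ℝ) : D.velocity M (-x) = -D.velocity M x := regularize_odd hM.one_le x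

lemma force_neg (x : ℝ) : D.force M (-x) = -D.force M x := regularize_odd hM.one_le x

lemma velocity_zero : D.velocity M 0 = 0 := regularize_zero hM.one_le

lemma velocity_of_mem (hx : x ∈ Icc M⁻¹ M) : D.velocity M x = x ^ D.κ :=
  regularize_of_mem hM.one_le hx

lemma force_of_mem (hx : x ∈ Icc M⁻¹ M) : D.force M x = D.f x :=
  regularize_of_mem hM.one_le hx

lemma velocity_one : D.velocity M 1 = 1 := by
  rw [hM.velocity_of_mem ⟨hM.inv_le_one, hM.one_le⟩, Real.one_rpow]

lemma velocity_mono (hx : 0 ≤ x) (hxy : x ≤ y) : D.velocity M x ≤ D.velocity M y :=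
  monotoneOn_regularize hM.one_le hM.monotoneOn_rpow_κ_Icc hM.inv_rpow_κ_pos.le hx
    (hx.trans hxy) hxy

lemma velocity_nonneg (hx : 0 ≤ x) : 0 ≤ D.velocity M x :=
  regularize_nonneg hM.one_le hM.monotoneOn_rpow_κ_Icc hM.inv_rpow_κ_pos.le hx

lemma velocity_pos (hx : 0 < x) : 0 < D.velocity M x :=
  regularize_pos hM.one_le hM.monotoneOn_rpow_κ_Icc hM.inv_rpow_κ_pos hx

lemma velocity_le (hx : 1 ≤ x) : D.velocity M x ≤ x ^ D.κ :=
  regularize_le hM.one_le (D.monotoneOn_rpow_κ.mono (Ici_subset_Ici.2 hM.inv_pos.le))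
    (hM.inv_le_one.trans hx)

lemma abs_velocity (x : ℝ) : |D.velocity M x| = D.velocity M |x| :=
  abs_regularize hM.one_le hM.monotoneOn_rpow_κ_Icc hM.inv_rpow_κ_pos.le x

lemma velocity_eq_zero_iff : D.velocity M x = 0 ↔ x = 0 := by
  rw [← abs_eq_zero, hM.abs_velocity]
  refine ⟨fun h => ?_, fun h => by rw [h, abs_zero, hM.velocity_zero]⟩
  by_contra hx
  exact (hM.velocity_pos (abs_pos.2 hx)).ne' h

lemma abs_velocity_le {W : ℝ} (hW : 1 ≤ W) (h : |x| ≤ W) : |D.velocity M x| ≤ W ^ D.κ := by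
  rw [hM.abs_velocity]
  exact (hM.velocity_mono (abs_nonneg _) h).trans (hM.velocity_le hW)

lemma force_nonpos (h0 : 0 ≤ x) (h : x ≤ D.β) : D.force M x ≤ 0 := by
  rcases le_total x M⁻¹ with hx | hx
  · rw [force, regularize_of_mem_Icc_zero_inv hM.one_le ⟨h0, hx⟩]
    exact mul_nonpos_of_nonneg_of_nonpos h0
      (mul_nonpos_of_nonpos_of_nonneg (D.f_nonpos _ hM.inv_pos hM.inv_le_β) hM.pos.le)
  · rw [hM.force_of_mem ⟨hx, h.trans hM.β_le⟩]
    exact D.f_nonpos _ (hM.inv_pos.trans_le hx) h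

lemma force_nonneg (h : D.β ≤ x) : 0 ≤ D.force M x := by
  rcases le_total x M with hx | hx
  · rw [hM.force_of_mem ⟨hM.inv_le_β.trans h, hx⟩]
    exact D.f_nonneg _ h
  · rw [force, regularize_of_ge hM.one_le hx]
    exact D.f_nonneg _ hM.β_le

lemma abs_force_le (h0 : 0 < x) (h : x ≤ D.β) : |D.force M x| ≤ D.C * x ^ (-D.m) := by
  rcases le_total x M⁻¹ with hx | hx
  · rw [force, regularize_of_mem_Icc_zero_inv hM.one_le ⟨h0.le, hx⟩]
    have hxM : x * M ≤ 1 := by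
      rwa [← le_div_iff₀ hM.pos, one_div]
    have hpow : M⁻¹ ^ (-D.m) ≤ x ^ (-D.m) :=
      Real.rpow_le_rpow_of_nonpos h0 hx (neg_nonpos.2 D.m_pos.le)
    have hC := D.C_pos.le
    calc |x * (D.f M⁻¹ * M)| = |D.f M⁻¹| * (x * M) := by
          rw [abs_mul, abs_mul, abs_of_pos h0, abs_of_pos hM.pos]; ring
      _ ≤ |D.f M⁻¹| := mul_le_of_le_one_right (abs_nonneg _) hxM
      _ ≤ D.C * M⁻¹ ^ (-D.m) := D.f_bound _ hM.inv_pos hM.inv_le_β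
      _ ≤ D.C * x ^ (-D.m) := by gcongr
  · rw [hM.force_of_mem ⟨hx, h.trans hM.β_le⟩]
    exact D.f_bound _ h0 h

lemma hasDerivAt_kinetic (x : ℝ) : HasDerivAt (D.kinetic M) (D.velocity M x) x :=
  hM.continuous_velocity.integral_hasStrictDerivAt 0 x |>.hasDerivAt

lemma hasDerivAt_potential (x : ℝ) : HasDerivAt (D.potential M) (D.force M x) x :=
  hM.continuous_force.integral_hasStrictDerivAt 0 x |>.hasDerivAt

lemma continuous_kinetic : Continuous (D.kinetic M) :=
  continuous_iff_continuousAt.2 fun x => (hM.hasDerivAt_kinetic x).continuousAt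

lemma continuous_potential : Continuous (D.potential M) :=
  continuous_iff_continuousAt.2 fun x => (hM.hasDerivAt_potential x).continuousAt

lemma kinetic_abs (x : ℝ) : D.kinetic M |x| = D.kinetic M x :=
  integral_zero_abs_of_odd hM.velocity_neg x

lemma potential_abs (x : ℝ) : D.potential M |x| = D.potential M x :=
  integral_zero_abs_of_odd hM.force_neg x

omit hM in
lemma kinetic_zero : D.kinetic M 0 = 0 := intervalIntegral.integral_same

omit hM in
lemma potential_zero : D.potential M 0 = 0 := intervalIntegral.integral_same

lemma velocity_mul_sub_le_kinetic_sub (hx : 0 ≤ x) (hxy : x ≤ y) :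
    D.velocity M x * (y - x) ≤ D.kinetic M y - D.kinetic M x :=
  le_sub_of_le_hasDerivAt hxy hM.continuous_kinetic.continuousOn
    (fun t _ => hM.hasDerivAt_kinetic t) fun _ ht => hM.velocity_mono hx ht.1.le

lemma kinetic_sub_le_velocity_mul_sub (hx : 0 ≤ x) (hxy : x ≤ y) :
    D.kinetic M y - D.kinetic M x ≤ D.velocity M y * (y - x) :=
  sub_le_of_hasDerivAt_le hxy hM.continuous_kinetic.continuousOn
    (fun t _ => hM.hasDerivAt_kinetic t) fun _ ht => hM.velocity_mono (hx.trans ht.1.le) ht.2.le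

lemma kinetic_mono (hx : 0 ≤ x) (hxy : x ≤ y) : D.kinetic M x ≤ D.kinetic M y := by
  have := hM.velocity_mul_sub_le_kinetic_sub hx hxy
  have := mul_nonneg (hM.velocity_nonneg hx) (sub_nonneg.2 hxy)
  linarith

lemma kinetic_nonneg (x : ℝ) : 0 ≤ D.kinetic M x := by
  rw [← hM.kinetic_abs, ← kinetic_zero (D := D) (M := M)]
  exact hM.kinetic_mono le_rfl (abs_nonneg x)

lemma abs_le_kinetic_add_one (x : ℝ) : |x| ≤ D.kinetic M x + 1 := by
  rcases le_total |x| 1 with h | h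
  · linarith [hM.kinetic_nonneg x]
  · have hx := hM.velocity_mul_sub_le_kinetic_sub zero_le_one h
    rw [hM.velocity_one, hM.kinetic_abs] at hx
    linarith [hM.kinetic_nonneg 1]

lemma kinetic_le_velocity_mul (hx : 0 ≤ x) : D.kinetic M x ≤ D.velocity M x * x := by
  simpa only [kinetic_zero, sub_zero] using hM.kinetic_sub_le_velocity_mul_sub le_rfl hx

lemma kinetic_le_rpow_mul (hx : 1 ≤ x) : D.kinetic M x ≤ x ^ D.κ * x :=
  (hM.kinetic_le_velocity_mul (by linarith)).trans
    (mul_le_mul_of_nonneg_right (hM.velocity_le hx) (by linarith))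

lemma kinetic_le_self (h0 : 0 ≤ x) (hx : x ≤ 1) : D.kinetic M x ≤ x := by
  refine (hM.kinetic_le_velocity_mul h0).trans (mul_le_of_le_one_left h0 ?_)
  rw [← hM.velocity_one]
  exact hM.velocity_mono h0 hx

lemma le_kinetic_one : (1 / 2) ^ D.κ * (1 / 2) ≤ D.kinetic M 1 := by
  have hhalf := hM.velocity_mul_sub_le_kinetic_sub (x := 1 / 2) (y := 1) (by norm_num)
    (by norm_num)
  rw [hM.velocity_of_mem ⟨hM.inv_le_half, by linarith [hM.two_le]⟩, sub_half] at hhalf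
  linarith [hM.kinetic_nonneg (1 / 2)]

lemma potential_nonpos (h : |x| ≤ D.β) : D.potential M x ≤ 0 := by
  have := sub_le_of_hasDerivAt_le (abs_nonneg x) hM.continuous_potential.continuousOn
    (fun t _ => hM.hasDerivAt_potential t) (fun t ht => hM.force_nonpos ht.1.le (ht.2.le.trans h))
  rw [potential_zero, hM.potential_abs] at this
  linarith

lemma neg_potential_le (h : |x| ≤ D.β) :
    -D.potential M x ≤ D.C / (1 - D.m) * |x| ^ (1 - D.m) := by
  have := sub_zero_le_of_hasDerivAt_le_rpow (c := D.C) (sub_pos.2 D.m_lt_one) (abs_nonneg x)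
    hM.continuous_potential.neg.continuousOn (fun t _ => (hM.hasDerivAt_potential t).neg)
    fun t ht => by
      rw [sub_sub_cancel_left]
      exact (neg_le_abs _).trans (hM.abs_force_le ht.1 (ht.2.le.trans h))
  simpa only [Pi.neg_apply, hM.potential_abs, potential_zero, neg_zero, sub_zero] using this

lemma abs_potential_le (h : |x| ≤ D.β) :
    |D.potential M x| ≤ D.C / (1 - D.m) * |x| ^ (1 - D.m) := by
  rw [abs_of_nonpos (hM.potential_nonpos h)]
  exact hM.neg_potential_le h

lemma neg_le_potential (x : ℝ) : -(D.C / (1 - D.m) * D.β ^ (1 - D.m)) ≤ D.potential M x := by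
  have hm := D.m_lt_one
  rcases le_total |x| D.β with h | h
  · have hpow : |x| ^ (1 - D.m) ≤ D.β ^ (1 - D.m) :=
      Real.rpow_le_rpow (abs_nonneg _) h (by linarith)
    have hcoef : 0 ≤ D.C / (1 - D.m) := div_nonneg D.C_pos.le (by linarith)
    linarith [hM.neg_potential_le h, mul_le_mul_of_nonneg_left hpow hcoef]
  · have hβ := hM.neg_potential_le (abs_of_pos D.β_pos).le
    rw [abs_of_pos D.β_pos] at hβ
    have hmono := le_of_hasDerivAt_nonneg h hM.continuous_potential.continuousOn
      (fun t _ => hM.hasDerivAt_potential t) fun t ht => hM.force_nonneg ht.1.le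
    rw [hM.potential_abs] at hmono
    linarith

end Admissible

lemma h_antitoneOn : AntitoneOn D.h (Ioc 0 D.T) := by
  refine antitoneOn_of_hasDerivWithinAt_nonpos (f' := D.h') (convex_Ioc 0 D.T) D.h_cont ?_ ?_ <;>
    rw [interior_Ioc]
  exacts [fun t ht => (D.h_deriv t ht).hasDerivWithinAt, D.h'_nonpos]

lemma Admissible.weight_pos (hM : D.Admissible M) {t : ℝ} (ht : t ≤ D.T) : 0 < D.weight M t :=
  D.h_pos _ ⟨lt_max_of_lt_right hM.inv_pos, max_le ht hM.inv_le_T⟩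

lemma Admissible.weight_le (hM : D.Admissible M) {t : ℝ} (h0 : 0 < t) (ht : t ≤ D.T) :
    D.weight M t ≤ D.A * t ^ (-D.q) :=
  (D.h_bound _ ⟨lt_max_of_lt_left h0, max_le ht hM.inv_le_T⟩).trans <|
    mul_le_mul_of_nonneg_left (Real.rpow_le_rpow_of_nonpos h0 (le_max_left _ _)
      (neg_nonpos.2 D.q_nonneg)) D.A_pos.le

lemma Admissible.weight_mul_abs_force_le (hM : D.Admissible M) {t : ℝ} (h0 : 0 < t)
    (ht : t ≤ D.T) (htx : t ≤ x) (hx : x ≤ D.β) :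
    D.weight M t * |D.force M x| ≤ D.C * D.A * t ^ (1 - D.q - D.m - 1) := by
  have hpow : x ^ (-D.m) ≤ t ^ (-D.m) :=
    Real.rpow_le_rpow_of_nonpos h0 htx (neg_nonpos.2 D.m_pos.le)
  have hforce : |D.force M x| ≤ D.C * t ^ (-D.m) :=
    (hM.abs_force_le (h0.trans_le htx) hx).trans (mul_le_mul_of_nonneg_left hpow D.C_pos.le)
  calc D.weight M t * |D.force M x| ≤ D.A * t ^ (-D.q) * (D.C * t ^ (-D.m)) :=
        mul_le_mul (hM.weight_le h0 ht) hforce (abs_nonneg _)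
          ((hM.weight_pos ht).le.trans (hM.weight_le h0 ht))
    _ = D.C * D.A * (t ^ (-D.q) * t ^ (-D.m)) := by ring
    _ = D.C * D.A * t ^ (1 - D.q - D.m - 1) := by
        rw [← Real.rpow_add h0]
        ring_nf

lemma Admissible.continuousOn_weight (hM : D.Admissible M) :
    ContinuousOn (D.weight M) (Icc 0 D.T) :=
  D.h_cont.comp (by fun_prop) fun _ ht =>
    ⟨lt_max_of_lt_right hM.inv_pos, max_le ht.2 hM.inv_le_T⟩

lemma weight_of_ge {t : ℝ} (h : M⁻¹ ≤ t) : D.weight M t = D.h t := by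
  rw [weight, max_eq_left h]

/-- `(v, w)` solves the regularized initial value problem with initial slope `w 0 = a`. -/
structure IsSolution (D : ShootingData) (M a : ℝ) (v w : ℝ → ℝ) : Prop where
  v_zero : v 0 = 0
  w_zero : w 0 = a
  dv : ∀ t ∈ Icc 0 D.T, HasDerivWithinAt v (D.velocity M (w t)) (Icc 0 D.T) t
  dw : ∀ t ∈ Icc 0 D.T, HasDerivWithinAt w (-(D.weight M t * D.force M (v t))) (Icc 0 D.T) t

namespace IsSolution

variable {a s t B : ℝ} {v w : ℝ → ℝ} (S : D.IsSolution M a v w)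
include S

lemma continuousOn_v : ContinuousOn v (Icc 0 D.T) := fun t ht => (S.dv t ht).continuousWithinAt

lemma continuousOn_w : ContinuousOn w (Icc 0 D.T) := fun t ht => (S.dw t ht).continuousWithinAt

lemma hasDerivAt_v (h0 : 0 < t) (h : t < D.T) : HasDerivAt v (D.velocity M (w t)) t :=
  (S.dv t ⟨h0.le, h.le⟩).hasDerivAt (Icc_mem_nhds h0 h)

lemma hasDerivAt_w (h0 : 0 < t) (h : t < D.T) :
    HasDerivAt w (-(D.weight M t * D.force M (v t))) t :=
  (S.dw t ⟨h0.le, h.le⟩).hasDerivAt (Icc_mem_nhds h0 h)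

lemma neg (hM : D.Admissible M) : D.IsSolution M (-a) (fun t => -v t) (fun t => -w t) where
  v_zero := by rw [S.v_zero, neg_zero]
  w_zero := by rw [S.w_zero]
  dv t ht := by
    rw [hM.velocity_neg]
    exact (S.dv t ht).neg
  dw t ht := by
    rw [hM.force_neg, mul_neg]
    exact (S.dw t ht).neg

lemma mul_sub_le_v_sub (h0 : 0 ≤ s) (hst : s ≤ t) (ht : t ≤ D.T)
    (h : ∀ x ∈ Ioo s t, B ≤ D.velocity M (w x)) : B * (t - s) ≤ v t - v s :=
  le_sub_of_le_hasDerivAt hst (S.continuousOn_v.mono (Icc_subset_Icc h0 ht))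
    (fun _ hx => S.hasDerivAt_v (h0.trans_lt hx.1) (hx.2.trans_le ht)) h

lemma v_sub_le_mul_sub (h0 : 0 ≤ s) (hst : s ≤ t) (ht : t ≤ D.T)
    (h : ∀ x ∈ Ioo s t, D.velocity M (w x) ≤ B) : v t - v s ≤ B * (t - s) :=
  sub_le_of_hasDerivAt_le hst (S.continuousOn_v.mono (Icc_subset_Icc h0 ht))
    (fun _ hx => S.hasDerivAt_v (h0.trans_lt hx.1) (hx.2.trans_le ht)) h

lemma mul_sub_le_w_sub (h0 : 0 ≤ s) (hst : s ≤ t) (ht : t ≤ D.T)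
    (h : ∀ x ∈ Ioo s t, B ≤ -(D.weight M x * D.force M (v x))) : B * (t - s) ≤ w t - w s :=
  le_sub_of_le_hasDerivAt hst (S.continuousOn_w.mono (Icc_subset_Icc h0 ht))
    (fun _ hx => S.hasDerivAt_w (h0.trans_lt hx.1) (hx.2.trans_le ht)) h

lemma v_le_v_of_w_nonneg (hM : D.Admissible M) (h0 : 0 ≤ s) (hst : s ≤ t) (ht : t ≤ D.T)
    (hw : ∀ x ∈ Ioo s t, 0 ≤ w x) : v s ≤ v t := by
  have := S.mul_sub_le_v_sub h0 hst ht fun x hx => hM.velocity_nonneg (hw x hx)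
  linarith

lemma w_le_w_of_v_mem (hM : D.Admissible M) (h0 : 0 ≤ s) (hst : s ≤ t) (ht : t ≤ D.T)
    (hv : ∀ x ∈ Ioo s t, v x ∈ Icc 0 D.β) : w s ≤ w t := by
  have := S.mul_sub_le_w_sub h0 hst ht fun x hx => neg_nonneg.2 <|
    mul_nonpos_of_nonneg_of_nonpos (hM.weight_pos (hx.2.le.trans ht)).le
      (hM.force_nonpos (hv x hx).1 (hv x hx).2)
  linarith

lemma abs_v_sub_le (hM : D.Admissible M) {W : ℝ} (hW1 : 1 ≤ W)
    (hW : ∀ t ∈ Icc 0 D.T, |w t| ≤ W) (h0 : 0 ≤ s) (hst : s ≤ t) (ht : t ≤ D.T) :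
    |v t - v s| ≤ W ^ D.κ * (t - s) :=
  abs_sub_le_of_abs_hasDerivAt_le hst
    (S.continuousOn_v.mono (Icc_subset_Icc h0 ht))
    (fun _ hx => S.hasDerivAt_v (h0.trans_lt hx.1) (hx.2.trans_le ht))
    (fun x hx => hM.abs_velocity_le hW1 (hW x ⟨h0.trans hx.1.le, hx.2.le.trans ht⟩))

end IsSolution

/-- `h` times the energy `kinetic / h + potential` of a solution; the quotient by `h` is the
quantity that increases in `t`. -/
noncomputable def energy (D : ShootingData) (M : ℝ) (v w : ℝ → ℝ) (t : ℝ) : ℝ :=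
  D.kinetic M (w t) + D.h t * D.potential M (v t)

namespace IsSolution

variable {a s t B : ℝ} {v w : ℝ → ℝ} (S : D.IsSolution M a v w) (hM : D.Admissible M)
include S hM

lemma continuousOn_energy (h0 : 0 < s) : ContinuousOn (D.energy M v w) (Icc s D.T) := by
  have hsub : Icc s D.T ⊆ Icc 0 D.T := Icc_subset_Icc h0.le le_rfl
  exact (hM.continuous_kinetic.comp_continuousOn (S.continuousOn_w.mono hsub)).add
    ((D.h_cont.mono fun x hx => ⟨h0.trans_le hx.1, hx.2⟩).mul
      (hM.continuous_potential.comp_continuousOn (S.continuousOn_v.mono hsub)))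

lemma hasDerivAt_energy (h0 : M⁻¹ ≤ t) (h : t < D.T) :
    HasDerivAt (D.energy M v w) (D.h' t * D.potential M (v t)) t := by
  have ht := hM.inv_pos.trans_le h0
  have hkin := (hM.hasDerivAt_kinetic (w t)).comp t (S.hasDerivAt_w ht h)
  have hpot := (D.h_deriv t ⟨ht, h⟩).mul
    ((hM.hasDerivAt_potential (v t)).comp t (S.hasDerivAt_v ht h))
  have hsum := hkin.add hpot
  rw [weight_of_ge h0] at hsum
  refine hsum.congr_deriv ?_
  simp only [Function.comp_apply]
  ring

lemma energy_sub_mul_le_of_potential_le (h0 : M⁻¹ ≤ s) (hst : s ≤ t) (ht : t ≤ D.T)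
    (hB : ∀ x ∈ Icc s t, D.potential M (v x) ≤ B) :
    D.energy M v w s - B * D.h s ≤ D.energy M v w t - B * D.h t := by
  have hs := hM.inv_pos.trans_le h0
  refine le_of_hasDerivAt_nonneg (g := fun x => D.energy M v w x - B * D.h x) hst
    (((S.continuousOn_energy hM hs).mono (Icc_subset_Icc le_rfl ht)).sub
      (continuousOn_const.mul (D.h_cont.mono fun x hx => ⟨hs.trans_le hx.1, hx.2.trans ht⟩)))
    (fun x hx => (S.hasDerivAt_energy hM (h0.trans hx.1.le) (hx.2.trans_le ht)).sub
      ((D.h_deriv x ⟨hs.trans hx.1, hx.2.trans_le ht⟩).const_mul B)) fun x hx => ?_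
  have hh' := D.h'_nonpos x ⟨hs.trans hx.1, hx.2.trans_le ht⟩
  nlinarith [hB x (Ioo_subset_Icc_self hx)]

lemma energy_sub_mul_le_of_le_potential (h0 : M⁻¹ ≤ s) (hst : s ≤ t) (ht : t ≤ D.T)
    (hB : ∀ x ∈ Icc s t, B ≤ D.potential M (v x)) :
    D.energy M v w t - B * D.h t ≤ D.energy M v w s - B * D.h s := by
  have hs := hM.inv_pos.trans_le h0
  refine sub_nonpos.1 <| (sub_le_of_hasDerivAt_le (g := fun x => D.energy M v w x - B * D.h x)
    (B := 0) hst
    (((S.continuousOn_energy hM hs).mono (Icc_subset_Icc le_rfl ht)).sub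
      (continuousOn_const.mul (D.h_cont.mono fun x hx => ⟨hs.trans_le hx.1, hx.2.trans ht⟩)))
    (fun x hx => (S.hasDerivAt_energy hM (h0.trans hx.1.le) (hx.2.trans_le ht)).sub
      ((D.h_deriv x ⟨hs.trans hx.1, hx.2.trans_le ht⟩).const_mul B)) fun x hx => ?_).trans_eq
    (zero_mul _)
  have hh' := D.h'_nonpos x ⟨hs.trans hx.1, hx.2.trans_le ht⟩
  nlinarith [hB x (Ioo_subset_Icc_self hx)]

lemma energy_div_h_mono (h0 : M⁻¹ ≤ s) (hst : s ≤ t) (ht : t ≤ D.T) :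
    D.energy M v w s / D.h s ≤ D.energy M v w t / D.h t := by
  have hs := hM.inv_pos.trans_le h0
  have hpos : ∀ x ∈ Icc s t, 0 < D.h x := fun x hx =>
    D.h_pos x ⟨hs.trans_le hx.1, hx.2.trans ht⟩
  refine le_of_hasDerivAt_nonneg (g := fun x => D.energy M v w x / D.h x) hst
    (((S.continuousOn_energy hM hs).mono (Icc_subset_Icc le_rfl ht)).div
      (D.h_cont.mono fun x hx => ⟨hs.trans_le hx.1, hx.2.trans ht⟩) fun x hx => (hpos x hx).ne')
    (fun x hx => (S.hasDerivAt_energy hM (h0.trans hx.1.le) (hx.2.trans_le ht)).div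
      (D.h_deriv x ⟨hs.trans hx.1, hx.2.trans_le ht⟩) (hpos x (Ioo_subset_Icc_self hx)).ne')
    fun x hx => div_nonneg ?_ (sq_nonneg _)
  have hh' := D.h'_nonpos x ⟨hs.trans hx.1, hx.2.trans_le ht⟩
  have hkin := hM.kinetic_nonneg (w x)
  calc 0 ≤ -D.h' x * D.kinetic M (w x) := mul_nonneg (neg_nonneg.2 hh') hkin
    _ = D.h' x * D.potential M (v x) * D.h x - D.energy M v w x * D.h' x := by
      rw [energy]; ring

end IsSolution

end ShootingData

/-! ### Bounds uniform in the regularization -/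

namespace ShootingData

variable {D : ShootingData} {M a : ℝ} {v w : ℝ → ℝ}

lemma one_sub_q_sub_m_pos (D : ShootingData) : 0 < 1 - D.q - D.m := by
  linarith [D.q_add_m_lt_one]

/-- An upper bound for `w` on the initial interval where `0 ≤ v ≤ β`, for the initial slope `a`. -/
noncomputable def topSlope (D : ShootingData) (a : ℝ) : ℝ :=
  a + D.C * D.A / (1 - D.q - D.m) * D.T ^ (1 - D.q - D.m)

lemma le_topSlope (D : ShootingData) (a : ℝ) : a ≤ D.topSlope a :=
  le_add_of_nonneg_right <| mul_nonneg
    (div_nonneg (mul_nonneg D.C_pos.le D.A_pos.le) D.one_sub_q_sub_m_pos.le)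
    (Real.rpow_nonneg D.T_pos.le _)

lemma topSlope_mono (D : ShootingData) : Monotone D.topSlope := fun _ _ h =>
  add_le_add_left h _

namespace IsSolution

section InitialPhase

variable (S : D.IsSolution M a v w) (hM : D.Admissible M)
include S hM

lemma v_nonneg_of_w_nonneg {t : ℝ} (h0 : 0 ≤ t) (ht : t ≤ D.T) (hw : ∀ s ∈ Ioo 0 t, 0 ≤ w s) :
    0 ≤ v t := by
  simpa only [S.v_zero] using S.v_le_v_of_w_nonneg hM le_rfl h0 ht hw

variable {τ : ℝ} (hτ : τ ≤ D.T) (hv : ∀ s ∈ Ico 0 τ, v s < D.β)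
include hτ hv

lemma le_w_of_w_pos_of_v_lt_β {t : ℝ} (ht : t ∈ Icc 0 τ) (hw : ∀ s ∈ Ico 0 t, 0 < w s) :
    a ≤ w t := by
  simpa only [S.w_zero] using S.w_le_w_of_v_mem hM le_rfl ht.1 (ht.2.trans hτ) fun s hs =>
    ⟨S.v_nonneg_of_w_nonneg hM hs.1.le (hs.2.le.trans (ht.2.trans hτ))
      fun x hx => (hw x ⟨hx.1.le, hx.2.trans hs.2⟩).le, (hv s ⟨hs.1.le, hs.2.trans_le ht.2⟩).le⟩

lemma le_w_of_v_lt_β (ha : 0 < a) : ∀ s ∈ Icc 0 τ, a ≤ w s := by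
  have hpos : ∀ s ∈ Icc 0 τ, 0 < w s :=
    forall_lt_of_forall_Ico_lt (S.continuousOn_w.mono (Icc_subset_Icc le_rfl hτ))
      fun t ht hw => ha.trans_le (S.le_w_of_w_pos_of_v_lt_β hM hτ hv ht hw)
  exact fun s hs => S.le_w_of_w_pos_of_v_lt_β hM hτ hv hs
    fun x hx => hpos x ⟨hx.1, hx.2.le.trans hs.2⟩

variable (ha : 1 ≤ a)
include ha

lemma le_v_of_v_lt_β : ∀ s ∈ Icc 0 τ, s ≤ v s := by
  intro s hs
  have hslope := S.mul_sub_le_v_sub (B := 1) le_rfl hs.1 (hs.2.trans hτ) fun t ht => by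
    rw [← hM.velocity_one]
    exact hM.velocity_mono zero_le_one
      (ha.trans (S.le_w_of_v_lt_β hM hτ hv (by linarith) t ⟨ht.1.le, ht.2.le.trans hs.2⟩))
  rwa [S.v_zero, one_mul, sub_zero, sub_zero] at hslope

lemma w_le_topSlope : ∀ s ∈ Icc 0 τ, w s ≤ D.topSlope a := by
  intro s hs
  have hσ := D.one_sub_q_sub_m_pos
  have hgrowth : w s - w 0 ≤ D.C * D.A / (1 - D.q - D.m) * s ^ (1 - D.q - D.m) := by
    refine sub_zero_le_of_hasDerivAt_le_rpow hσ hs.1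
      (S.continuousOn_w.mono (Icc_subset_Icc le_rfl (hs.2.trans hτ)))
      (fun t ht => S.hasDerivAt_w ht.1 (ht.2.trans_le (hs.2.trans hτ))) fun t ht => ?_
    have htτ : t < τ := ht.2.trans_le hs.2
    refine le_trans ?_ (hM.weight_mul_abs_force_le ht.1 (htτ.le.trans hτ)
      (S.le_v_of_v_lt_β hM hτ hv ha t ⟨ht.1.le, htτ.le⟩) (hv t ⟨ht.1.le, htτ⟩).le)
    rw [← mul_neg]
    exact mul_le_mul_of_nonneg_left (neg_le_abs _) (hM.weight_pos (htτ.le.trans hτ)).le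
  have hpow : s ^ (1 - D.q - D.m) ≤ D.T ^ (1 - D.q - D.m) :=
    Real.rpow_le_rpow hs.1 (hs.2.trans hτ) hσ.le
  have hcoef : 0 ≤ D.C * D.A / (1 - D.q - D.m) :=
    div_nonneg (mul_nonneg D.C_pos.le D.A_pos.le) hσ.le
  have := mul_le_mul_of_nonneg_left hpow hcoef
  rw [S.w_zero] at hgrowth
  rw [topSlope]
  linarith

lemma v_le_topSlope_rpow_mul : ∀ s ∈ Icc 0 τ, v s ≤ D.topSlope a ^ D.κ * s := by
  intro s hs
  have hslope := S.v_sub_le_mul_sub (B := D.topSlope a ^ D.κ) le_rfl hs.1 (hs.2.trans hτ)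
    fun t ht => by
      have htτ : t ∈ Icc 0 τ := ⟨ht.1.le, ht.2.le.trans hs.2⟩
      have hw0 : 0 ≤ w t := by linarith [S.le_w_of_v_lt_β hM hτ hv (by linarith) t htτ]
      exact (hM.velocity_mono hw0 (S.w_le_topSlope hM hτ hv ha t htτ)).trans
        (hM.velocity_le (ha.trans (D.le_topSlope a)))
  rwa [S.v_zero, sub_zero, sub_zero] at hslope

end InitialPhase

variable (S : D.IsSolution M a v w) (hM : D.Admissible M)
include S hM

lemma v_lt_β {a₁ t₀ : ℝ} (ha : 1 ≤ a) (ha₁ : a ≤ a₁) (h0T : t₀ ≤ D.T)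
    (ht₀ : D.topSlope a₁ ^ D.κ * t₀ < D.β) : ∀ s ∈ Icc 0 t₀, v s < D.β := by
  have htop : 1 ≤ D.topSlope a := ha.trans (D.le_topSlope a)
  have hpow : D.topSlope a ^ D.κ ≤ D.topSlope a₁ ^ D.κ :=
    Real.rpow_le_rpow (by linarith) (D.topSlope_mono ha₁) D.κ_pos.le
  have hpos : 0 ≤ D.topSlope a₁ ^ D.κ :=
    Real.rpow_nonneg (by linarith [D.topSlope_mono ha₁]) _
  have hneg : ∀ s ∈ Icc 0 t₀, -D.β < -v s := by
    refine forall_lt_of_forall_Ico_lt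
      (S.continuousOn_v.neg.mono (Icc_subset_Icc le_rfl h0T)) fun τ hτ h => neg_lt_neg ?_
    calc v τ ≤ D.topSlope a ^ D.κ * τ :=
          S.v_le_topSlope_rpow_mul hM (hτ.2.trans h0T) (fun s hs => neg_lt_neg_iff.1 (h s hs))
            ha τ ⟨hτ.1, le_rfl⟩
      _ ≤ D.topSlope a₁ ^ D.κ * t₀ := mul_le_mul hpow hτ.2 hτ.1 hpos
      _ < D.β := ht₀
  exact fun s hs => neg_lt_neg_iff.1 (hneg s hs)

lemma initial_bounds {a₁ t₀ : ℝ} (ha : 1 ≤ a) (ha₁ : a ≤ a₁) (h0T : t₀ ≤ D.T)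
    (ht₀ : D.topSlope a₁ ^ D.κ * t₀ < D.β) :
    ∀ s ∈ Icc 0 t₀, a ≤ w s ∧ s ≤ v s ∧ w s ≤ D.topSlope a₁ ∧
      v s ≤ D.topSlope a₁ ^ D.κ * s := by
  have hv : ∀ s ∈ Ico 0 t₀, v s < D.β := fun s hs =>
    S.v_lt_β hM ha ha₁ h0T ht₀ s ⟨hs.1, hs.2.le⟩
  have htop : 0 ≤ D.topSlope a := by linarith [D.le_topSlope a]
  refine fun s hs => ⟨S.le_w_of_v_lt_β hM h0T hv (by linarith) s hs,
    S.le_v_of_v_lt_β hM h0T hv ha s hs,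
    (S.w_le_topSlope hM h0T hv ha s hs).trans (D.topSlope_mono ha₁),
    (S.v_le_topSlope_rpow_mul hM h0T hv ha s hs).trans ?_⟩
  exact mul_le_mul_of_nonneg_right
    (Real.rpow_le_rpow htop (D.topSlope_mono ha₁) D.κ_pos.le) hs.1

end IsSolution

lemma exists_pos_mul_lt_β_rpow_le (D : ShootingData) {P c e : ℝ} (he : 0 < e) :
    ∃ t, 0 < t ∧ t ≤ D.T ∧ P * t < D.β ∧ c * t ^ (1 - D.q - D.m) ≤ e := by
  have hσ := D.one_sub_q_sub_m_pos
  have hlin : Tendsto (fun t : ℝ => P * t) (𝓝 0) (𝓝 0) := by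
    have : Continuous fun t : ℝ => P * t := by fun_prop
    simpa using this.tendsto 0
  have hpow : Tendsto (fun t : ℝ => c * t ^ (1 - D.q - D.m)) (𝓝 0) (𝓝 0) := by
    have : Continuous fun t : ℝ => c * t ^ (1 - D.q - D.m) :=
      continuous_const.mul (Real.continuous_rpow_const hσ.le)
    simpa [Real.zero_rpow hσ.ne'] using this.tendsto 0
  have hsmall : ∀ᶠ t in 𝓝[>] (0 : ℝ), t ≤ D.T ∧ P * t < D.β ∧ c * t ^ (1 - D.q - D.m) ≤ e :=
    nhdsWithin_le_nhds ((eventually_le_nhds D.T_pos).and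
      ((hlin.eventually_lt_const D.β_pos).and (hpow.eventually_le_const he)))
  obtain ⟨t, ht, ht0⟩ := (hsmall.and self_mem_nhdsWithin).exists
  exact ⟨t, ht0, ht⟩

lemma rpow_q_mul_le_div_h {t c k : ℝ} (h0 : 0 < t) (ht : t ≤ D.T) (hc : 0 ≤ c) (hck : c ≤ k) :
    t ^ D.q * (c / D.A) ≤ k / D.h t := by
  have hA := D.A_pos
  rw [le_div_iff₀ (D.h_pos t ⟨h0, ht⟩)]
  calc t ^ D.q * (c / D.A) * D.h t ≤ t ^ D.q * (c / D.A) * (D.A * t ^ (-D.q)) := by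
        gcongr
        exact D.h_bound t ⟨h0, ht⟩
    _ = c * (t ^ D.q * t ^ (-D.q)) := by field_simp
    _ = c := by rw [← Real.rpow_add h0, add_neg_cancel, Real.rpow_zero, mul_one]
    _ ≤ k := hck

/-- The kinetic term `w / h` is at least of order `t ^ q`, while the potential term is at most of
order `t ^ (1 - m)`, which is smaller since `q + m < 1`. -/
lemma exists_le_energy_div_h (D : ShootingData) {P : ℝ} (hP : 0 ≤ P) :
    ∃ t e, 0 < t ∧ t ≤ D.T ∧ P * t < D.β ∧ 0 < e ∧ ∀ M, D.Admissible M → ∀ v w : ℝ → ℝ,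
      1 ≤ w t → |v t| ≤ P * t → e ≤ D.energy M v w t / D.h t := by
  have hA := D.A_pos
  have hm : 0 < 1 - D.m := sub_pos.2 D.m_lt_one
  have hcoef : 0 ≤ D.C / (1 - D.m) := div_nonneg D.C_pos.le hm.le
  set k₁ : ℝ := (1 / 2) ^ D.κ * (1 / 2)
  have hk₁_pos : 0 < k₁ := by positivity
  set e := k₁ / D.A / 2
  obtain ⟨t, ht0, htT, htβ, hte⟩ := D.exists_pos_mul_lt_β_rpow_le (P := P)
    (c := D.C / (1 - D.m) * P ^ (1 - D.m)) (e := e) (by positivity)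
  refine ⟨t, t ^ D.q * e, ht0, htT, htβ, by positivity, fun M hM v w hw hv => ?_⟩
  have hkin : t ^ D.q * (k₁ / D.A) ≤ D.kinetic M (w t) / D.h t :=
    rpow_q_mul_le_div_h ht0 htT hk₁_pos.le
      (hM.le_kinetic_one.trans (hM.kinetic_mono zero_le_one hw))
  have hpot : -D.potential M (v t) ≤ t ^ D.q * e := calc
    -D.potential M (v t) ≤ D.C / (1 - D.m) * |v t| ^ (1 - D.m) :=
        hM.neg_potential_le (hv.trans htβ.le)
    _ ≤ D.C / (1 - D.m) * (P * t) ^ (1 - D.m) := by gcongr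
    _ = t ^ D.q * (D.C / (1 - D.m) * P ^ (1 - D.m) * t ^ (1 - D.q - D.m)) := by
        rw [Real.mul_rpow hP ht0.le, show 1 - D.m = D.q + (1 - D.q - D.m) by ring,
          Real.rpow_add ht0]
        ring_nf
    _ ≤ t ^ D.q * e := by gcongr
  have hsplit : D.energy M v w t / D.h t = D.kinetic M (w t) / D.h t + D.potential M (v t) := by
    rw [energy, add_div, mul_div_cancel_left₀ _ (D.h_pos t ⟨ht0, htT⟩).ne']
  have hhalf : t ^ D.q * (k₁ / D.A) = t ^ D.q * e + t ^ D.q * e := by ring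
  linarith

namespace IsSolution

variable (S : D.IsSolution M a v w) (hM : D.Admissible M) {s t E : ℝ}
include S hM

lemma abs_w_le_of_energy_le (h0 : M⁻¹ ≤ s) (hst : s ≤ t) (ht : t ≤ D.T)
    (hE : D.energy M v w s ≤ E) :
    |w t| ≤ E + D.C / (1 - D.m) * D.β ^ (1 - D.m) * D.h s + 1 := by
  have hmono := S.energy_sub_mul_le_of_le_potential hM h0 hst ht fun x _ =>
    hM.neg_le_potential (v x)
  have hpot := mul_le_mul_of_nonneg_left (hM.neg_le_potential (v t))
    (D.h_pos t ⟨hM.inv_pos.trans_le (h0.trans hst), ht⟩).le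
  have hkin := hM.abs_le_kinetic_add_one (w t)
  rw [energy.eq_1 D M v w t] at hmono
  linarith

lemma min_le_abs_w_of_le_energy_div_h (hE0 : 0 ≤ E) (h0 : M⁻¹ ≤ s) (hst : s ≤ t) (ht : t ≤ D.T)
    (hE : E ≤ D.energy M v w s / D.h s) (hv : |v t| ≤ D.β) : min 1 (D.h D.T * E) ≤ |w t| := by
  have ht0 : t ∈ Ioc 0 D.T := ⟨hM.inv_pos.trans_le (h0.trans hst), ht⟩
  have hh := D.h_pos t ht0
  have henergy : E * D.h t ≤ D.energy M v w t :=
    (le_div_iff₀ hh).1 (hE.trans (S.energy_div_h_mono hM h0 hst ht))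
  have hpot := mul_nonpos_of_nonneg_of_nonpos hh.le (hM.potential_nonpos hv)
  have hanti := mul_le_mul_of_nonneg_left
    (h_antitoneOn ht0 (right_mem_Ioc.2 D.T_pos) ht) hE0
  rcases le_total |w t| 1 with hw | hw
  · have hkin := hM.kinetic_le_self (abs_nonneg _) hw
    rw [hM.kinetic_abs] at hkin
    rw [energy] at henergy
    exact (min_le_right _ _).trans (by linarith)
  · exact (min_le_left _ _).trans hw

end IsSolution

/-- A priori bounds for a solution, to hold with constants independent of the regularization
parameter `M`. -/
structure Bounds (D : ShootingData) (W w₀ t₂ : ℝ) (v w : ℝ → ℝ) : Prop where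
  le_v : ∀ t ∈ Icc 0 t₂, t ≤ v t
  abs_w_le : ∀ t ∈ Icc 0 D.T, |w t| ≤ W
  le_abs_w : ∀ t ∈ Icc 0 D.T, |v t| ≤ D.β → w₀ ≤ |w t|

lemma exists_uniform_bounds (D : ShootingData) {a₁ : ℝ} (ha₁ : 1 ≤ a₁) :
    ∃ W w₀ t₂, 1 ≤ W ∧ 0 < w₀ ∧ 0 < t₂ ∧ ∀ M, D.Admissible M → M⁻¹ ≤ t₂ →
      ∀ a ∈ Icc 1 a₁, ∀ v w, D.IsSolution M a v w → D.Bounds W w₀ t₂ v w := by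
  set P := D.topSlope a₁
  have hP1 : 1 ≤ P := ha₁.trans (D.le_topSlope a₁)
  obtain ⟨t₂, E, ht0, htT, htβ, hE, henergy⟩ :=
    D.exists_le_energy_div_h (P := P ^ D.κ) (by positivity)
  have hh := D.h_pos t₂ ⟨ht0, htT⟩
  have hhT := D.h_pos D.T (right_mem_Ioc.2 D.T_pos)
  have hwell : 0 ≤ D.C / (1 - D.m) * D.β ^ (1 - D.m) * D.h t₂ :=
    mul_nonneg (mul_nonneg (div_nonneg D.C_pos.le (sub_pos.2 D.m_lt_one).le)
      (Real.rpow_nonneg D.β_pos.le _)) hh.le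
  have hPP : 0 ≤ P ^ D.κ * P := by positivity
  refine ⟨P + (P ^ D.κ * P + D.C / (1 - D.m) * D.β ^ (1 - D.m) * D.h t₂ + 1),
    min 1 (D.h D.T * E), t₂, by linarith, lt_min one_pos (by positivity), ht0,
    fun M hM hMt a ha v w S => ?_⟩
  have init := S.initial_bounds hM ha.1 ha.2 htT htβ
  obtain ⟨hwa, hvt, hwP, hvP⟩ := init t₂ ⟨ht0.le, le_rfl⟩
  have habs : |v t₂| ≤ P ^ D.κ * t₂ := by rwa [abs_of_nonneg (ht0.le.trans hvt)]
  have hupper : D.energy M v w t₂ ≤ P ^ D.κ * P := by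
    have hkin := (hM.kinetic_mono (by linarith [ha.1]) hwP).trans (hM.kinetic_le_rpow_mul hP1)
    have hpot := mul_nonpos_of_nonneg_of_nonpos hh.le (hM.potential_nonpos (habs.trans htβ.le))
    rw [energy]
    linarith
  refine ⟨fun t ht => (init t ht).2.1, fun t ht => ?_, fun t ht hvβ => ?_⟩
  · rcases le_total t t₂ with h | h
    · obtain ⟨hwa, -, hwP, -⟩ := init t ⟨ht.1, h⟩
      rw [abs_of_nonneg (by linarith [ha.1])]
      linarith
    · linarith [S.abs_w_le_of_energy_le hM hMt h ht.2 hupper]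
  · rcases le_total t t₂ with h | h
    · exact (min_le_left _ _).trans
        ((ha.1.trans (init t ⟨ht.1, h⟩).1).trans (le_abs_self _))
    · exact S.min_le_abs_w_of_le_energy_div_h hM hE.le hMt h ht.2
        (henergy M hM v w (ha.1.trans hwa) habs) hvβ

lemma Bounds.div_le_sub_of_v_eq_zero {W w₀ t₂ : ℝ} (B : D.Bounds W w₀ t₂ v w)
    (S : D.IsSolution M a v w) (hM : D.Admissible M) (hW : 1 ≤ W) (hw₀ : 0 < w₀) {s t : ℝ}
    (hs : 0 ≤ s) (hst : s < t) (ht : t ≤ D.T) (hvs : v s = 0) (hvt : v t = 0) :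
    D.β / W ^ D.κ ≤ t - s := by
  obtain ⟨ξ, hξ, hw⟩ := exists_hasDerivAt_eq_zero hst
    (S.continuousOn_v.mono (Icc_subset_Icc hs ht)) (hvs.trans hvt.symm)
    (fun x hx => S.hasDerivAt_v (hs.trans_lt hx.1) (hx.2.trans_le ht))
  rw [hM.velocity_eq_zero_iff] at hw
  have hξT : ξ ∈ Icc 0 D.T := ⟨hs.trans hξ.1.le, hξ.2.le.trans ht⟩
  have hβ : D.β < |v ξ| := by
    by_contra! hvβ
    have := B.le_abs_w ξ hξT hvβ
    rw [hw, abs_zero] at this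
    linarith
  have hrise := S.abs_v_sub_le hM hW B.abs_w_le hs hξ.1.le hξT.2
  rw [hvs, sub_zero] at hrise
  have hWκ : 0 < W ^ D.κ := Real.rpow_pos_of_pos (by linarith) _
  rw [div_le_iff₀ hWκ]
  linarith [mul_le_mul_of_nonneg_left (sub_le_sub_right hξ.2.le s) hWκ.le]

end ShootingData

/-! ### Oscillation for large initial slopes -/

lemma forall_lt_or_forall_lt_neg {g : ℝ → ℝ} {a b c : ℝ} (hc : 0 ≤ c)
    (hg : ContinuousOn g (Icc a b)) (h : ∀ t ∈ Icc a b, c < |g t|) :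
    (∀ t ∈ Icc a b, c < g t) ∨ ∀ t ∈ Icc a b, g t < -c := by
  by_contra! hcon
  obtain ⟨⟨s, hs, hgs⟩, t, ht, hgt⟩ := hcon
  have hneg : g s < -c := lt_neg.1 ((lt_abs.1 (h s hs)).resolve_left hgs.not_gt)
  have hpos : c < g t := (lt_abs.1 (h t ht)).resolve_right (by linarith)
  obtain ⟨x, hx, hx0⟩ := isPreconnected_Icc.intermediate_value hs ht hg
    (show (0 : ℝ) ∈ Icc (g s) (g t) from ⟨by linarith, by linarith⟩)
  have := h x hx
  rw [hx0, abs_zero] at this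
  linarith

namespace ShootingData

variable {D : ShootingData} {M a : ℝ} {v w : ℝ → ℝ}

namespace IsSolution

section LargeSlope

variable (S : D.IsSolution M a v w) (hM : D.Admissible M) (ha : 2 ≤ a) {ℓ P B : ℝ}
  (hℓT : ℓ ≤ D.T) (hB : 0 ≤ B) (hf : ∀ x, 0 ≤ x → x ≤ P → D.force M x ≤ B)
  (hBa : B * D.A / (1 - D.q) * ℓ ^ (1 - D.q) < a / 2)
include S hM ha hℓT hB hf hBa

lemma half_lt_w_of_v_lt (hv : ∀ t ∈ Icc 0 ℓ, v t < P) : ∀ t ∈ Icc 0 ℓ, a / 2 < w t := by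
  have hq : 0 < 1 - D.q := by linarith [D.q_add_m_lt_one, D.m_pos]
  refine forall_lt_of_forall_Ico_lt (S.continuousOn_w.mono (Icc_subset_Icc le_rfl hℓT))
    fun τ hτ hw => ?_
  have hdrop : -w τ - -w 0 ≤ B * D.A / (1 - D.q) * τ ^ (1 - D.q) := by
    refine sub_zero_le_of_hasDerivAt_le_rpow hq hτ.1
      (S.continuousOn_w.mono (Icc_subset_Icc le_rfl (hτ.2.trans hℓT))).neg
      (fun t ht => (S.hasDerivAt_w ht.1 (ht.2.trans_le (hτ.2.trans hℓT))).neg) fun t ht => ?_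
    have htT : t ≤ D.T := ht.2.le.trans (hτ.2.trans hℓT)
    have hv0 : 0 ≤ v t := S.v_nonneg_of_w_nonneg hM ht.1.le htT
      fun s hs => by linarith [hw s ⟨hs.1.le, hs.2.trans ht.2⟩]
    have hforce := hf _ hv0 (hv t ⟨ht.1.le, ht.2.le.trans hτ.2⟩).le
    calc - -(D.weight M t * D.force M (v t)) = D.weight M t * D.force M (v t) := neg_neg _
      _ ≤ D.weight M t * B := mul_le_mul_of_nonneg_left hforce (hM.weight_pos htT).le
      _ ≤ D.A * t ^ (-D.q) * B := mul_le_mul_of_nonneg_right (hM.weight_le ht.1 htT) hB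
      _ = B * D.A * t ^ (1 - D.q - 1) := by rw [sub_sub_cancel_left]; ring
  have hcoef : 0 ≤ B * D.A / (1 - D.q) := div_nonneg (mul_nonneg hB D.A_pos.le) hq.le
  have hpow := mul_le_mul_of_nonneg_left (Real.rpow_le_rpow hτ.1 hτ.2 hq.le) hcoef
  rw [S.w_zero] at hdrop
  linarith

lemma exists_le_v (haM : a ≤ M) (hℓ : 0 < ℓ) (hP : P ≤ (a / 2) ^ D.κ * ℓ) :
    ∃ t ∈ Icc 0 ℓ, P ≤ v t := by
  by_contra! hv
  have hslope := S.mul_sub_le_v_sub (B := (a / 2) ^ D.κ) le_rfl hℓ.le hℓT fun t ht => by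
    rw [← hM.velocity_of_mem ⟨by linarith [hM.inv_le_half], by linarith⟩]
    exact hM.velocity_mono (by linarith)
      (S.half_lt_w_of_v_lt hM ha hℓT hB hf hBa hv t (Ioo_subset_Icc_self ht)).le
  rw [S.v_zero, sub_zero, sub_zero] at hslope
  linarith [hv ℓ (right_mem_Icc.2 hℓ.le)]

end LargeSlope

lemma exists_le_v_of_lt_abs_w (S : D.IsSolution M a v w) (hM : D.Admissible M) {s d P ω : ℝ}
    (hs : 0 ≤ s) (hd : 0 ≤ d) (hsT : s + d ≤ D.T) (hω1 : 1 ≤ ω) (hωM : ω ≤ M)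
    (hω : P < ω ^ D.κ * d) (hv : ∀ t ∈ Icc s (s + d), 0 < v t)
    (hw : ∀ t ∈ Icc s (s + d), |v t| ≤ P → ω < |w t|) : ∃ t ∈ Icc s (s + d), P ≤ v t := by
  by_contra! hvP
  have hsd : s ≤ s + d := le_add_of_nonneg_right hd
  have hψ : D.velocity M ω = ω ^ D.κ := hM.velocity_of_mem ⟨hM.inv_le_one.trans hω1, hωM⟩
  have hwlarge : ∀ t ∈ Icc s (s + d), ω < |w t| := fun t ht =>
    hw t ht (by rw [abs_of_pos (hv t ht)]; exact (hvP t ht).le)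
  rcases forall_lt_or_forall_lt_neg (by linarith)
      (S.continuousOn_w.mono (Icc_subset_Icc hs hsT)) hwlarge with h | h
  · have hrise := S.mul_sub_le_v_sub (B := ω ^ D.κ) hs hsd hsT fun t ht => by
      rw [← hψ]
      exact hM.velocity_mono (by linarith) (h t (Ioo_subset_Icc_self ht)).le
    rw [add_sub_cancel_left] at hrise
    linarith [hvP _ (right_mem_Icc.2 hsd), hv _ (left_mem_Icc.2 hsd)]
  · have hfall := S.v_sub_le_mul_sub (B := -ω ^ D.κ) hs hsd hsT fun t ht => by
      rw [← hψ, le_neg, ← hM.velocity_neg]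
      exact hM.velocity_mono (by linarith) (le_neg.1 (h t (Ioo_subset_Icc_self ht)).le)
    rw [add_sub_cancel_left] at hfall
    linarith [hvP _ (left_mem_Icc.2 hsd), hv _ (right_mem_Icc.2 hsd)]

/-- A positive interior minimum of `v` would be a zero of `w`. -/
lemma le_v_of_w_ne_zero (S : D.IsSolution M a v w) (hM : D.Admissible M) {s t P : ℝ}
    (hs : 0 ≤ s) (hst : s ≤ t) (ht : t ≤ D.T) (hvs : P ≤ v s) (hvt : P ≤ v t)
    (hw : ∀ x ∈ Icc s t, v x ≤ P → w x ≠ 0) : ∀ x ∈ Icc s t, P ≤ v x := by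
  obtain ⟨ξ, hξ, hmin⟩ := isCompact_Icc.exists_isMinOn (nonempty_Icc.2 hst)
    (S.continuousOn_v.mono (Icc_subset_Icc hs ht))
  suffices P ≤ v ξ from fun x hx => this.trans (hmin hx)
  by_contra! hlt
  have hsξ : s < ξ := lt_of_le_of_ne hξ.1 (by rintro rfl; linarith)
  have hξt : ξ < t := lt_of_le_of_ne hξ.2 (by rintro rfl; linarith)
  have hcrit := (hmin.isLocalMin (Icc_mem_nhds hsξ hξt)).hasDerivAt_eq_zero
    (S.hasDerivAt_v (hs.trans_lt hsξ) (hξt.trans_le ht))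
  exact hw ξ hξ hlt.le (hM.velocity_eq_zero_iff.1 hcrit)

end IsSolution

lemma false_of_superlinear (hM : D.Admissible M) {d b V w₁ : ℝ} (hd : 0 < d) (hV : 1 ≤ V)
    (hw₁ : w₁ ≤ M) (hMd : M⁻¹ ≤ d⁻¹ ^ (1 / D.κ)) (hb : d⁻¹ ^ (1 / D.κ) < b)
    (hrise : d * D.velocity M w₁ ≤ V) (hfall : b * V ^ (1 / D.κ) ≤ w₁) : False := by
  have hκ := D.κ_pos
  have hV1 : 1 ≤ V ^ (1 / D.κ) := Real.one_le_rpow hV (by positivity)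
  have hdV : 0 ≤ d⁻¹ * V := by positivity
  have hlow : d⁻¹ ^ (1 / D.κ) * V ^ (1 / D.κ) < w₁ :=
    (mul_lt_mul_of_pos_right hb (by linarith)).trans_le hfall
  have hMw : M⁻¹ ≤ w₁ :=
    (hMd.trans (le_mul_of_one_le_right (by positivity) hV1)).trans hlow.le
  rw [hM.velocity_of_mem ⟨hMw, hw₁⟩] at hrise
  rw [← Real.mul_rpow (by positivity) (by linarith)] at hlow
  have hpow : d⁻¹ * V < w₁ ^ D.κ := by
    have := Real.rpow_lt_rpow (Real.rpow_nonneg hdV _) hlow hκ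
    rwa [← Real.rpow_mul hdV, one_div_mul_cancel hκ.ne', Real.rpow_one] at this
  have := mul_lt_mul_of_pos_left hpow hd
  rw [← mul_assoc, mul_inv_cancel₀ hd.ne', one_mul] at this
  linarith

/-- On `[x, y]` the pair `(v, w)` satisfies `v' = velocity w` and the superlinear differential
inequality `w' ≤ -c * v ^ (1 / κ)`, with `1 ≤ v` and `|w| ≤ M`. This notion is invariant under
time reversal and cannot persist on a long interval. -/
structure SuperlinearDecay (D : ShootingData) (M c x y : ℝ) (v w : ℝ → ℝ) : Prop where
  continuousOn_v : ContinuousOn v (Icc x y)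
  continuousOn_w : ContinuousOn w (Icc x y)
  dv : ∀ t ∈ Ioo x y, HasDerivAt v (D.velocity M (w t)) t
  dw : ∀ t ∈ Ioo x y, ∃ w', HasDerivAt w w' t ∧ w' ≤ -(c * v t ^ (1 / D.κ))
  one_le_v : ∀ t ∈ Icc x y, 1 ≤ v t
  abs_w_le : ∀ t ∈ Icc x y, |w t| ≤ M

namespace SuperlinearDecay

variable {c x y d : ℝ} (H : D.SuperlinearDecay M c x y v w)
include H

lemma reverse (hM : D.Admissible M) :
    D.SuperlinearDecay M c x y (fun t => v (x + y - t)) (fun t => -w (x + y - t)) := by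
  have hIcc : MapsTo (fun t => x + y - t) (Icc x y) (Icc x y) := fun t ht =>
    ⟨by linarith [ht.2], by linarith [ht.1]⟩
  have hIoo : MapsTo (fun t => x + y - t) (Ioo x y) (Ioo x y) := fun t ht =>
    ⟨by linarith [ht.2], by linarith [ht.1]⟩
  have hcont : ContinuousOn (fun t => x + y - t) (Icc x y) := by fun_prop
  refine ⟨H.continuousOn_v.comp hcont hIcc, (H.continuousOn_w.comp hcont hIcc).neg,
    fun t ht => ?_, fun t ht => ?_, fun t ht => H.one_le_v _ (hIcc ht), fun t ht => ?_⟩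
  · rw [hM.velocity_neg]
    exact (H.dv _ (hIoo ht)).comp_const_sub _ _
  · obtain ⟨w', hw', hle⟩ := H.dw _ (hIoo ht)
    exact ⟨w', (hw'.comp_const_sub (x + y) t).neg.congr_deriv (neg_neg w'), hle⟩
  · rw [abs_neg]
    exact H.abs_w_le _ (hIcc ht)

lemma w_sub_le (hc : 0 ≤ c) {V s t : ℝ} (hV : 0 ≤ V) (hxs : x ≤ s) (hst : s ≤ t) (hty : t ≤ y)
    (hVv : ∀ r ∈ Ioo s t, V ≤ v r) : w t - w s ≤ -(c * V ^ (1 / D.κ)) * (t - s) := by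
  choose! w' hdw hw' using H.dw
  have hsub : ∀ r ∈ Ioo s t, r ∈ Ioo x y := fun r hr =>
    ⟨hxs.trans_lt hr.1, hr.2.trans_le hty⟩
  refine sub_le_of_hasDerivAt_le hst (H.continuousOn_w.mono (Icc_subset_Icc hxs hty))
    (fun r hr => hdw r (hsub r hr)) fun r hr => (hw' r (hsub r hr)).trans (neg_le_neg ?_)
  exact mul_le_mul_of_nonneg_left
    (Real.rpow_le_rpow hV (hVv r hr) (one_div_pos.2 D.κ_pos).le) hc

lemma w_antitone (hc : 0 ≤ c) {s t : ℝ} (hxs : x ≤ s) (hst : s ≤ t) (hty : t ≤ y) :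
    w t ≤ w s := by
  have hfall := H.w_sub_le hc zero_le_one hxs hst hty fun r hr =>
    H.one_le_v r ⟨hxs.trans hr.1.le, hr.2.le.trans hty⟩
  rw [Real.one_rpow, mul_one, neg_mul] at hfall
  linarith [mul_nonneg hc (sub_nonneg.2 hst)]

/-- If `w` stayed nonnegative up to the midpoint, then `v` would rise on the first quarter to
`V ≥ d * w₁ ^ κ`, where `w₁` is the value of `w` after that quarter, while `w` would have to lose
`d * c * V ^ (1 / κ) > w₁` on the second. -/
lemma w_midpoint_neg (hM : D.Admissible M) (hd : 0 < d) (hy : y = x + 4 * d)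
    (hc : d⁻¹ ^ (1 / D.κ) < d * c) (hMd : M⁻¹ ≤ d⁻¹ ^ (1 / D.κ)) : w (x + 2 * d) < 0 := by
  by_contra! hmid
  have hc0 : 0 ≤ c := by
    have hdc : 0 < d * c := lt_of_le_of_lt (by positivity) hc
    exact (pos_of_mul_pos_right hdc hd.le).le
  have hquarter : x + d ∈ Icc x y := ⟨by linarith, by linarith⟩
  have hw_nonneg : ∀ t ∈ Icc x (x + 2 * d), 0 ≤ w t := fun t ht =>
    hmid.trans (H.w_antitone hc0 ht.1 ht.2 (by linarith))
  have hrise : D.velocity M (w (x + d)) * (x + d - x) ≤ v (x + d) - v x :=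
    le_sub_of_le_hasDerivAt (by linarith)
      (H.continuousOn_v.mono (Icc_subset_Icc le_rfl hquarter.2))
      (fun t ht => H.dv t ⟨ht.1, ht.2.trans_le hquarter.2⟩) fun t ht =>
        hM.velocity_mono (hw_nonneg _ ⟨by linarith, by linarith⟩)
          (H.w_antitone hc0 ht.1.le ht.2.le hquarter.2)
  have hv_mono : ∀ t ∈ Ioo (x + d) (x + 2 * d), v (x + d) ≤ v t := fun t ht =>
    le_of_hasDerivAt_nonneg ht.1.le
      (H.continuousOn_v.mono (Icc_subset_Icc hquarter.1 (by linarith [ht.2])))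
      (fun r hr => H.dv r ⟨by linarith [hr.1], by linarith [hr.2, ht.2]⟩) fun r hr =>
        hM.velocity_nonneg (hw_nonneg r ⟨by linarith [hr.1], by linarith [hr.2, ht.2]⟩)
  have hV := H.one_le_v _ hquarter
  have hfall := H.w_sub_le hc0 (zero_le_one.trans hV) hquarter.1 (by linarith)
    (show x + 2 * d ≤ y by linarith) hv_mono
  rw [show x + 2 * d - (x + d) = d by ring] at hfall
  rw [add_sub_cancel_left] at hrise
  refine false_of_superlinear hM hd hV ((le_abs_self _).trans (H.abs_w_le _ hquarter)) hMd hc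
    ?_ ?_ <;> linarith [H.one_le_v x ⟨le_rfl, by linarith⟩]

lemma false_of_length (hM : D.Admissible M) (hd : 0 < d) (hy : y = x + 4 * d)
    (hc : d⁻¹ ^ (1 / D.κ) < d * c) (hMd : M⁻¹ ≤ d⁻¹ ^ (1 / D.κ)) : False := by
  have hforward := H.w_midpoint_neg hM hd hy hc hMd
  have hbackward := (H.reverse hM).w_midpoint_neg hM hd hy hc hMd
  rw [show x + y - (x + 2 * d) = x + 2 * d by linarith] at hbackward
  linarith

end SuperlinearDecay

lemma IsSolution.superlinearDecay (S : D.IsSolution M a v w) (hM : D.Admissible M)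
    {x y P Λ : ℝ} (hMx : M⁻¹ ≤ x) (hyT : y ≤ D.T) (hP : 1 ≤ P) (hΛ : 0 ≤ Λ)
    (hf : ∀ z, P ≤ z → z ≤ M → Λ * z ^ (1 / D.κ) ≤ D.force M z)
    (hv : ∀ t ∈ Icc x y, v t ∈ Icc P M) (hw : ∀ t ∈ Icc x y, |w t| ≤ M) :
    D.SuperlinearDecay M (D.h D.T * Λ) x y v w := by
  have hx0 : 0 < x := hM.inv_pos.trans_le hMx
  have hsub : Icc x y ⊆ Icc 0 D.T := Icc_subset_Icc hx0.le hyT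
  refine ⟨S.continuousOn_v.mono hsub, S.continuousOn_w.mono hsub,
    fun t ht => S.hasDerivAt_v (hx0.trans ht.1) (ht.2.trans_le hyT),
    fun t ht => ⟨_, S.hasDerivAt_w (hx0.trans ht.1) (ht.2.trans_le hyT), neg_le_neg ?_⟩,
    fun t ht => hP.trans (hv t ht).1, hw⟩
  obtain ⟨hPv, hvM⟩ := hv t (Ioo_subset_Icc_self ht)
  have hh : D.h D.T ≤ D.weight M t := by
    rw [weight_of_ge (hMx.trans ht.1.le)]
    exact h_antitoneOn ⟨hx0.trans ht.1, ht.2.le.trans hyT⟩ (right_mem_Ioc.2 D.T_pos)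
      (ht.2.le.trans hyT)
  rw [mul_assoc]
  exact mul_le_mul hh (hf _ hPv hvM)
    (mul_nonneg hΛ (Real.rpow_nonneg (by linarith) _))
    ((D.h_pos D.T (right_mem_Ioc.2 D.T_pos)).le.trans hh)

/-- Constants for which every interval of length `ℓ` contains a zero of `v`: as long as `|v| ≤ P`,
a slope `|w| > ω` carries `v` across `[0, P]` in time `ℓ / 4`, and once `P ≤ |v|`, the
superlinearity constant `Λ` of the nonlinearity brings `v` back in time `ℓ / 2`. -/
structure OscillationConstants (D : ShootingData) (M ℓ P ω Λ : ℝ) : Prop where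
  one_le_P : 1 ≤ P
  one_le_ω : 1 ≤ ω
  ω_le : ω ≤ M
  lt_ω : P < ω ^ D.κ * (ℓ / 4)
  Λ_nonneg : 0 ≤ Λ
  le_force : ∀ z, P ≤ z → z ≤ M → Λ * z ^ (1 / D.κ) ≤ D.force M z
  inv_le : M⁻¹ ≤ (ℓ / 8)⁻¹ ^ (1 / D.κ)
  lt_Λ : (ℓ / 8)⁻¹ ^ (1 / D.κ) < ℓ / 8 * (D.h D.T * Λ)

namespace IsSolution

variable {s ℓ P ω Λ : ℝ} (S : D.IsSolution M a v w) (hM : D.Admissible M)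
  (O : D.OscillationConstants M ℓ P ω Λ) (hℓ : 0 < ℓ) (hMs : M⁻¹ ≤ s) (hsT : s + ℓ ≤ D.T)
  (hbound : ∀ t ∈ Icc s (s + ℓ), |v t| ≤ M ∧ |w t| ≤ M)
  (hw : ∀ t ∈ Icc s (s + ℓ), |v t| ≤ P → ω < |w t|)
include S hM O hℓ hMs hsT hbound hw

lemma not_forall_v_pos : ¬ ∀ t ∈ Icc s (s + ℓ), 0 < v t := by
  intro hv
  have hs0 : 0 ≤ s := (hM.inv_pos.trans_le hMs).le
  have hsub : ∀ {x y}, s ≤ x → y ≤ s + ℓ → Icc x y ⊆ Icc s (s + ℓ) := Icc_subset_Icc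
  have hreach : ∀ x, s ≤ x → x + ℓ / 4 ≤ s + ℓ → ∃ t ∈ Icc x (x + ℓ / 4), P ≤ v t :=
    fun x hx hxℓ => S.exists_le_v_of_lt_abs_w hM (hs0.trans hx) (by positivity)
      (hxℓ.trans hsT) O.one_le_ω O.ω_le O.lt_ω (fun t ht => hv t (hsub hx hxℓ ht))
      fun t ht => hw t (hsub hx hxℓ ht)
  obtain ⟨τ₁, hτ₁, hv₁⟩ := hreach s le_rfl (by linarith)
  obtain ⟨τ₂, hτ₂, hv₂⟩ := hreach (s + 3 * ℓ / 4) (by linarith) (by linarith)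
  have hτ : τ₁ + 4 * (ℓ / 8) ≤ τ₂ := by linarith [hτ₁.2, hτ₂.1]
  have hτ₂s : τ₂ ≤ s + ℓ := by linarith [hτ₂.2]
  have hPv : ∀ t ∈ Icc τ₁ τ₂, P ≤ v t := by
    refine S.le_v_of_w_ne_zero hM (hs0.trans hτ₁.1) (by linarith) (hτ₂s.trans hsT) hv₁ hv₂
      fun x hx hxP => abs_pos.1 ?_
    have hxs := hsub hτ₁.1 hτ₂s hx
    have := hw x hxs (by rwa [abs_of_pos (hv x hxs)])
    linarith [O.one_le_ω]
  have hτs := hsub hτ₁.1 (hτ.trans hτ₂s)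
  exact (S.superlinearDecay hM (hMs.trans hτ₁.1) ((hτ.trans hτ₂s).trans hsT) O.one_le_P
    O.Λ_nonneg O.le_force
    (fun t ht => ⟨hPv t ⟨ht.1, ht.2.trans hτ⟩, (le_abs_self _).trans (hbound t (hτs ht)).1⟩)
    fun t ht => (hbound t (hτs ht)).2).false_of_length hM (by positivity) rfl O.lt_Λ O.inv_le

lemma exists_v_eq_zero : ∃ t ∈ Icc s (s + ℓ), v t = 0 := by
  by_contra! hne
  have hs0 : 0 ≤ s := (hM.inv_pos.trans_le hMs).le
  rcases forall_lt_or_forall_lt_neg le_rfl (S.continuousOn_v.mono (Icc_subset_Icc hs0 hsT))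
      (fun t ht => abs_pos.2 (hne t ht)) with hv | hv
  · exact S.not_forall_v_pos hM O hℓ hMs hsT hbound hw hv
  · exact (S.neg hM).not_forall_v_pos hM O hℓ hMs hsT (by simpa only [abs_neg] using hbound)
      (by simpa only [abs_neg] using hw) fun t ht => by linarith [hv t ht]

end IsSolution

lemma Admissible.potential_mono (hM : D.Admissible M) {x y : ℝ} (hx : D.β ≤ x) (hxy : x ≤ y) :
    D.potential M x ≤ D.potential M y :=
  le_of_hasDerivAt_nonneg hxy hM.continuous_potential.continuousOn
    (fun t _ => hM.hasDerivAt_potential t) fun _ ht => hM.force_nonneg (hx.trans ht.1.le)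

lemma exists_mul_rpow_le_f (D : ShootingData) (c P₀ : ℝ) :
    ∃ P, D.β ≤ P ∧ 1 ≤ P ∧ P₀ ≤ P ∧ ∀ x, P ≤ x → c * x ^ (1 / D.κ) ≤ D.f x := by
  obtain ⟨P, hP⟩ := eventually_atTop.1 ((D.f_super.eventually_ge_atTop c).and
    ((eventually_ge_atTop D.β).and ((eventually_ge_atTop 1).and (eventually_ge_atTop P₀))))
  refine ⟨P, (hP P le_rfl).2.1, (hP P le_rfl).2.2.1, (hP P le_rfl).2.2.2, fun x hx => ?_⟩
  have hx0 : 0 < x := zero_lt_one.trans_le (hP x hx).2.2.1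
  exact (le_div_iff₀ (Real.rpow_pos_of_pos hx0 _)).1 (hP x hx).1

lemma exists_lt_abs_w_of_le_v (D : ShootingData) {P ω : ℝ} (hω : 1 ≤ ω) :
    ∃ P₂, 1 ≤ P₂ ∧ ∀ M, D.Admissible M → P₂ ≤ M → ∀ a v w, D.IsSolution M a v w →
      ∀ s t, M⁻¹ ≤ s → s ≤ t → t ≤ D.T → P₂ ≤ v s → |v t| ≤ P → ω < |w t| := by
  have hhT := D.h_pos D.T (right_mem_Ioc.2 D.T_pos)
  have hE : 0 < ω ^ D.κ * ω / D.h D.T := by positivity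
  have hwell : 0 ≤ D.C / (1 - D.m) * D.β ^ (1 - D.m) :=
    mul_nonneg (div_nonneg D.C_pos.le (sub_pos.2 D.m_lt_one).le) (Real.rpow_nonneg D.β_pos.le _)
  obtain ⟨P₁, hβ₁, h1P, hP₁, hf⟩ := D.exists_mul_rpow_le_f 1 P
  set P₂ := P₁ + (D.C / (1 - D.m) * D.β ^ (1 - D.m) + ω ^ D.κ * ω / D.h D.T + 1)
  have h12 : P₁ ≤ P₂ := by linarith
  refine ⟨P₂, h1P.trans h12, fun M hM hMP a v w S s t hMs hst ht hvs hvt => ?_⟩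
  have hs0 : 0 < s := hM.inv_pos.trans_le hMs
  have hgrowth : P₂ - P₁ ≤ D.potential M P₂ - D.potential M P₁ := by
    rw [← one_mul (P₂ - P₁)]
    refine le_sub_of_le_hasDerivAt h12 hM.continuous_potential.continuousOn
      (fun x _ => hM.hasDerivAt_potential x) fun x hx => ?_
    rw [hM.force_of_mem ⟨hM.inv_le_β.trans (hβ₁.trans hx.1.le), hx.2.le.trans hMP⟩]
    have hx1 : 1 ≤ x ^ (1 / D.κ) :=
      Real.one_le_rpow (h1P.trans hx.1.le) (one_div_pos.2 D.κ_pos).le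
    linarith [hf x hx.1.le]
  have hlow : D.potential M (v t) ≤ D.potential M P₁ + D.C / (1 - D.m) * D.β ^ (1 - D.m) := by
    rcases le_total |v t| D.β with h | h
    · linarith [hM.potential_nonpos h, hM.neg_le_potential P₁]
    · rw [← hM.potential_abs]
      linarith [hM.potential_mono h (hvt.trans hP₁)]
  have henergy : D.potential M P₂ ≤ D.energy M v w t / D.h t := by
    refine le_trans ?_ (S.energy_div_h_mono hM hMs hst ht)
    have hh := D.h_pos s ⟨hs0, hst.trans ht⟩
    rw [energy, add_div, mul_div_cancel_left₀ _ hh.ne']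
    linarith [hM.potential_mono (hβ₁.trans h12) hvs, div_nonneg (hM.kinetic_nonneg (w s)) hh.le]
  have hh := D.h_pos t ⟨hs0.trans_le hst, ht⟩
  rw [energy, add_div, mul_div_cancel_left₀ _ hh.ne'] at henergy
  have hkin : ω ^ D.κ * ω < D.kinetic M (w t) := by
    have hanti := div_le_div_of_nonneg_left (hM.kinetic_nonneg (w t)) hhT
      (h_antitoneOn ⟨hs0.trans_le hst, ht⟩ (right_mem_Ioc.2 D.T_pos) ht)
    exact (div_lt_div_iff_of_pos_right hhT).1 (by linarith)
  by_contra! hwω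
  have hmono := hM.kinetic_mono (abs_nonneg _) hwω
  rw [hM.kinetic_abs] at hmono
  linarith [hM.kinetic_le_rpow_mul hω]

lemma exists_abs_le (D : ShootingData) {a₁ : ℝ} (ha₁ : 1 ≤ a₁) :
    ∃ V, ∀ᶠ M in atTop, ∀ a ∈ Icc 1 a₁, ∀ v w, D.IsSolution M a v w →
      ∀ t ∈ Icc 0 D.T, |v t| ≤ V * t ∧ |w t| ≤ V := by
  obtain ⟨W, w₀, t₂, hW, -, ht₂, hbounds⟩ := D.exists_uniform_bounds ha₁
  refine ⟨max W (W ^ D.κ), ?_⟩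
  filter_upwards [D.eventually_admissible,
    tendsto_inv_atTop_zero.eventually_le_const ht₂] with M hM hMt a ha v w S t ht
  have B := hbounds M hM hMt a ha v w S
  have hv := S.abs_v_sub_le hM hW B.abs_w_le le_rfl ht.1 ht.2
  rw [S.v_zero, sub_zero, sub_zero] at hv
  exact ⟨hv.trans (mul_le_mul_of_nonneg_right (le_max_right _ _) ht.1),
    (B.abs_w_le t ht).trans (le_max_left _ _)⟩

lemma exists_force_le (D : ShootingData) (P : ℝ) :
    ∃ B, 0 ≤ B ∧ ∀ M, D.Admissible M → P ≤ M → ∀ x, 0 ≤ x → x ≤ P → D.force M x ≤ B := by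
  obtain ⟨B, hB⟩ := isCompact_Icc.exists_bound_of_continuousOn
    (D.f_lip.continuousOn.mono fun x (hx : x ∈ Icc D.β P) => D.β_pos.trans_le hx.1)
  refine ⟨max B 0, le_max_right _ _, fun M hM hMP x h0 hx => ?_⟩
  rcases le_total x D.β with hxβ | hxβ
  · exact (hM.force_nonpos h0 hxβ).trans (le_max_right _ _)
  · rw [hM.force_of_mem ⟨hM.inv_le_β.trans hxβ, hx.trans hMP⟩]
    exact ((le_abs_self _).trans (hB x ⟨hxβ, hx⟩)).trans (le_max_left _ _)

lemma exists_slope_le_v (D : ShootingData) {ℓ P : ℝ} (hℓ : 0 < ℓ) (hℓT : ℓ ≤ D.T) :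
    ∃ a₁, 1 ≤ a₁ ∧ ∀ᶠ M in atTop, ∀ v w, D.IsSolution M a₁ v w → ∃ t ∈ Icc 0 ℓ, P ≤ v t := by
  obtain ⟨B, hB, hforce⟩ := D.exists_force_le P
  have hhalf : Tendsto (fun x : ℝ => x / 2) atTop atTop := tendsto_id.atTop_div_const two_pos
  have hpow := ((tendsto_rpow_atTop D.κ_pos).comp hhalf).atTop_mul_const hℓ
  obtain ⟨a₁, ha₁, hBa, hPa⟩ := ((eventually_ge_atTop 2).and
    ((hhalf.eventually_gt_atTop (B * D.A / (1 - D.q) * ℓ ^ (1 - D.q))).and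
      (hpow.eventually_ge_atTop P))).exists
  refine ⟨a₁, by linarith, ?_⟩
  filter_upwards [D.eventually_admissible, eventually_ge_atTop a₁, eventually_ge_atTop P]
    with M hM haM hPM v w S
  exact S.exists_le_v hM ha₁ hℓT hB (hforce M hM hPM) hBa haM hℓ hPa

lemma exists_oscillationConstants (D : ShootingData) {ℓ : ℝ} (hℓ : 0 < ℓ) :
    ∃ P ω Λ, ∀ᶠ M in atTop, D.OscillationConstants M ℓ P ω Λ := by
  have hhT := D.h_pos D.T (right_mem_Ioc.2 D.T_pos)
  set c := (ℓ / 8)⁻¹ ^ (1 / D.κ)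
  have hc : 0 < c := by positivity
  obtain ⟨P, hPβ, hP1, -, hf⟩ := D.exists_mul_rpow_le_f ((c + 1) / (ℓ / 8 * D.h D.T)) 0
  obtain ⟨ω, hω1, hω⟩ := ((eventually_ge_atTop 1).and
    (((tendsto_rpow_atTop D.κ_pos).atTop_mul_const
      (by positivity : 0 < ℓ / 4)).eventually_gt_atTop P)).exists
  refine ⟨P, ω, (c + 1) / (ℓ / 8 * D.h D.T), ?_⟩
  filter_upwards [D.eventually_admissible, eventually_ge_atTop ω,
    tendsto_inv_atTop_zero.eventually_le_const hc] with M hM hωM hMc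
  refine ⟨hP1, hω1, hωM, hω, by positivity, fun z hPz hzM => ?_, hMc, ?_⟩
  · rw [hM.force_of_mem ⟨hM.inv_le_β.trans (hPβ.trans hPz), hzM⟩]
    exact hf z hPz
  · rw [← mul_assoc, mul_div_cancel₀ _ (by positivity)]
    exact lt_add_one c

lemma exists_forall_exists_zero (D : ShootingData) {ℓ : ℝ} (hℓ : 0 < ℓ) (hℓT : ℓ ≤ D.T) :
    ∃ a₁, 1 ≤ a₁ ∧ ∀ᶠ M in atTop, ∀ v w, D.IsSolution M a₁ v w →
      ∀ s, ℓ ≤ s → s + ℓ ≤ D.T → ∃ t ∈ Icc s (s + ℓ), v t = 0 := by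
  obtain ⟨P, ω, Λ, hosc⟩ := D.exists_oscillationConstants hℓ
  obtain ⟨P₂, hP₂, hlow⟩ := D.exists_lt_abs_w_of_le_v (P := P) hosc.exists.choose_spec.one_le_ω
  obtain ⟨a₁, ha₁, hslope⟩ := D.exists_slope_le_v (P := P₂) hℓ hℓT
  obtain ⟨V, hV⟩ := D.exists_abs_le ha₁
  refine ⟨a₁, ha₁, ?_⟩
  filter_upwards [D.eventually_admissible, hosc, hslope, hV, eventually_ge_atTop P₂,
    eventually_ge_atTop V, eventually_ge_atTop (V * D.T),
    tendsto_inv_atTop_zero.eventually_le_const hℓ]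
    with M hM hO hreach hbound hMP hMV hMVT hMℓ v w S s hs hsT
  have hVbound := hbound a₁ ⟨ha₁, le_rfl⟩ v w S
  have hV0 : 0 ≤ V := (abs_nonneg _).trans (hVbound 0 ⟨le_rfl, D.T_pos.le⟩).2
  have hMbound : ∀ t ∈ Icc 0 D.T, |v t| ≤ M ∧ |w t| ≤ M := fun t ht =>
    ⟨(hVbound t ht).1.trans ((mul_le_mul_of_nonneg_left ht.2 hV0).trans hMVT),
      (hVbound t ht).2.trans hMV⟩
  obtain ⟨t₁, ht₁, hvt₁⟩ := hreach v w S
  have hMt₁ : M⁻¹ ≤ t₁ := by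
    have hv := (le_abs_self _).trans (hVbound t₁ ⟨ht₁.1, ht₁.2.trans hℓT⟩).1
    rw [inv_le_iff_one_le_mul₀' hM.pos]
    exact (hP₂.trans (hvt₁.trans hv)).trans (mul_le_mul_of_nonneg_right hMV ht₁.1)
  refine S.exists_v_eq_zero hM hO hℓ (hMℓ.trans hs) hsT
    (fun t ht => hMbound t ⟨hℓ.le.trans (hs.trans ht.1), ht.2.trans hsT⟩) fun t ht => ?_
  exact hlow M hM hMP a₁ v w S t₁ t hMt₁ (ht₁.2.trans (hs.trans ht.1)) (ht.2.trans hsT) hvt₁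

end ShootingData

/-! ### Counting zeros by a polar angle -/

lemma lt_of_forall_eq_imp_deriv_pos {θ g : ℝ → ℝ} {s t c : ℝ} (hθ : ∀ x, HasDerivAt θ (g x) x)
    (hpos : ∀ x ∈ Icc s t, θ x = c → 0 < g x) (hst : s < t) (hs : c ≤ θ s) : c < θ t := by
  have hle : ∀ x ∈ Icc s t, c ≤ θ x :=
    image_le_of_deriv_right_lt_deriv_boundary (f' := fun _ => 0) continuousOn_const
      (fun x _ => (hasDerivAt_const x c).hasDerivWithinAt) hs hθ
      fun x hx hxc => hpos x (Ico_subset_Icc_self hx) hxc.symm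
  have ht : t ∈ Icc s t := right_mem_Icc.2 hst.le
  refine (hle t ht).lt_of_ne fun hct => ?_
  have hmin : IsLocalMinOn θ (Icc s t) t :=
    IsMinOn.localize fun x hx => hct.ge.trans (hle x hx)
  have hdir := hmin.hasFDerivWithinAt_nonneg (hθ t).hasDerivWithinAt.hasFDerivWithinAt
    (sub_mem_posTangentConeAt_of_segment_subset ((convex_Icc s t).segment_subset ht
      (left_mem_Icc.2 hst.le)))
  simp only [ContinuousLinearMap.toSpanSingleton_apply, smul_eq_mul] at hdir
  linarith [mul_neg_of_neg_of_pos (sub_neg.2 hst) (hpos t ht hct.symm)]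

section PolarAngle

variable {v' w' T t : ℝ} {v w θ : ℝ → ℝ}

/-- If `θ' = φ'` for the polar angle `φ` of the nonvanishing curve `(w, v)`, then
`(v cos θ - w sin θ)² / (v² + w²) = sin² (φ - θ)` is constant. -/
lemma hasDerivAt_sq_sin_polarAngle_sub (hv : HasDerivAt v v' t) (hw : HasDerivAt w w' t)
    (hne : v t ^ 2 + w t ^ 2 ≠ 0)
    (hθ : HasDerivAt θ ((v' * w t - v t * w') / (v t ^ 2 + w t ^ 2)) t) :
    HasDerivAt (fun t => (v t * Real.cos (θ t) - w t * Real.sin (θ t)) ^ 2 / (v t ^ 2 + w t ^ 2))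
      0 t := by
  refine ((((hv.mul hθ.cos).sub (hw.mul hθ.sin)).pow 2).div
    ((hv.pow 2).add (hw.pow 2)) hne).congr_deriv (div_eq_zero_iff.2 (Or.inl ?_))
  simp only [Pi.add_apply, Pi.sub_apply, Pi.mul_apply, Pi.pow_apply]
  field_simp
  ring

lemma mul_cos_eq_mul_sin_of_polarAngle {v' w' : ℝ → ℝ}
    (hv : ContinuousOn v (Icc 0 T)) (hw : ContinuousOn w (Icc 0 T))
    (hv' : ∀ t ∈ Ioo 0 T, HasDerivAt v (v' t) t) (hw' : ∀ t ∈ Ioo 0 T, HasDerivAt w (w' t) t)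
    (hne : ∀ t ∈ Icc 0 T, v t ^ 2 + w t ^ 2 ≠ 0) (hθ : ContinuousOn θ (Icc 0 T))
    (hθ' : ∀ t ∈ Ioo 0 T, HasDerivAt θ ((v' t * w t - v t * w' t) / (v t ^ 2 + w t ^ 2)) t)
    (hv0 : v 0 = 0) (hθ0 : θ 0 = 0) (ht : t ∈ Icc 0 T) :
    v t * Real.cos (θ t) = w t * Real.sin (θ t) := by
  have hcont : ContinuousOn (fun t =>
      (v t * Real.cos (θ t) - w t * Real.sin (θ t)) ^ 2 / (v t ^ 2 + w t ^ 2)) (Icc 0 T) :=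
    (((hv.mul (Real.continuous_cos.comp_continuousOn hθ)).sub
      (hw.mul (Real.continuous_sin.comp_continuousOn hθ))).pow 2).div
      ((hv.pow 2).add (hw.pow 2)) hne
  have hconst := abs_sub_le_of_abs_hasDerivAt_le (B := 0) ht.1
    (hcont.mono (Icc_subset_Icc_right ht.2))
    (fun x hx =>
      have hxT : x ∈ Ioo 0 T := ⟨hx.1, hx.2.trans_le ht.2⟩
      hasDerivAt_sq_sin_polarAngle_sub (hv' x hxT) (hw' x hxT) (hne x (Ioo_subset_Icc_self hxT))
        (hθ' x hxT))
    fun x _ => abs_zero.le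
  simp only [hv0, hθ0, Real.sin_zero, zero_mul, mul_zero, sub_zero, ne_eq, OfNat.ofNat_ne_zero,
    not_false_eq_true, zero_pow, zero_div, abs_nonpos_iff, div_eq_zero_iff, hne t ht,
    or_false, pow_eq_zero_iff] at hconst
  exact sub_eq_zero.1 hconst

end PolarAngle

lemma exists_continuousOn_flow {E : Type*} [NormedAddCommGroup E] [NormedSpace ℝ E]
    [CompleteSpace E] {G : ℝ → E → E} {T : ℝ} {L K : NNReal} (hT : 0 ≤ T)
    (hlip : ∀ t ∈ Icc 0 T, LipschitzWith K (G t)) (hcont : ∀ x, ContinuousOn (G · x) (Icc 0 T))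
    (hbound : ∀ t ∈ Icc 0 T, ∀ x, ‖G t x‖ ≤ L) (x₀ : E) (r : NNReal) :
    ∃ U : E × ℝ → E, ContinuousOn U (Metric.closedBall x₀ r ×ˢ Icc 0 T) ∧
      ∀ x ∈ Metric.closedBall x₀ r, U (x, 0) = x ∧
        ∀ t ∈ Icc 0 T, HasDerivWithinAt (fun t => U (x, t)) (G t (U (x, t))) (Icc 0 T) t := by
  have hPL : IsPicardLindelof G (⟨0, le_rfl, hT⟩ : Icc 0 T) x₀ (L * T.toNNReal + r) r L K :=
    ⟨fun t ht => (hlip t ht).lipschitzOnWith, fun x _ => hcont x, fun t ht x _ => hbound t ht x,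
      by simp [hT]⟩
  obtain ⟨U, hU, hUcont⟩ := hPL.exists_forall_mem_closedBall_eq_hasDerivWithinAt_continuousOn
  exact ⟨U, hUcont, hU⟩

namespace ShootingData

variable {D : ShootingData} {M a : ℝ} {v w : ℝ → ℝ}

/-- The values of `z` enumerate, without repetition, the zeros of `v` in `(0, T)`. -/
structure IsZeroEnumeration (D : ShootingData) {n : ℕ} (v : ℝ → ℝ) (z : Fin n → ℝ) : Prop where
  mem : ∀ i, z i ∈ Ioo 0 D.T
  v_eq_zero : ∀ i, v (z i) = 0
  injective : Function.Injective z
  exists_eq : ∀ t ∈ Ioo 0 D.T, v t = 0 → ∃ i, t = z i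

/-- `θ`, with derivative `g`, is an angle that is a multiple of `π` exactly at the zeros of `v` in
`[0, T]` and increases through them, so that it counts these zeros. -/
structure IsAngle (D : ShootingData) (v θ g : ℝ → ℝ) : Prop where
  zero : θ 0 = 0
  hasDerivAt : ∀ t, HasDerivAt θ (g t) t
  v_eq_zero_iff : ∀ t ∈ Icc 0 D.T, v t = 0 ↔ Real.sin (θ t) = 0
  pos_of_v_eq_zero : ∀ t ∈ Icc 0 D.T, v t = 0 → 0 < g t

namespace IsAngle

variable {θ g : ℝ → ℝ} {s t : ℝ} (A : D.IsAngle v θ g)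
include A

lemma continuous : Continuous θ :=
  continuous_iff_continuousAt.2 fun x => (A.hasDerivAt x).continuousAt

lemma v_eq_zero (ht : t ∈ Icc 0 D.T) {k : ℤ} (h : θ t = k * Real.pi) : v t = 0 := by
  rw [A.v_eq_zero_iff t ht, h, Real.sin_int_mul_pi]

lemma exists_int_mul_pi_eq (ht : t ∈ Icc 0 D.T) (h : v t = 0) : ∃ k : ℤ, k * Real.pi = θ t :=
  Real.sin_eq_zero_iff.1 ((A.v_eq_zero_iff t ht).1 h)

lemma int_mul_pi_lt (hs : 0 ≤ s) (hst : s < t) (ht : t ≤ D.T) {k : ℤ} (h : k * Real.pi ≤ θ s) :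
    k * Real.pi < θ t :=
  lt_of_forall_eq_imp_deriv_pos A.hasDerivAt (fun x hx hxk =>
    have hxT : x ∈ Icc 0 D.T := ⟨hs.trans hx.1, hx.2.trans ht⟩
    A.pos_of_v_eq_zero x hxT (A.v_eq_zero hxT hxk)) hst h

lemma lt_of_v_eq_zero (hs : 0 ≤ s) (hst : s < t) (ht : t ≤ D.T) (hvs : v s = 0) : θ s < θ t := by
  obtain ⟨k, hk⟩ := A.exists_int_mul_pi_eq ⟨hs, hst.le.trans ht⟩ hvs
  exact hk.symm.trans_lt (A.int_mul_pi_lt hs hst ht hk.le)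

lemma add_one_mul_pi_le (hs : 0 ≤ s) (hst : s < t) (ht : t ≤ D.T) (hvt : v t = 0) {k : ℕ}
    (h : k * Real.pi ≤ θ s) : ((k + 1 : ℕ) : ℝ) * Real.pi ≤ θ t := by
  obtain ⟨j, hj⟩ := A.exists_int_mul_pi_eq ⟨hs.trans hst.le, ht⟩ hvt
  have hlt := A.int_mul_pi_lt hs hst ht (k := k) (by exact_mod_cast h)
  rw [← hj, mul_lt_mul_iff_left₀ Real.pi_pos, Int.cast_lt] at hlt
  rw [← hj]
  exact mul_le_mul_of_nonneg_right (by exact_mod_cast Int.add_one_le_of_lt hlt) Real.pi_pos.le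

lemma add_one_mul_pi_le_of_zeros {n : ℕ} {x : ℕ → ℝ} (h0 : 0 < x 0)
    (hx : ∀ j < n, x j < x (j + 1)) (hT : ∀ j ≤ n, x j ≤ D.T) (hv : ∀ j ≤ n, v (x j) = 0) :
    0 < x n ∧ ((n + 1 : ℕ) : ℝ) * Real.pi ≤ θ (x n) := by
  induction n with
  | zero => exact ⟨h0, A.add_one_mul_pi_le le_rfl h0 (hT 0 le_rfl) (hv 0 le_rfl) (by simp [A.zero])⟩
  | succ n ih =>
    obtain ⟨hpos, hπ⟩ := ih (fun j hj => hx j (by lia)) (fun j hj => hT j (by lia))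
      fun j hj => hv j (by lia)
    have hlt := hx n n.lt_succ_self
    exact ⟨hpos.trans hlt, A.add_one_mul_pi_le hpos.le hlt (hT _ le_rfl) (hv _ le_rfl) hπ⟩

lemma exists_eq_mul_pi {δ : ℝ}
    (hgap : ∀ s t, 0 ≤ s → s < t → t ≤ D.T → v s = 0 → v t = 0 → δ ≤ t - s) (j : ℕ)
    (hj : j * Real.pi ≤ θ D.T) : ∃ y ∈ Icc 0 D.T, θ y = j * Real.pi ∧ j * δ ≤ y := by
  induction j with
  | zero => exact ⟨0, ⟨le_rfl, D.T_pos.le⟩, by simp [A.zero], by simp⟩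
  | succ j ih =>
    have hstep : (j : ℝ) * Real.pi < (j + 1 : ℕ) * Real.pi := by
      gcongr
      exact j.lt_succ_self
    obtain ⟨y, hy, hyθ, hyδ⟩ := ih (hstep.le.trans hj)
    obtain ⟨z, hz, hzθ⟩ := intermediate_value_Icc hy.2 A.continuous.continuousOn
      ⟨hyθ.trans_le hstep.le, hj⟩
    have hyz : y < z := hz.1.lt_of_ne (by rintro rfl; linarith)
    have hzT : z ∈ Icc 0 D.T := ⟨hy.1.trans hz.1, hz.2⟩
    have := hgap y z hy.1 hyz hz.2 (A.v_eq_zero hy (k := j) (by exact_mod_cast hyθ))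
      (A.v_eq_zero hzT (k := (j + 1 : ℕ)) (by exact_mod_cast hzθ))
    exact ⟨z, hzT, hzθ, by push_cast; linarith⟩

lemma exists_isZeroEnumeration {n : ℕ} (hn : θ D.T = (n + 1 : ℕ) * Real.pi) :
    ∃ z : Fin n → ℝ, D.IsZeroEnumeration v z := by
  have hπ := Real.pi_pos
  have hex : ∀ i : Fin n, ∃ y ∈ Icc 0 D.T, θ y = (i + 1 : ℕ) * Real.pi := fun i =>
    intermediate_value_Icc D.T_pos.le A.continuous.continuousOn
      ⟨A.zero.trans_le (by positivity), by rw [hn]; gcongr; exact i.2.le⟩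
  choose z hz hzθ using hex
  have hcast : ∀ i, θ (z i) = ((i + 1 : ℕ) : ℤ) * Real.pi := fun i => by exact_mod_cast hzθ i
  have hvz : ∀ i, v (z i) = 0 := fun i => A.v_eq_zero (hz i) (hcast i)
  refine ⟨z, fun i => ⟨(hz i).1.lt_of_ne fun h => ?_, (hz i).2.lt_of_ne fun h => ?_⟩, hvz,
    fun i j hij => ?_, fun t ht hvt => ?_⟩
  · have := hzθ i
    rw [← h, A.zero] at this
    exact absurd this (by positivity)
  · have := hzθ i
    rw [h, hn, mul_left_inj' hπ.ne', Nat.cast_inj] at this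
    lia
  · have := (hzθ i).symm.trans ((congrArg θ hij).trans (hzθ j))
    rw [mul_left_inj' hπ.ne', Nat.cast_inj] at this
    lia
  · obtain ⟨k, hk⟩ := A.exists_int_mul_pi_eq (Ioo_subset_Icc_self ht) hvt
    have hk0 : 0 < k := by
      have := A.int_mul_pi_lt (k := 0) le_rfl ht.1 ht.2.le (by simp [A.zero])
      rwa [← hk, mul_lt_mul_iff_left₀ hπ, Int.cast_lt] at this
    have hkn : k < (n + 1 : ℕ) := by
      have := A.lt_of_v_eq_zero ht.1.le ht.2 le_rfl hvt
      rw [hn, ← hk, mul_lt_mul_iff_left₀ hπ] at this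
      exact_mod_cast this
    lift k to ℕ using hk0.le
    refine ⟨⟨k - 1, by lia⟩, ?_⟩
    have hθ : θ t = θ (z ⟨k - 1, by lia⟩) := by
      rw [hzθ, ← hk, Nat.sub_add_cancel (by lia), Int.cast_natCast]
    rcases lt_trichotomy t (z ⟨k - 1, by lia⟩) with h | h | h
    · exact absurd hθ (A.lt_of_v_eq_zero ht.1.le h (hz _).2 hvt).ne
    · exact h
    · exact absurd hθ (A.lt_of_v_eq_zero (hz _).1 h ht.2.le (hvz _)).ne'

lemma apply_T_le_of_gap {δ : ℝ} {n : ℕ}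
    (hgap : ∀ s t, 0 ≤ s → s < t → t ≤ D.T → v s = 0 → v t = 0 → δ ≤ t - s)
    (hn : D.T < (n + 1 : ℕ) * δ) : θ D.T ≤ (n + 1 : ℕ) * Real.pi := by
  by_contra! h
  obtain ⟨y, hy, -, hyδ⟩ := A.exists_eq_mul_pi hgap (n + 1) h.le
  linarith [hy.2]

lemma le_apply_T_of_dense {ℓ : ℝ} {n : ℕ} (hℓ : 0 < ℓ) (hℓT : ℓ * (2 * n + 2) = D.T)
    (hdense : ∀ s, ℓ ≤ s → s + ℓ ≤ D.T → ∃ t ∈ Icc s (s + ℓ), v t = 0) :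
    (n + 1 : ℕ) * Real.pi ≤ θ D.T := by
  have hex : ∀ j : ℕ, ∃ t, j ≤ n → t ∈ Icc ((2 * j + 1) * ℓ) ((2 * j + 1) * ℓ + ℓ) ∧ v t = 0 := by
    intro j
    by_cases hj : j ≤ n
    · have hjn : (j : ℝ) ≤ n := by exact_mod_cast hj
      obtain ⟨t, ht, hvt⟩ := hdense ((2 * j + 1) * ℓ)
        (by linarith [mul_nonneg j.cast_nonneg hℓ.le]) (by nlinarith)
      exact ⟨t, fun _ => ⟨ht, hvt⟩⟩
    · exact ⟨0, fun h => absurd h hj⟩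
  choose x hx using hex
  have hxT : ∀ j ≤ n, x j ≤ D.T := fun j hj => by
    have hjn : (j : ℝ) ≤ n := by exact_mod_cast hj
    nlinarith [(hx j hj).1.2]
  have hx0 : 0 < x 0 := by
    have := (hx 0 n.zero_le).1.1
    simp only [Nat.cast_zero, mul_zero, zero_add, one_mul] at this
    linarith
  have hlt : ∀ j < n, x j < x (j + 1) := fun j hj => by
    have hnext := (hx (j + 1) hj).1.1
    push_cast at hnext
    linarith [(hx j hj.le).1.2]
  obtain ⟨hpos, hπ⟩ := A.add_one_mul_pi_le_of_zeros hx0 hlt hxT fun j hj => (hx j hj).2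
  rcases (hxT n le_rfl).eq_or_lt with h | h
  · rwa [h] at hπ
  · exact_mod_cast (A.int_mul_pi_lt (k := (n + 1 : ℕ)) hpos.le h le_rfl (by exact_mod_cast hπ)).le

end IsAngle

/-- The right-hand side of the regularized system satisfied by `(v, w)`. -/
noncomputable def vectorField (D : ShootingData) (M t : ℝ) (x : ℝ × ℝ) : ℝ × ℝ :=
  (D.velocity M x.2, -(D.weight M t * D.force M x.1))

lemma Admissible.exists_vectorField_bounds (hM : D.Admissible M) :
    ∃ L K : NNReal, ∀ t ∈ Icc 0 D.T,
      LipschitzWith K (D.vectorField M t) ∧ ∀ x, ‖D.vectorField M t x‖ ≤ L := by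
  obtain ⟨L₁, B₁, hL₁, hB₁⟩ :=
    exists_lipschitzWith_regularize (locallyLipschitzOn_rpow_const D.κ) hM.one_le
  obtain ⟨L₂, B₂, hL₂, hB₂⟩ := exists_lipschitzWith_regularize D.f_lip hM.one_le
  obtain ⟨H, hH⟩ := isCompact_Icc.exists_bound_of_continuousOn hM.continuousOn_weight
  lift H to NNReal using (norm_nonneg _).trans (hH 0 ⟨le_rfl, D.T_pos.le⟩)
  refine ⟨max B₁ (H * B₂), max L₁ (H * L₂), fun t ht => ⟨?_, fun x => ?_⟩⟩
  · have hv : LipschitzWith L₁ fun x : ℝ × ℝ => D.velocity M x.2 :=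
      (hL₁.comp LipschitzWith.prod_snd).weaken (mul_one _).le
    have hf : LipschitzWith L₂ fun x : ℝ × ℝ => D.force M x.1 :=
      (hL₂.comp LipschitzWith.prod_fst).weaken (mul_one _).le
    refine hv.prodMk (LipschitzWith.of_dist_le_mul fun x y => ?_)
    rw [dist_neg_neg, ← smul_eq_mul, ← smul_eq_mul, dist_smul₀, NNReal.coe_mul, mul_assoc]
    exact mul_le_mul (hH t ht) (hf.dist_le_mul x y) dist_nonneg H.2
  · rw [vectorField, Prod.norm_mk, norm_neg, norm_mul, NNReal.coe_max, NNReal.coe_mul]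
    exact max_le_max (hB₁ _) (mul_le_mul (hH t ht) (hB₂ _) (norm_nonneg _) H.2)

/-- The flow is extended to all of `ℝ × ℝ` by projecting onto `[1, a₁] × [0, T]`. -/
lemma Admissible.exists_flow (hM : D.Admissible M) {a₁ : ℝ} (ha₁ : 1 ≤ a₁) :
    ∃ V W : ℝ × ℝ → ℝ, Continuous V ∧ Continuous W ∧
      (∀ a ∈ Icc 1 a₁, D.IsSolution M a (fun t => V (a, t)) (fun t => W (a, t))) ∧
      ∀ x, ∃ a ∈ Icc 1 a₁, ∃ t ∈ Icc 0 D.T, V x = V (a, t) ∧ W x = W (a, t) := by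
  have hT := D.T_pos.le
  obtain ⟨L, K, hLK⟩ := hM.exists_vectorField_bounds
  obtain ⟨U, hU, hflow⟩ := exists_continuousOn_flow hT (fun t ht => (hLK t ht).1)
    (fun x => continuousOn_const.prodMk (hM.continuousOn_weight.mul continuousOn_const).neg)
    (fun t ht => (hLK t ht).2) ((0, 1) : ℝ × ℝ) a₁.toNNReal
  have hball : ∀ a ∈ Icc 1 a₁, ((0, a) : ℝ × ℝ) ∈ Metric.closedBall (0, 1) a₁.toNNReal := by
    intro a ha
    rw [Metric.mem_closedBall, Prod.dist_eq, Real.coe_toNNReal _ (by linarith), dist_self,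
      Real.dist_eq, abs_of_nonneg (sub_nonneg.2 ha.1)]
    exact max_le (by linarith) (by linarith [ha.2])
  let π : ℝ × ℝ → (ℝ × ℝ) × ℝ := fun x => ((0, projIcc 1 a₁ ha₁ x.1), projIcc 0 D.T hT x.2)
  have hπ : Continuous π := by fun_prop
  have hπ_of_mem : ∀ a ∈ Icc 1 a₁, ∀ t ∈ Icc 0 D.T, π (a, t) = ((0, a), t) := fun a ha t ht => by
    simp only [π, projIcc_of_mem ha₁ ha, projIcc_of_mem hT ht]
  have hUπ : Continuous (U ∘ π) :=
    hU.comp_continuous hπ fun x => ⟨hball _ (projIcc 1 a₁ ha₁ x.1).2, (projIcc 0 D.T hT x.2).2⟩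
  refine ⟨fun x => (U (π x)).1, fun x => (U (π x)).2, hUπ.fst, hUπ.snd, fun a ha => ?_,
    fun x => ⟨_, (projIcc 1 a₁ ha₁ x.1).2, _, (projIcc 0 D.T hT x.2).2, ?_⟩⟩
  · obtain ⟨hinit, hderiv⟩ := hflow _ (hball a ha)
    have hzero : U (π (a, 0)) = (0, a) := by rw [hπ_of_mem a ha 0 ⟨le_rfl, hT⟩, hinit]
    have hd : ∀ t ∈ Icc 0 D.T, HasDerivWithinAt (fun t => U (π (a, t)))
        (D.vectorField M t (U (π (a, t)))) (Icc 0 D.T) t := fun t ht => by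
      rw [hπ_of_mem a ha t ht]
      exact (hderiv t ht).congr (fun s hs => congrArg U (hπ_of_mem a ha s hs))
        (congrArg U (hπ_of_mem a ha t ht))
    exact ⟨congrArg Prod.fst hzero, congrArg Prod.snd hzero, fun t ht => (hd t ht).fst,
      fun t ht => (hd t ht).snd⟩
  · simp only [hπ_of_mem _ (projIcc 1 a₁ ha₁ x.1).2 _ (projIcc 0 D.T hT x.2).2, and_self, π]

/-- The derivative of the polar angle of `(w, v)` along a regularized solution. -/
noncomputable def angularSpeed (D : ShootingData) (M t v w : ℝ) : ℝ :=
  (D.velocity M w * w + v * (D.weight M t * D.force M v)) / (v ^ 2 + w ^ 2)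

lemma Admissible.angularSpeed_pos (hM : D.Admissible M) {t y : ℝ} (hy : y ≠ 0) :
    0 < D.angularSpeed M t 0 y := by
  have hvel : 0 < D.velocity M y * y := by
    rcases lt_or_gt_of_ne hy with h | h
    · have := hM.velocity_pos (neg_pos.2 h)
      rw [hM.velocity_neg] at this
      exact mul_pos_of_neg_of_neg (neg_pos.1 this) h
    · exact mul_pos (hM.velocity_pos h) h
  rw [angularSpeed, zero_mul, add_zero]
  positivity

lemma IsSolution.isAngle (S : D.IsSolution M a v w) (hM : D.Admissible M)
    (hne : ∀ t ∈ Icc 0 D.T, v t = 0 → w t ≠ 0) {θ g : ℝ → ℝ} (hθ0 : θ 0 = 0)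
    (hθ : ∀ t, HasDerivAt θ (g t) t)
    (hg : ∀ t ∈ Icc 0 D.T, g t = D.angularSpeed M t (v t) (w t)) : D.IsAngle v θ g := by
  have hsq : ∀ t ∈ Icc 0 D.T, v t ^ 2 + w t ^ 2 ≠ 0 := fun t ht h =>
    have hv : v t = 0 := by nlinarith [sq_nonneg (v t), sq_nonneg (w t)]
    hne t ht hv (by nlinarith [sq_nonneg (v t), sq_nonneg (w t)])
  have htan : ∀ t ∈ Icc 0 D.T, v t * Real.cos (θ t) = w t * Real.sin (θ t) := fun t ht =>
    mul_cos_eq_mul_sin_of_polarAngle S.continuousOn_v S.continuousOn_w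
      (fun t ht => S.hasDerivAt_v ht.1 ht.2) (fun t ht => S.hasDerivAt_w ht.1 ht.2) hsq
      (fun t _ => (hθ t).continuousAt.continuousWithinAt)
      (fun t ht => (hθ t).congr_deriv (by
        rw [hg t (Ioo_subset_Icc_self ht), angularSpeed, mul_neg, sub_neg_eq_add]))
      S.v_zero hθ0 ht
  refine ⟨hθ0, hθ, fun t ht => ⟨fun hv => ?_, fun hsin => ?_⟩, fun t ht hv => ?_⟩
  · have := htan t ht
    rw [hv, zero_mul] at this
    exact (mul_eq_zero.1 this.symm).resolve_left (hne t ht hv)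
  · have := htan t ht
    rw [hsin, mul_zero] at this
    refine (mul_eq_zero.1 this).resolve_right fun hcos => ?_
    have := Real.sin_sq_add_cos_sq (θ t)
    rw [hsin, hcos] at this
    norm_num at this
  · rw [hg t ht, hv]
    exact hM.angularSpeed_pos (hne t ht hv)

lemma Admissible.exists_flow_isAngle (hM : D.Admissible M) {a₁ : ℝ} (ha₁ : 1 ≤ a₁)
    (hne : ∀ a ∈ Icc 1 a₁, ∀ v w, D.IsSolution M a v w → ∀ t ∈ Icc 0 D.T, v t = 0 → w t ≠ 0) :
    ∃ V W Θ G : ℝ → ℝ → ℝ,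
      (∀ a ∈ Icc 1 a₁, D.IsSolution M a (V a) (W a) ∧ D.IsAngle (V a) (Θ a) (G a)) ∧
      Continuous fun a => Θ a D.T := by
  obtain ⟨V, W, hV, hW, hS, hproj⟩ := hM.exists_flow ha₁
  have hT := D.T_pos.le
  have hsq : ∀ x, V x ^ 2 + W x ^ 2 ≠ 0 := fun x h => by
    obtain ⟨a, ha, t, ht, hVx, hWx⟩ := hproj x
    have hVzero : V x = 0 := by nlinarith [sq_nonneg (V x), sq_nonneg (W x)]
    refine hne a ha _ _ (hS a ha) t ht (hVx.symm.trans hVzero) (hWx.symm.trans ?_)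
    nlinarith [sq_nonneg (V x), sq_nonneg (W x)]
  let G : ℝ × ℝ → ℝ := fun x => D.angularSpeed M (projIcc 0 D.T hT x.2) (V x) (W x)
  have hweight : Continuous fun x : ℝ × ℝ => D.weight M (projIcc 0 D.T hT x.2) :=
    hM.continuousOn_weight.comp_continuous (by fun_prop) fun x => (projIcc 0 D.T hT x.2).2
  have hG : Continuous G :=
    (((hM.continuous_velocity.comp hW).mul hW).add
      (hV.mul (hweight.mul (hM.continuous_force.comp hV)))).div ((hV.pow 2).add (hW.pow 2)) hsq
  refine ⟨fun a t => V (a, t), fun a t => W (a, t), fun a t => ∫ s in (0 : ℝ)..t, G (a, s),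
    fun a t => G (a, t), fun a ha => ⟨hS a ha, ?_⟩,
    intervalIntegral.continuous_parametric_intervalIntegral_of_continuous' hG 0 D.T⟩
  refine (hS a ha).isAngle hM (hne a ha _ _ (hS a ha)) intervalIntegral.integral_same
    (fun t => (hG.comp (by fun_prop)).integral_hasStrictDerivAt 0 t |>.hasDerivAt) fun t ht => ?_
  simp only [G, projIcc_of_mem hT ht]

lemma exists_isZeroEnumeration_regularized (D : ShootingData) : ∃ n₀ : ℕ, ∀ n ≥ n₀, ∃ a₁, 1 ≤ a₁ ∧
    ∀ᶠ M in atTop, ∃ a ∈ Icc 1 a₁, ∃ v w, D.IsSolution M a v w ∧ v D.T = 0 ∧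
      ∃ z : Fin n → ℝ, D.IsZeroEnumeration v z := by
  obtain ⟨W, w₀, t₂, hW, hw₀, ht₂, hbounds⟩ := D.exists_uniform_bounds (a₁ := 1) le_rfl
  have hδ : 0 < D.β / W ^ D.κ := div_pos D.β_pos (Real.rpow_pos_of_pos (by linarith) _)
  obtain ⟨n₀, hn₀⟩ := exists_nat_gt (D.T / (D.β / W ^ D.κ))
  rw [div_lt_iff₀ hδ] at hn₀
  refine ⟨n₀, fun n hn => ?_⟩
  have hℓ : 0 < D.T / (2 * n + 2) := div_pos D.T_pos (by positivity)
  have hℓT : D.T / (2 * n + 2) * (2 * n + 2) = D.T := div_mul_cancel₀ _ (by positivity)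
  obtain ⟨a₁, ha₁, hdense⟩ := D.exists_forall_exists_zero hℓ
    (div_le_self D.T_pos.le (by linarith [n.cast_nonneg (α := ℝ)]))
  obtain ⟨W', w₀', t₂', -, hw₀', ht₂', hbounds'⟩ := D.exists_uniform_bounds ha₁
  refine ⟨a₁, ha₁, ?_⟩
  filter_upwards [D.eventually_admissible, tendsto_inv_atTop_zero.eventually_le_const ht₂,
    tendsto_inv_atTop_zero.eventually_le_const ht₂', hdense] with M hM hMt hMt' hosc
  obtain ⟨V, U, Θ, G, hS, hΘ⟩ := hM.exists_flow_isAngle ha₁ fun a ha v w S t ht hvt hwt => by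
    have := (hbounds' M hM hMt' a ha v w S).le_abs_w t ht (by rw [hvt, abs_zero]; exact D.β_pos.le)
    rw [hwt, abs_zero] at this
    linarith
  have hlow : Θ 1 D.T ≤ (n + 1 : ℕ) * Real.pi := by
    obtain ⟨S, A⟩ := hS 1 ⟨le_rfl, ha₁⟩
    refine A.apply_T_le_of_gap (fun s t hs hst ht hvs hvt =>
      (hbounds M hM hMt 1 ⟨le_rfl, le_rfl⟩ _ _ S).div_le_sub_of_v_eq_zero S hM hW hw₀ hs hst ht
        hvs hvt) (hn₀.trans_le ?_)
    gcongr
    exact hn.trans n.le_succ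
  have hhigh : (n + 1 : ℕ) * Real.pi ≤ Θ a₁ D.T :=
    have ⟨S, A⟩ := hS a₁ ⟨ha₁, le_rfl⟩
    A.le_apply_T_of_dense hℓ hℓT (hosc _ _ S)
  obtain ⟨a, ha, haθ⟩ := intermediate_value_Icc ha₁ hΘ.continuousOn ⟨hlow, hhigh⟩
  obtain ⟨S, A⟩ := hS a ha
  exact ⟨a, ha, _, _, S, A.v_eq_zero (right_mem_Icc.2 D.T_pos.le) (k := (n + 1 : ℕ))
    (by exact_mod_cast haθ), A.exists_isZeroEnumeration haθ⟩

end ShootingData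

/-! ### The limit of the regularized solutions -/

/-- The odd extension of `x ↦ x ^ κ` from the half-line to `ℝ`, the limit of the regularized
velocities. -/
noncomputable def signedPow (κ x : ℝ) : ℝ := max x 0 ^ κ - max (-x) 0 ^ κ

lemma continuous_signedPow {κ : ℝ} (hκ : 0 < κ) : Continuous (signedPow κ) :=
  ((Real.continuous_rpow_const hκ.le).comp (continuous_id.max continuous_const)).sub
    ((Real.continuous_rpow_const hκ.le).comp (continuous_neg.max continuous_const))

lemma signedPow_of_nonneg {κ x : ℝ} (hκ : 0 < κ) (hx : 0 ≤ x) : signedPow κ x = x ^ κ := by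
  rw [signedPow, max_eq_left hx, max_eq_right (by linarith), Real.zero_rpow hκ.ne', sub_zero]

lemma signedPow_neg (κ x : ℝ) : signedPow κ (-x) = -signedPow κ x := by
  rw [signedPow, signedPow, neg_neg, neg_sub]

lemma eventually_nhdsWithin_prod_iff {ι : Type*} {l : Filter ι} {S : Set ℝ} {t : ℝ}
    {P : ℝ × ι → Prop} : (∀ᶠ p in 𝓝[S] t ×ˢ l, P p) ↔
      ∃ δ > 0, ∀ᶠ k in l, ∀ s ∈ S, |s - t| < δ → P (s, k) := by
  rw [(Metric.nhdsWithin_basis_ball.prod l.basis_sets).eventually_iff]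
  constructor
  · rintro ⟨⟨δ, A⟩, ⟨hδ, hA⟩, h⟩
    exact ⟨δ, hδ, mem_of_superset hA fun k hk s hs hst => h (mk_mem_prod ⟨hst, hs⟩ hk)⟩
  · rintro ⟨δ, hδ, h⟩
    exact ⟨(δ, _), ⟨hδ, h⟩, fun p hp => hp.2 p.1 hp.1.2 hp.1.1⟩

lemma continuousWithinAt_of_tendsto_prod {X Y ι : Type*} [TopologicalSpace X]
    [TopologicalSpace Y] [RegularSpace Y] {l : Filter ι} [l.NeBot] {g : ι → X → Y} {G : X → Y}
    {S : Set X} {t : X} (hG : ∀ s ∈ S, Tendsto (fun k => g k s) l (𝓝 (G s)))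
    (h : Tendsto (fun p : X × ι => g p.2 p.1) (𝓝[S] t ×ˢ l) (𝓝 (G t))) :
    ContinuousWithinAt G S t := by
  refine (closed_nhds_basis (G t)).tendsto_right_iff.2 fun C hC => ?_
  filter_upwards [(h.eventually_mem hC.1).curry, self_mem_nhdsWithin] with s hs hsS
  exact hC.2.mem_of_tendsto (hG s hsS) hs

lemma abs_sub_le_of_abs_hasDerivAt_le_of_near {g g' : ℝ → ℝ} {T s t δ B : ℝ} (hs : s ∈ Icc 0 T)
    (ht : t ∈ Icc 0 T) (hst : |s - t| < δ) (hc : ContinuousOn g (Icc 0 T))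
    (hd : ∀ x ∈ Ioo 0 T, HasDerivAt g (g' x) x) (hB : ∀ x ∈ Ioo 0 T, |x - t| < δ → |g' x| ≤ B) :
    |g s - g t| ≤ B * |s - t| := by
  have hbound : ∀ x ∈ Ioo 0 T, x ∈ uIcc s t → |g' x| ≤ B := fun x hx hxst => hB x hx <| by
    rw [abs_sub_comm] at hst ⊢
    exact (abs_sub_right_of_mem_uIcc hxst).trans_lt hst
  rcases le_total s t with h | h
  · rw [abs_sub_comm, abs_sub_comm s, abs_of_nonneg (sub_nonneg.2 h)]
    have hsub : Ioo s t ⊆ Ioo 0 T := Ioo_subset_Ioo hs.1 ht.2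
    exact abs_sub_le_of_abs_hasDerivAt_le h (hc.mono (Icc_subset_Icc hs.1 ht.2))
      (fun x hx => hd x (hsub hx))
      fun x hx => hbound x (hsub hx) (Icc_subset_uIcc (Ioo_subset_Icc_self hx))
  · rw [abs_of_nonneg (sub_nonneg.2 h)]
    have hsub : Ioo t s ⊆ Ioo 0 T := Ioo_subset_Ioo ht.1 hs.2
    exact abs_sub_le_of_abs_hasDerivAt_le h (hc.mono (Icc_subset_Icc ht.1 hs.2))
      (fun x hx => hd x (hsub hx))
      fun x hx => hbound x (hsub hx) (Icc_subset_uIcc' (Ioo_subset_Icc_self hx))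

lemma hasDerivWithinAt_of_tendsto_prod {ι : Type*} {l : Filter ι} [l.NeBot] {g g' : ι → ℝ → ℝ}
    {G : ℝ → ℝ} {T t L : ℝ} (ht : t ∈ Icc 0 T)
    (hG : ∀ s ∈ Icc 0 T, Tendsto (fun k => g k s) l (𝓝 (G s)))
    (hc : ∀ k, ContinuousOn (g k) (Icc 0 T))
    (hd : ∀ k, ∀ s ∈ Ioo 0 T, HasDerivAt (g k) (g' k s) s)
    (hL : Tendsto (fun p : ℝ × ι => g' p.2 p.1) (𝓝[Icc 0 T] t ×ˢ l) (𝓝 L)) :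
    HasDerivWithinAt G L (Icc 0 T) t := by
  rw [hasDerivWithinAt_iff_isLittleO, Asymptotics.isLittleO_iff]
  intro ε hε
  obtain ⟨δ, hδ, hnear⟩ := eventually_nhdsWithin_prod_iff.1 (hL (Metric.closedBall_mem_nhds L hε))
  filter_upwards [inter_mem_nhdsWithin (Icc 0 T) (Metric.ball_mem_nhds t hδ)] with s ⟨hs, hst⟩
  have hlim : Tendsto (fun k => |g k s - s * L - (g k t - t * L)|) l
      (𝓝 |G s - s * L - (G t - t * L)|) :=
    (((hG s hs).sub_const _).sub ((hG t ht).sub_const _)).abs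
  rw [smul_eq_mul, show G s - G t - (s - t) * L = G s - s * L - (G t - t * L) by ring]
  refine le_of_tendsto hlim ?_
  filter_upwards [hnear] with k hk
  refine abs_sub_le_of_abs_hasDerivAt_le_of_near (g := fun x => g k x - x * L) hs ht hst
    ((hc k).sub (continuousOn_id.mul continuousOn_const))
    (fun x hx => by simpa using (hd k x hx).fun_sub ((hasDerivAt_id x).mul_const L))
    fun x hx hxt => hk x (Ioo_subset_Icc_self hx) hxt

lemma abs_sub_eq_abs_abs_sub_abs {g : ℝ → ℝ} {s t : ℝ} (hst : s ≤ t)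
    (hg : ContinuousOn g (Icc s t)) (h : ∀ x ∈ Icc s t, g x ≠ 0) :
    |g t - g s| = |(|g t| - |g s|)| := by
  have hs := left_mem_Icc.2 hst
  have ht := right_mem_Icc.2 hst
  rcases forall_lt_or_forall_lt_neg le_rfl hg fun x hx => abs_pos.2 (h x hx) with hpos | hneg
  · rw [abs_of_pos (hpos t ht), abs_of_pos (hpos s hs)]
  · rw [neg_zero] at hneg
    rw [abs_of_neg (hneg t ht), abs_of_neg (hneg s hs), neg_sub_neg, abs_sub_comm]

lemma tendsto_limUnder_of_forall_mem {X ι : Type*} [TopologicalSpace X] [Nonempty X] {K : Set X}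
    (hK : IsCompact K) (l : Ultrafilter ι) {g : ι → X} (h : ∀ k, g k ∈ K) :
    Tendsto g l (𝓝 (limUnder (l : Filter ι) g)) := by
  obtain ⟨x, -, hx⟩ := hK.ultrafilter_le_nhds (l.map g)
    (le_principal_iff.2 (Eventually.of_forall (f := (l : Filter ι)) h))
  exact tendsto_nhds_limUnder ⟨x, hx⟩

namespace ShootingData

variable {D : ShootingData} {M a : ℝ} {v w : ℝ → ℝ}

lemma continuousAt_f (D : ShootingData) {x : ℝ} (hx : x ≠ 0) : ContinuousAt D.f x := by
  have hpos : ∀ {y : ℝ}, 0 < y → ContinuousAt D.f y := fun hy =>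
    D.f_lip.continuousOn.continuousAt (Ioi_mem_nhds hy)
  rcases lt_or_gt_of_ne hx with h | h
  · have hneg : ContinuousAt (fun y => -D.f (-y)) x :=
      (ContinuousAt.comp (f := Neg.neg) (hpos (neg_pos.2 h)) continuous_neg.continuousAt).neg
    refine hneg.congr ?_
    filter_upwards [Iio_mem_nhds h] with y hy
    rw [D.f_odd y (ne_of_lt hy), neg_neg]
  · exact hpos h

lemma Admissible.force_of_abs_mem (hM : D.Admissible M) {x : ℝ} (hx : |x| ∈ Icc M⁻¹ M) :
    D.force M x = D.f x := by
  rcases abs_choice x with habs | habs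
  · rw [habs] at hx
    exact hM.force_of_mem hx
  · have hx0 : x ≠ 0 := abs_pos.1 (hM.inv_pos.trans_le hx.1)
    rw [habs] at hx
    rw [← neg_inj, ← hM.force_neg, hM.force_of_mem hx, D.f_odd x hx0]

lemma Admissible.abs_velocity_sub_signedPow_le (hM : D.Admissible M) {x : ℝ} (h : |x| ≤ M) :
    |D.velocity M x - signedPow D.κ x| ≤ M⁻¹ ^ D.κ := by
  have hκ := D.κ_pos
  have hnonneg : ∀ y, 0 ≤ y → y ≤ M → |D.velocity M y - signedPow D.κ y| ≤ M⁻¹ ^ D.κ := by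
    intro y h0 hyM
    rw [signedPow_of_nonneg hκ h0]
    rcases le_total M⁻¹ y with hy | hy
    · rw [hM.velocity_of_mem ⟨hy, hyM⟩, sub_self, abs_zero]
      exact hM.inv_rpow_κ_pos.le
    · have hvel := hM.velocity_mono h0 hy
      rw [hM.velocity_of_mem ⟨le_rfl, inv_le_self_of_one_le hM.one_le⟩] at hvel
      exact abs_sub_le_of_nonneg_of_le (hM.velocity_nonneg h0) hvel (Real.rpow_nonneg h0 _)
        (Real.rpow_le_rpow h0 hy hκ.le)
  rcases abs_cases x with ⟨habs, hx⟩ | ⟨habs, hx⟩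
  · exact hnonneg x hx (habs ▸ h)
  · have := hnonneg (-x) (neg_nonneg.2 hx.le) (habs ▸ h)
    rwa [hM.velocity_neg, signedPow_neg, neg_sub_neg, abs_sub_comm] at this

lemma Admissible.rpow_mul_abs_sub_le (hM : D.Admissible M) {w₀ x y : ℝ} (hw : w₀ ∈ Icc M⁻¹ M)
    (hx : w₀ ≤ |x|) (hy : w₀ ≤ |y|) :
    w₀ ^ D.κ * |(|y| - |x|)| ≤ |D.kinetic M y - D.kinetic M x| := by
  have hw₀ : 0 ≤ w₀ := hM.inv_pos.le.trans hw.1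
  have hordered : ∀ r s, w₀ ≤ r → r ≤ s → w₀ ^ D.κ * (s - r) ≤ D.kinetic M s - D.kinetic M r := by
    intro r s hr hrs
    refine le_trans ?_ (hM.velocity_mul_sub_le_kinetic_sub (hw₀.trans hr) hrs)
    rw [← hM.velocity_of_mem hw]
    exact mul_le_mul_of_nonneg_right (hM.velocity_mono hw₀ hr) (sub_nonneg.2 hrs)
  rw [← hM.kinetic_abs x, ← hM.kinetic_abs y]
  rcases le_total |x| |y| with h | h
  · rw [abs_of_nonneg (sub_nonneg.2 h)]
    exact (hordered _ _ hx h).trans (le_abs_self _)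
  · rw [abs_sub_comm, abs_of_nonneg (sub_nonneg.2 h), abs_sub_comm]
    exact (hordered _ _ hy h).trans (le_abs_self _)

section FixedParameter

variable (S : D.IsSolution M a v w) (hM : D.Admissible M) {W w₀ t₂ s t : ℝ}
include S hM

lemma IsSolution.abs_kinetic_sub_le {F : ℝ} (h0 : M⁻¹ ≤ s) (hst : s ≤ t) (ht : t ≤ D.T)
    (hF : ∀ x ∈ Icc s t, |D.potential M (v x)| ≤ F) :
    |D.kinetic M (w t) - D.kinetic M (w s)| ≤ 2 * D.h s * F := by
  have hs0 : 0 < s := hM.inv_pos.trans_le h0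
  have hlower := S.energy_sub_mul_le_of_potential_le hM h0 hst ht fun x hx =>
    (abs_le.1 (hF x hx)).2
  have hupper := S.energy_sub_mul_le_of_le_potential hM h0 hst ht fun x hx =>
    (abs_le.1 (hF x hx)).1
  have hmul : ∀ x ∈ Icc s t, |D.h x * D.potential M (v x)| ≤ D.h x * F := fun x hx => by
    have hh := D.h_pos x ⟨hs0.trans_le hx.1, hx.2.trans ht⟩
    rw [abs_mul, abs_of_pos hh]
    exact mul_le_mul_of_nonneg_left (hF x hx) hh.le
  have hs := abs_le.1 (hmul s (left_mem_Icc.2 hst))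
  have ht := abs_le.1 (hmul t (right_mem_Icc.2 hst))
  unfold energy at hlower hupper
  rw [abs_le]
  constructor <;> linarith [hs.1, hs.2, ht.1, ht.2]

lemma IsSolution.exists_v_eq_zero_of_le_w (hw : w₀ ∈ Icc M⁻¹ M) {η : ℝ} (hη : 0 ≤ η)
    (h0 : 0 ≤ t - η) (hT : t + η ≤ D.T) (hwlow : ∀ x ∈ Icc (t - η) (t + η), w₀ ≤ w x)
    (hvt : |v t| ≤ w₀ ^ D.κ * η) : ∃ z ∈ Icc (t - η) (t + η), v z = 0 := by
  have hvel : ∀ x ∈ Icc (t - η) (t + η), w₀ ^ D.κ ≤ D.velocity M (w x) := fun x hx => by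
    rw [← hM.velocity_of_mem hw]
    exact hM.velocity_mono (hM.inv_pos.le.trans hw.1) (hwlow x hx)
  have hleft := S.mul_sub_le_v_sub h0 (by linarith) (by linarith) fun x (hx : x ∈ Ioo (t - η) t) =>
    hvel x ⟨hx.1.le, by linarith [hx.2]⟩
  have hright := S.mul_sub_le_v_sub (by linarith) (by linarith) hT
    fun x (hx : x ∈ Ioo t (t + η)) => hvel x ⟨by linarith [hx.1], hx.2.le⟩
  rw [sub_sub_cancel] at hleft
  rw [add_sub_cancel_left] at hright
  obtain ⟨hvt_ge, hvt_le⟩ := abs_le.1 hvt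
  exact intermediate_value_Icc (by linarith) (S.continuousOn_v.mono (Icc_subset_Icc h0 hT))
    ⟨by linarith, by linarith⟩

variable (B : D.Bounds W w₀ t₂ v w)
include B

lemma Bounds.abs_v_sub_le (hW : 1 ≤ W) (hs : s ∈ Icc 0 D.T) (ht : t ∈ Icc 0 D.T) :
    |v t - v s| ≤ W ^ D.κ * |t - s| := by
  rcases le_total s t with h | h
  · rw [abs_of_nonneg (sub_nonneg.2 h)]
    exact S.abs_v_sub_le hM hW B.abs_w_le hs.1 h ht.2
  · rw [abs_sub_comm, abs_sub_comm t, abs_of_nonneg (sub_nonneg.2 h)]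
    exact S.abs_v_sub_le hM hW B.abs_w_le ht.1 h hs.2

lemma Bounds.abs_w_sub_le (hMt : M⁻¹ ≤ t₂) (hw : w₀ ∈ Icc M⁻¹ M) (hs : t₂ ≤ s) (hst : s ≤ t)
    (ht : t ≤ D.T) {ρ : ℝ} (hρ : ρ ≤ D.β) (hv : ∀ x ∈ Icc s t, |v x| ≤ ρ) :
    w₀ ^ D.κ * |w t - w s| ≤ 2 * D.h t₂ * (D.C / (1 - D.m) * ρ ^ (1 - D.m)) := by
  have hm := sub_pos.2 D.m_lt_one
  have hC := D.C_pos
  have ht₂ : 0 < t₂ := hM.inv_pos.trans_le hMt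
  have hs0 : 0 < s := ht₂.trans_le hs
  have hpot : ∀ x ∈ Icc s t, |D.potential M (v x)| ≤ D.C / (1 - D.m) * ρ ^ (1 - D.m) := by
    intro x hx
    have hvx := hv x hx
    exact (hM.abs_potential_le (hvx.trans hρ)).trans (by gcongr)
  have hwlow : ∀ x ∈ Icc s t, w₀ ≤ |w x| := fun x hx =>
    B.le_abs_w x ⟨hs0.le.trans hx.1, hx.2.trans ht⟩ ((hv x hx).trans hρ)
  have hw_ne : ∀ x ∈ Icc s t, w x ≠ 0 := fun x hx =>
    abs_pos.1 ((hM.inv_pos.trans_le hw.1).trans_le (hwlow x hx))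
  have hh : D.h s ≤ D.h t₂ :=
    h_antitoneOn ⟨ht₂, hs.trans (hst.trans ht)⟩ ⟨hs0, hst.trans ht⟩ hs
  have hF := (abs_nonneg _).trans (hpot s (left_mem_Icc.2 hst))
  calc w₀ ^ D.κ * |w t - w s| = w₀ ^ D.κ * |(|w t| - |w s|)| := by
        rw [abs_sub_eq_abs_abs_sub_abs hst (S.continuousOn_w.mono (Icc_subset_Icc hs0.le ht)) hw_ne]
    _ ≤ |D.kinetic M (w t) - D.kinetic M (w s)| :=
        hM.rpow_mul_abs_sub_le hw (hwlow s (left_mem_Icc.2 hst)) (hwlow t (right_mem_Icc.2 hst))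
    _ ≤ 2 * D.h s * (D.C / (1 - D.m) * ρ ^ (1 - D.m)) :=
        S.abs_kinetic_sub_le hM (hMt.trans hs) hst ht hpot
    _ ≤ 2 * D.h t₂ * (D.C / (1 - D.m) * ρ ^ (1 - D.m)) := by gcongr

lemma Bounds.exists_v_eq_zero (hw : w₀ ∈ Icc M⁻¹ M) {η : ℝ} (hη : 0 ≤ η) (h0 : 0 ≤ t - η)
    (hT : t + η ≤ D.T) (hv : ∀ x ∈ Icc (t - η) (t + η), |v x| ≤ D.β)
    (hvt : |v t| ≤ w₀ ^ D.κ * η) : ∃ z ∈ Icc (t - η) (t + η), v z = 0 := by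
  have hsub : Icc (t - η) (t + η) ⊆ Icc 0 D.T := Icc_subset_Icc h0 hT
  have hwlow : ∀ x ∈ Icc (t - η) (t + η), w₀ ≤ |w x| := fun x hx =>
    B.le_abs_w x (hsub hx) (hv x hx)
  have hw₀ : 0 < w₀ := hM.inv_pos.trans_le hw.1
  rcases forall_lt_or_forall_lt_neg le_rfl (S.continuousOn_w.mono hsub)
      (fun x hx => hw₀.trans_le (hwlow x hx)) with hpos | hneg
  · exact S.exists_v_eq_zero_of_le_w hM hw hη h0 hT
      (fun x hx => (hwlow x hx).trans_eq (abs_of_pos (hpos x hx))) hvt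
  · rw [neg_zero] at hneg
    obtain ⟨z, hz, hvz⟩ := (S.neg hM).exists_v_eq_zero_of_le_w hM hw hη h0 hT
      (fun x hx => (hwlow x hx).trans_eq (abs_of_neg (hneg x hx))) (by rwa [abs_neg])
    exact ⟨z, hz, neg_eq_zero.1 hvz⟩

end FixedParameter

/-- `(V, U)` is the pointwise limit along `l` of regularized solutions `(v k, w k)` that satisfy
common bounds, as the regularization parameter `M k` tends to infinity. -/
structure IsLimit {ι : Type*} (D : ShootingData) (l : Filter ι) (M a : ι → ℝ)
    (v w : ι → ℝ → ℝ) (W w₀ t₂ : ℝ) (V U : ℝ → ℝ) : Prop where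
  one_le_W : 1 ≤ W
  w₀_pos : 0 < w₀
  t₂_pos : 0 < t₂
  admissible : ∀ k, D.Admissible (M k)
  sol : ∀ k, D.IsSolution (M k) (a k) (v k) (w k)
  bounds : ∀ k, D.Bounds W w₀ t₂ (v k) (w k)
  tendsto_M : Tendsto M l atTop
  tendsto_v : ∀ t ∈ Icc 0 D.T, Tendsto (fun k => v k t) l (𝓝 (V t))
  tendsto_w : ∀ t ∈ Icc 0 D.T, Tendsto (fun k => w k t) l (𝓝 (U t))

namespace IsLimit

variable {ι : Type*} {l : Filter ι} {M a : ι → ℝ} {v w : ι → ℝ → ℝ} {W w₀ t₂ t : ℝ} {V U : ℝ → ℝ}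

lemma tendsto_mul_abs_sub_prod (c : ℝ) (S : Set ℝ) :
    Tendsto (fun p : ℝ × ι => c * |p.1 - t|) (𝓝[S] t ×ˢ l) (𝓝 0) := by
  have hfst : Tendsto (Prod.fst : ℝ × ι → ℝ) (𝓝[S] t ×ˢ l) (𝓝 t) :=
    tendsto_fst.mono_right nhdsWithin_le_nhds
  simpa using ((hfst.sub_const t).abs).const_mul c

section Convergence

variable (H : D.IsLimit l M a v w W w₀ t₂ V U)
include H

lemma eventually_inv_le {ε : ℝ} (hε : 0 < ε) : ∀ᶠ k in l, (M k)⁻¹ ≤ ε :=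
  (tendsto_inv_atTop_zero.comp H.tendsto_M).eventually_le_const hε

lemma eventually_mem_Icc {x : ℝ} (hx : 0 < x) : ∀ᶠ k in l, x ∈ Icc (M k)⁻¹ (M k) :=
  (H.eventually_inv_le hx).and (H.tendsto_M.eventually_ge_atTop x)

lemma tendsto_v_prod (ht : t ∈ Icc 0 D.T) :
    Tendsto (fun p : ℝ × ι => v p.2 p.1) (𝓝[Icc 0 D.T] t ×ˢ l) (𝓝 (V t)) := by
  have hdiff : Tendsto (fun p : ℝ × ι => v p.2 p.1 - v p.2 t) (𝓝[Icc 0 D.T] t ×ˢ l) (𝓝 0) := by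
    refine squeeze_zero_norm' ?_ (tendsto_mul_abs_sub_prod (W ^ D.κ) _)
    filter_upwards [tendsto_fst.eventually self_mem_nhdsWithin] with p hp
    exact (H.bounds p.2).abs_v_sub_le (H.sol p.2) (H.admissible p.2) H.one_le_W ht hp
  simpa using hdiff.add ((H.tendsto_v t ht).comp tendsto_snd)

lemma tendsto_weight_mul_force_prod (ht : t ∈ Ioc 0 D.T) (hV : V t ≠ 0) :
    Tendsto (fun p : ℝ × ι => -(D.weight (M p.2) p.1 * D.force (M p.2) (v p.2 p.1)))
      (𝓝[Icc 0 D.T] t ×ˢ l) (𝓝 (-(D.h t * D.f (V t)))) := by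
  have hv := H.tendsto_v_prod (Ioc_subset_Icc_self ht)
  have hpos : ∀ᶠ s in 𝓝[Icc 0 D.T] t, t / 2 ≤ s :=
    nhdsWithin_le_nhds (Ici_mem_nhds (half_lt_self ht.1))
  have hIoc : Ioc 0 D.T ∈ 𝓝[Icc 0 D.T] t := by
    filter_upwards [hpos, self_mem_nhdsWithin] with s hts hs
    exact ⟨(half_pos ht.1).trans_le hts, hs.2⟩
  have hh : Tendsto D.h (𝓝[Icc 0 D.T] t) (𝓝 (D.h t)) :=
    (D.h_cont t ht).mono_of_mem_nhdsWithin hIoc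
  have hlim := ((hh.comp tendsto_fst).mul ((D.continuousAt_f hV).tendsto.comp hv)).neg
  refine hlim.congr' ?_
  have hV0 : 0 < |V t| := abs_pos.2 hV
  filter_upwards [tendsto_fst.eventually hpos, hv.abs.eventually_const_lt (half_lt_self hV0),
    hv.abs.eventually_lt_const (show |V t| < 2 * |V t| by linarith),
    tendsto_snd.eventually (H.eventually_inv_le (half_pos ht.1)),
    tendsto_snd.eventually (H.eventually_inv_le (half_pos hV0)),
    tendsto_snd.eventually (H.tendsto_M.eventually_ge_atTop (2 * |V t|))]
    with p hts hv_gt hv_lt hM_t hM_V hM_ge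
  rw [weight_of_ge (hM_t.trans hts),
    (H.admissible p.2).force_of_abs_mem ⟨hM_V.trans hv_gt.le, hv_lt.le.trans hM_ge⟩]
  rfl

lemma tendsto_w_prod_of_tendsto_sub (ht : t ∈ Icc 0 D.T)
    (h : Tendsto (fun p : ℝ × ι => w p.2 p.1 - w p.2 t) (𝓝[Icc 0 D.T] t ×ˢ l) (𝓝 0)) :
    Tendsto (fun p : ℝ × ι => w p.2 p.1) (𝓝[Icc 0 D.T] t ×ˢ l) (𝓝 (U t)) := by
  simpa using h.add ((H.tendsto_w t ht).comp tendsto_snd)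

lemma tendsto_w_prod_of_ne_zero (ht : t ∈ Ioc 0 D.T) (hV : V t ≠ 0) :
    Tendsto (fun p : ℝ × ι => w p.2 p.1) (𝓝[Icc 0 D.T] t ×ˢ l) (𝓝 (U t)) := by
  have ht' := Ioc_subset_Icc_self ht
  obtain ⟨δ, hδ, hbound⟩ := eventually_nhdsWithin_prod_iff.1
    ((H.tendsto_weight_mul_force_prod ht hV).abs.eventually_le_const (lt_add_one _))
  refine H.tendsto_w_prod_of_tendsto_sub ht' (squeeze_zero_norm' ?_
    (tendsto_mul_abs_sub_prod (|-(D.h t * D.f (V t))| + 1) _))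
  refine eventually_nhdsWithin_prod_iff.2 ⟨δ, hδ, ?_⟩
  filter_upwards [hbound] with k hk s hs hst
  exact abs_sub_le_of_abs_hasDerivAt_le_of_near hs ht' hst (H.sol k).continuousOn_w
    (fun x hx => (H.sol k).hasDerivAt_w hx.1 hx.2)
    fun x hx hxt => hk x (Ioo_subset_Icc_self hx) hxt

lemma t₂_lt_of_V_eq_zero [l.NeBot] (ht : t ∈ Ioc 0 D.T) (hV : V t = 0) : t₂ < t := by
  by_contra! h
  have hle : t ≤ V t :=
    ge_of_tendsto' (H.tendsto_v t (Ioc_subset_Icc_self ht)) fun k =>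
      (H.bounds k).le_v t ⟨ht.1.le, h⟩
  linarith [ht.1]

/-- At a zero of the limit the force is unbounded, and the energy controls `w` instead. -/
lemma tendsto_w_prod_of_eq_zero [l.NeBot] (ht : t ∈ Ioc 0 D.T) (hV : V t = 0) :
    Tendsto (fun p : ℝ × ι => w p.2 p.1) (𝓝[Icc 0 D.T] t ×ˢ l) (𝓝 (U t)) := by
  have ht' := Ioc_subset_Icc_self ht
  have ht₂ := H.t₂_lt_of_V_eq_zero ht hV
  have hw₀ : 0 < w₀ ^ D.κ := Real.rpow_pos_of_pos H.w₀_pos _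
  have hW : 0 ≤ W ^ D.κ := Real.rpow_nonneg (zero_le_one.trans H.one_le_W) _
  set ρ : ℝ × ι → ℝ := fun p => |v p.2 t| + W ^ D.κ * |p.1 - t|
  set F : ℝ → ℝ := fun r => 2 * D.h t₂ * (D.C / (1 - D.m) * r ^ (1 - D.m)) / w₀ ^ D.κ
  have hρ : Tendsto ρ (𝓝[Icc 0 D.T] t ×ˢ l) (𝓝 0) := by
    simpa [hV] using ((H.tendsto_v t ht').abs.comp tendsto_snd).add
      (tendsto_mul_abs_sub_prod (W ^ D.κ) (Icc 0 D.T))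
  have hm := sub_pos.2 D.m_lt_one
  have hF : Tendsto F (𝓝 0) (𝓝 0) := by
    have hcont : Continuous F :=
      ((Real.continuous_rpow_const hm.le).const_mul _ |>.const_mul _).div_const _
    simpa [F, Real.zero_rpow hm.ne'] using hcont.tendsto 0
  refine H.tendsto_w_prod_of_tendsto_sub ht' (squeeze_zero_norm' ?_ (hF.comp hρ))
  filter_upwards [tendsto_fst.eventually self_mem_nhdsWithin,
    tendsto_fst.eventually (nhdsWithin_le_nhds (Ici_mem_nhds ht₂)),
    hρ.eventually_le_const D.β_pos, tendsto_snd.eventually (H.eventually_inv_le H.t₂_pos),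
    tendsto_snd.eventually (H.eventually_mem_Icc H.w₀_pos)] with p hp hp₂ hpρ hMt hw
  have B := H.bounds p.2
  have S := H.sol p.2
  have hM := H.admissible p.2
  have hv : ∀ x ∈ uIcc p.1 t, |v p.2 x| ≤ ρ p := fun x hx => by
    have hxT : x ∈ Icc 0 D.T := (ordConnected_Icc.uIcc_subset hp ht') hx
    have hxt : |x - t| ≤ |p.1 - t| := by
      rw [abs_sub_comm, abs_sub_comm p.1]
      exact abs_sub_right_of_mem_uIcc hx
    calc |v p.2 x| ≤ |v p.2 t| + |v p.2 x - v p.2 t| := by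
          simpa using abs_add_le (v p.2 t) (v p.2 x - v p.2 t)
      _ ≤ |v p.2 t| + W ^ D.κ * |x - t| := by gcongr; exact B.abs_v_sub_le S hM H.one_le_W ht' hxT
      _ ≤ ρ p := add_le_add_right (mul_le_mul_of_nonneg_left hxt hW) _
  rw [Real.norm_eq_abs, Function.comp_apply, le_div_iff₀' hw₀]
  rcases le_total p.1 t with h | h
  · rw [abs_sub_comm]
    exact B.abs_w_sub_le S hM hMt hw hp₂ h ht.2 hpρ fun x hx => hv x (Icc_subset_uIcc hx)
  · exact B.abs_w_sub_le S hM hMt hw ht₂.le h hp.2 hpρ fun x hx => hv x (Icc_subset_uIcc' hx)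

variable [l.NeBot]

lemma tendsto_w_prod (ht : t ∈ Ioc 0 D.T) :
    Tendsto (fun p : ℝ × ι => w p.2 p.1) (𝓝[Icc 0 D.T] t ×ˢ l) (𝓝 (U t)) := by
  by_cases hV : V t = 0
  · exact H.tendsto_w_prod_of_eq_zero ht hV
  · exact H.tendsto_w_prod_of_ne_zero ht hV

lemma tendsto_velocity_prod (ht : t ∈ Ioc 0 D.T) :
    Tendsto (fun p : ℝ × ι => D.velocity (M p.2) (w p.2 p.1)) (𝓝[Icc 0 D.T] t ×ˢ l)
      (𝓝 (signedPow D.κ (U t))) := by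
  have hlim : Tendsto (fun p : ℝ × ι => signedPow D.κ (w p.2 p.1)) (𝓝[Icc 0 D.T] t ×ˢ l)
      (𝓝 (signedPow D.κ (U t))) :=
    ((continuous_signedPow D.κ_pos).tendsto _).comp (H.tendsto_w_prod ht)
  have hinv : Tendsto (fun p : ℝ × ι => (M p.2)⁻¹ ^ D.κ) (𝓝[Icc 0 D.T] t ×ˢ l) (𝓝 0) := by
    have := (tendsto_inv_atTop_zero.comp (H.tendsto_M.comp (tendsto_snd (f := 𝓝[Icc 0 D.T] t)))
      ).rpow_const (p := D.κ) (Or.inr D.κ_pos.le)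
    rwa [Real.zero_rpow D.κ_pos.ne'] at this
  have hdiff : Tendsto (fun p : ℝ × ι => D.velocity (M p.2) (w p.2 p.1)
      - signedPow D.κ (w p.2 p.1)) (𝓝[Icc 0 D.T] t ×ˢ l) (𝓝 0) := by
    refine squeeze_zero_norm' ?_ hinv
    filter_upwards [tendsto_fst.eventually self_mem_nhdsWithin,
      tendsto_snd.eventually (H.tendsto_M.eventually_ge_atTop W)] with p hp hW
    exact (H.admissible p.2).abs_velocity_sub_signedPow_le
      (((H.bounds p.2).abs_w_le p.1 hp).trans hW)
  simpa using hdiff.add hlim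

lemma hasDerivWithinAt_V (ht : t ∈ Ioc 0 D.T) :
    HasDerivWithinAt V (signedPow D.κ (U t)) (Icc 0 D.T) t :=
  hasDerivWithinAt_of_tendsto_prod (Ioc_subset_Icc_self ht) H.tendsto_v
    (fun k => (H.sol k).continuousOn_v) (fun k _ hs => (H.sol k).hasDerivAt_v hs.1 hs.2)
    (H.tendsto_velocity_prod ht)

lemma hasDerivWithinAt_U (ht : t ∈ Ioc 0 D.T) (hV : V t ≠ 0) :
    HasDerivWithinAt U (-(D.h t * D.f (V t))) (Icc 0 D.T) t :=
  hasDerivWithinAt_of_tendsto_prod (Ioc_subset_Icc_self ht) H.tendsto_w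
    (fun k => (H.sol k).continuousOn_w) (fun k _ hs => (H.sol k).hasDerivAt_w hs.1 hs.2)
    (H.tendsto_weight_mul_force_prod ht hV)

lemma continuousOn_V : ContinuousOn V (Icc 0 D.T) := fun _ ht =>
  continuousWithinAt_of_tendsto_prod H.tendsto_v (H.tendsto_v_prod ht)

lemma continuousOn_U : ContinuousOn U (Ioc 0 D.T) := fun _ ht =>
  (continuousWithinAt_of_tendsto_prod H.tendsto_w (H.tendsto_w_prod ht)).mono Ioc_subset_Icc_self

lemma V_zero : V 0 = 0 :=
  tendsto_nhds_unique (H.tendsto_v 0 (left_mem_Icc.2 D.T_pos.le))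
    (tendsto_const_nhds.congr fun k => (H.sol k).v_zero.symm)

lemma U_ne_zero (ht : t ∈ Icc 0 D.T) (hV : V t = 0) : U t ≠ 0 := by
  have hv := (H.tendsto_v t ht).abs
  rw [hV, abs_zero] at hv
  have hle : w₀ ≤ |U t| := by
    refine ge_of_tendsto (H.tendsto_w t ht).abs ?_
    filter_upwards [hv.eventually_le_const D.β_pos] with k hk using (H.bounds k).le_abs_w t ht hk
  exact abs_pos.1 (H.w₀_pos.trans_le hle)

omit [l.NeBot] in
lemma eventually_exists_v_eq_zero {η : ℝ} (hη : 0 < η) (ht : t ∈ Ioo 0 D.T) (hV : V t = 0) :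
    ∀ᶠ k in l, ∃ z ∈ Ioo 0 D.T, |z - t| ≤ η ∧ v k z = 0 := by
  have ht' := Ioo_subset_Icc_self ht
  have hv : Tendsto (fun p : ℝ × ι => |v p.2 p.1|) (𝓝[univ] t ×ˢ l) (𝓝 0) := by
    rw [nhdsWithin_univ, ← nhdsWithin_eq_nhds.2 (Icc_mem_nhds ht.1 ht.2)]
    simpa [hV] using (H.tendsto_v_prod ht').abs
  have hIoo : Ioo 0 D.T ∈ 𝓝[univ] t := nhdsWithin_le_nhds (Ioo_mem_nhds ht.1 ht.2)
  obtain ⟨δ, hδ, hnear⟩ := eventually_nhdsWithin_prod_iff.1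
    ((hv.eventually_le_const D.β_pos).and (tendsto_fst.eventually hIoo))
  obtain ⟨ν, hν, hνδ⟩ := exists_between (lt_min hη hδ)
  obtain ⟨hνη, hνδ⟩ := lt_min_iff.1 hνδ
  have hdist : ∀ x ∈ Icc (t - ν) (t + ν), |x - t| ≤ ν := fun x hx =>
    abs_sub_le_iff.2 ⟨by linarith [hx.2], by linarith [hx.1]⟩
  have hvt := (H.tendsto_v t ht').abs
  rw [hV, abs_zero] at hvt
  have hw₀ : 0 < w₀ ^ D.κ := Real.rpow_pos_of_pos H.w₀_pos _
  filter_upwards [hnear, H.eventually_mem_Icc H.w₀_pos,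
    hvt.eventually_le_const (mul_pos hw₀ hν)] with k hk hw hvk
  have hmem : ∀ x ∈ Icc (t - ν) (t + ν), |v k x| ≤ D.β ∧ x ∈ Ioo 0 D.T := fun x hx =>
    hk x (mem_univ x) ((hdist x hx).trans_lt hνδ)
  obtain ⟨z, hz, hvz⟩ := (H.bounds k).exists_v_eq_zero (H.sol k) (H.admissible k) hw hν.le
    (hmem _ (left_mem_Icc.2 (by linarith))).2.1.le (hmem _ (right_mem_Icc.2 (by linarith))).2.2.le
    (fun x hx => (hmem x hx).1) hvk
  exact ⟨z, (hmem z hz).2, (hdist z hz).trans hνη.le, hvz⟩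

end Convergence

section Zeros

variable [l.NeBot] (H : D.IsLimit l M a v w W w₀ t₂ V U) {n : ℕ} {z : ι → Fin n → ℝ} {Z : Fin n → ℝ}
  (hz : ∀ k, D.IsZeroEnumeration (v k) (z k)) (hZ : ∀ i, Tendsto (fun k => z k i) l (𝓝 (Z i)))
include H hz hZ

omit [l.NeBot] hz hZ in
lemma β_div_pos : 0 < D.β / W ^ D.κ :=
  div_pos D.β_pos (Real.rpow_pos_of_pos (zero_lt_one.trans_le H.one_le_W) _)

omit [l.NeBot] hz hZ in
lemma β_div_le_sub {k : ι} {s t : ℝ} (hs : 0 ≤ s) (hst : s < t) (ht : t ≤ D.T) (hvs : v k s = 0)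
    (hvt : v k t = 0) : D.β / W ^ D.κ ≤ t - s :=
  (H.bounds k).div_le_sub_of_v_eq_zero (H.sol k) (H.admissible k) H.one_le_W H.w₀_pos hs hst ht
    hvs hvt

lemma zero_mem_Ioo (hvT : ∀ k, v k D.T = 0) (i : Fin n) : Z i ∈ Ioo 0 D.T := by
  have hlow : D.β / W ^ D.κ ≤ Z i - 0 := ge_of_tendsto' ((hZ i).sub_const 0) fun k =>
    H.β_div_le_sub le_rfl ((hz k).mem i).1 ((hz k).mem i).2.le (H.sol k).v_zero ((hz k).v_eq_zero i)
  have hhigh : D.β / W ^ D.κ ≤ D.T - Z i := ge_of_tendsto' ((hZ i).const_sub D.T) fun k =>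
    H.β_div_le_sub ((hz k).mem i).1.le ((hz k).mem i).2 le_rfl ((hz k).v_eq_zero i) (hvT k)
  constructor <;> linarith [H.β_div_pos]

lemma zero_injective : Function.Injective Z := by
  intro i j hij
  by_contra hne
  have hgap : D.β / W ^ D.κ ≤ |Z i - Z j| := ge_of_tendsto' ((hZ i).sub (hZ j)).abs fun k => by
    obtain ⟨hi, hvi⟩ := And.intro ((hz k).mem i) ((hz k).v_eq_zero i)
    obtain ⟨hj, hvj⟩ := And.intro ((hz k).mem j) ((hz k).v_eq_zero j)
    rcases lt_or_gt_of_ne ((hz k).injective.ne hne) with h | h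
    · rw [abs_sub_comm]
      exact (H.β_div_le_sub hi.1.le h hj.2.le hvi hvj).trans (le_abs_self _)
    · exact (H.β_div_le_sub hj.1.le h hi.2.le hvj hvi).trans (le_abs_self _)
  rw [hij, sub_self, abs_zero] at hgap
  exact hgap.not_gt H.β_div_pos

lemma V_eq_zero_of_tendsto {i : Fin n} (hi : Z i ∈ Icc 0 D.T) : V (Z i) = 0 := by
  have hmem : Tendsto (fun k => z k i) l (𝓝[Icc 0 D.T] (Z i)) :=
    tendsto_nhdsWithin_iff.2 ⟨hZ i, .of_forall fun k => Ioo_subset_Icc_self ((hz k).mem i)⟩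
  exact tendsto_nhds_unique ((H.tendsto_v_prod hi).comp (hmem.prodMk tendsto_id))
    (tendsto_const_nhds.congr fun k => ((hz k).v_eq_zero i).symm)

lemma exists_eq_of_V_eq_zero (ht : t ∈ Ioo 0 D.T) (hV : V t = 0) : ∃ i, t = Z i := by
  by_contra! hne
  have hdist : ∀ᶠ η in 𝓝[>] (0 : ℝ), ∀ i, η < |Z i - t| := nhdsWithin_le_nhds
    (eventually_all.2 fun i => eventually_lt_nhds (abs_pos.2 (sub_ne_zero.2 (hne i).symm)))
  obtain ⟨η, hηZ, hη⟩ := (hdist.and self_mem_nhdsWithin).exists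
  have hfar : ∀ᶠ k in l, ∀ i, η < |z k i - t| :=
    eventually_all.2 fun i => ((hZ i).sub_const t).abs.eventually_const_lt (hηZ i)
  obtain ⟨k, hk, x, hx, hxt, hvx⟩ :=
    (hfar.and (H.eventually_exists_v_eq_zero hη ht hV)).exists
  obtain ⟨i, rfl⟩ := (hz k).exists_eq x hx hvx
  exact (hk i).not_ge hxt

lemma isZeroEnumeration (hvT : ∀ k, v k D.T = 0) : D.IsZeroEnumeration V Z where
  mem := H.zero_mem_Ioo hz hZ hvT
  v_eq_zero i := H.V_eq_zero_of_tendsto hz hZ (Ioo_subset_Icc_self (H.zero_mem_Ioo hz hZ hvT i))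
  injective := H.zero_injective hz hZ
  exists_eq _ := H.exists_eq_of_V_eq_zero hz hZ

end Zeros

end IsLimit

lemma IsZeroEnumeration.encard_eq {n : ℕ} {z : Fin n → ℝ} (hz : D.IsZeroEnumeration v z) :
    {t | t ∈ Ioo 0 D.T ∧ v t = 0}.encard = n := by
  have hrange : {t | t ∈ Ioo 0 D.T ∧ v t = 0} = range z := by
    ext t
    constructor
    · rintro ⟨ht, hvt⟩
      obtain ⟨i, rfl⟩ := hz.exists_eq t ht hvt
      exact mem_range_self i
    · rintro ⟨i, rfl⟩
      exact ⟨hz.mem i, hz.v_eq_zero i⟩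
  rw [hrange, ← image_univ, hz.injective.encard_image, encard_univ]
  simp

/-- `(V, U)` solves the singular problem on `(0, T]`, `V` vanishes at both ends, and `V` has exactly
`n` zeros in between. The equation for `U` is only required where `V ≠ 0`. -/
structure IsSingularSolution (D : ShootingData) (n : ℕ) (V U : ℝ → ℝ) : Prop where
  continuousOn_V : ContinuousOn V (Icc 0 D.T)
  continuousOn_U : ContinuousOn U (Ioc 0 D.T)
  V_zero : V 0 = 0
  V_T : V D.T = 0
  dV : ∀ t ∈ Ioc 0 D.T, HasDerivWithinAt V (signedPow D.κ (U t)) (Icc 0 D.T) t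
  dU : ∀ t ∈ Ioc 0 D.T, V t ≠ 0 →
    HasDerivWithinAt U (-(D.h t * D.f (V t))) (Icc 0 D.T) t
  U_ne_zero : ∀ t ∈ Ioc 0 D.T, V t = 0 → U t ≠ 0
  encard : {t | t ∈ Ioo 0 D.T ∧ V t = 0}.encard = n

lemma isLimit_limUnder {ι : Type*} {l : Ultrafilter ι} {M a : ι → ℝ} {v w : ι → ℝ → ℝ}
    {W w₀ t₂ : ℝ} (hW : 1 ≤ W) (hw₀ : 0 < w₀) (ht₂ : 0 < t₂)
    (hM : ∀ k, D.Admissible (M k)) (S : ∀ k, D.IsSolution (M k) (a k) (v k) (w k))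
    (B : ∀ k, D.Bounds W w₀ t₂ (v k) (w k)) (hl : Tendsto M l atTop) :
    D.IsLimit (l : Filter ι) M a v w W w₀ t₂ (fun t => limUnder (l : Filter ι) fun k => v k t)
      fun t => limUnder (l : Filter ι) fun k => w k t := by
  have h0 : (0 : ℝ) ∈ Icc 0 D.T := left_mem_Icc.2 D.T_pos.le
  refine ⟨hW, hw₀, ht₂, hM, S, B, hl, fun t ht => ?_, fun t ht => ?_⟩
  · refine tendsto_limUnder_of_forall_mem (isCompact_closedBall 0 (W ^ D.κ * |t - 0|)) l fun k => ?_
    have hv := (B k).abs_v_sub_le (S k) (hM k) hW h0 ht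
    rwa [(S k).v_zero] at hv
  · refine tendsto_limUnder_of_forall_mem (isCompact_closedBall 0 W) l fun k => ?_
    rw [mem_closedBall_zero_iff]
    exact (B k).abs_w_le t ht

lemma exists_isSingularSolution (D : ShootingData) :
    ∃ n₀ : ℕ, ∀ n ≥ n₀, ∃ V U, D.IsSingularSolution n V U := by
  obtain ⟨n₀, hn₀⟩ := D.exists_isZeroEnumeration_regularized
  refine ⟨n₀, fun n hn => ?_⟩
  obtain ⟨a₁, ha₁, hev⟩ := hn₀ n hn
  obtain ⟨W, w₀, t₂, hW, hw₀, ht₂, hbounds⟩ := D.exists_uniform_bounds ha₁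
  obtain ⟨M₀, hM₀⟩ := eventually_atTop.1 ((hev.and D.eventually_admissible).and
    (tendsto_inv_atTop_zero.eventually_le_const ht₂))
  have hlarge : ∀ k : ℕ, M₀ ≤ M₀ + k := fun k => le_add_of_nonneg_right k.cast_nonneg
  have hM : ∀ k : ℕ, D.Admissible (M₀ + k) := fun k => (hM₀ _ (hlarge k)).1.2
  choose a ha v w S hvT z hz using fun k : ℕ => (hM₀ _ (hlarge k)).1.1
  have hlim : Tendsto (fun k : ℕ => M₀ + k) (hyperfilter ℕ) atTop :=
    (tendsto_atTop_add_const_left _ M₀ tendsto_natCast_atTop_atTop).mono_left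
      Nat.hyperfilter_le_atTop
  have H := isLimit_limUnder hW hw₀ ht₂ hM S
    (fun k => hbounds _ (hM k) (hM₀ _ (hlarge k)).2 _ (ha k) _ _ (S k)) hlim
  have hZ := fun i => tendsto_limUnder_of_forall_mem isCompact_Icc (hyperfilter ℕ)
    fun k => Ioo_subset_Icc_self ((hz k).mem i)
  exact ⟨_, _, H.continuousOn_V, H.continuousOn_U, H.V_zero,
    tendsto_nhds_unique (H.tendsto_v _ (right_mem_Icc.2 D.T_pos.le))
      (tendsto_const_nhds.congr fun k => (hvT k).symm),
    fun _ ht => H.hasDerivWithinAt_V ht, fun _ ht => H.hasDerivWithinAt_U ht,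
    fun _ ht => H.U_ne_zero (Ioc_subset_Icc_self ht), (H.isZeroEnumeration hz hZ hvT).encard_eq⟩

end ShootingData

/-! ### The radial problem -/

lemma SingularAtZero.isBigO {f : ℝ → ℝ} {m : ℝ} (hf : SingularAtZero f m)
    (hm : 0 ≤ m) : f =O[𝓝[>] 0] fun u => u ^ (-m) := by
  obtain ⟨g, hg, -, δ, hδ, hfg⟩ := hf
  have hone : (fun _ => 1 : ℝ → ℝ) =O[𝓝[>] 0] fun u : ℝ => u ^ (-m) := by
    refine Asymptotics.IsBigO.of_bound' ?_
    filter_upwards [Ioo_mem_nhdsGT one_pos] with u hu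
    rw [norm_one, Real.norm_of_nonneg (Real.rpow_nonneg hu.1.le _)]
    exact Real.one_le_rpow_of_pos_of_le_one_of_nonpos hu.1 hu.2.le (neg_nonpos.2 hm)
  have hgO : g =O[𝓝[>] 0] fun u => u ^ (-m) :=
    ((hg.continuous.tendsto 0).mono_left nhdsWithin_le_nhds |>.isBigO_one ℝ).trans hone
  refine ((Asymptotics.isBigO_refl (fun u : ℝ => u ^ (-m)) _).neg_left.add hgO).congr' ?_
    EventuallyEq.rfl
  filter_upwards [Ioo_mem_nhdsGT hδ] with u hu
  rw [hfg u hu.1.ne' (by rw [abs_of_pos hu.1]; exact hu.2), abs_of_pos hu.1,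
    Real.rpow_sub_one hu.1.ne', div_mul_cancel₀ _ hu.1.ne', one_div, Real.rpow_neg hu.1.le]

lemma PowerAtInfinity.tendsto_div_rpow {f : ℝ → ℝ} {l s : ℝ} (hf : PowerAtInfinity f l)
    (hs : s < l) : Tendsto (fun u => f u / u ^ s) atTop atTop := by
  obtain ⟨g, -, ⟨M, hM⟩, hg⟩ := hf
  have hhalf : Tendsto (fun u : ℝ => u ^ (l - s) * (1 / 2)) atTop atTop :=
    (tendsto_rpow_atTop (sub_pos.2 hs)).atTop_mul_const (by norm_num)
  refine tendsto_atTop_mono' _ ?_ hhalf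
  filter_upwards [eventually_gt_atTop M, eventually_gt_atTop 0,
    hg.eventually_le_const (by norm_num : (0 : ℝ) < 1 / 2)] with u hMu hu hgu
  rw [abs_of_pos hu, div_le_iff₀ (Real.rpow_pos_of_pos hu _)] at hgu
  rw [hM u (hMu.trans_le (le_abs_self u)), abs_of_pos hu, Real.rpow_sub_one hu.ne',
    div_mul_cancel₀ _ hu.ne', le_div_iff₀ (Real.rpow_pos_of_pos hu _), mul_right_comm,
    ← Real.rpow_add hu, sub_add_cancel]
  linarith [neg_abs_le (g u)]

lemma UniquePositiveZero.exists_sign_change {f : ℝ → ℝ} (hf : UniquePositiveZero f) :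
    ∃ β > 0, (∀ u ∈ Ioc 0 β, f u ≤ 0) ∧ ∀ u ∈ Ici β, 0 ≤ f u := by
  obtain ⟨β, hβ, hfβ, hneg, hpos⟩ := hf
  refine ⟨β, hβ, fun u hu => ?_, fun u hu => ?_⟩
  · rcases hu.2.eq_or_lt with rfl | h
    exacts [hfβ.le, (hneg u ⟨hu.1, h⟩).le]
  · rcases (mem_Ici.1 hu).eq_or_lt with rfl | h
    exacts [hfβ.ge, (hpos u h).le]

lemma OddLocLipschitz.exists_forall_abs_le {f : ℝ → ℝ} {m : ℝ} (hf : OddLocLipschitz f)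
    (hfO : f =O[𝓝[>] 0] fun u => u ^ (-m)) (Y : ℝ) :
    ∃ C > 0, ∀ y, y ≠ 0 → |y| ≤ Y → |f y| ≤ C * |y| ^ (-m) := by
  obtain ⟨c, hc⟩ := hfO.bound
  obtain ⟨δ, hδ, hsmall⟩ := (mem_nhdsGT_iff_exists_Ioo_subset).1 hc
  have hcont : ContinuousOn (fun y => f y / y ^ (-m)) (Icc δ Y) := by
    have hne : ∀ y ∈ Icc δ Y, y ≠ 0 := fun y hy => (hδ.trans_le hy.1).ne'
    exact (hf.2.continuousOn.mono hne).div
      (continuousOn_id.rpow_const fun y hy => Or.inl (hne y hy))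
      fun y hy => (Real.rpow_pos_of_pos (hδ.trans_le hy.1) _).ne'
  obtain ⟨B, hB⟩ := isCompact_Icc.exists_bound_of_continuousOn hcont
  have hpos : ∀ y, 0 < y → y ≤ Y → |f y| ≤ max 1 (max c B) * y ^ (-m) := by
    intro y hy hyY
    have hym := Real.rpow_pos_of_pos hy (-m)
    rcases lt_or_ge y δ with h | h
    · have hcy : |f y| ≤ c * y ^ (-m) := by
        simpa only [mem_ofPred_eq, Real.norm_eq_abs, abs_of_pos hym] using hsmall ⟨hy, h⟩
      exact hcy.trans (by gcongr; simp)
    · have hBy := hB y ⟨h, hyY⟩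
      rw [Real.norm_eq_abs, abs_div, abs_of_pos hym, div_le_iff₀ hym] at hBy
      exact hBy.trans (by gcongr; simp)
  refine ⟨max 1 (max c B), by positivity, fun y hy hyY => ?_⟩
  rcases hy.lt_or_gt with h | h
  · have := hpos (-y) (neg_pos.2 h) (by rwa [← abs_of_neg h])
    rwa [hf.1 y hy, abs_neg, ← abs_of_neg h] at this
  · rw [abs_of_pos h] at hyY ⊢
    exact hpos y h hyY

/-- The exponent of the fundamental solution `r ^ radialExponent N p` of the `p`-Laplacian on
`ℝ ^ N`, which is the new variable of the reduction to a `ShootingData`. -/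
noncomputable def radialExponent (N p : ℝ) : ℝ := (p - N) / (p - 1)

/-- The weight of the shooting problem, expressed in the radial variable `r`. -/
noncomputable def radialWeight (N p : ℝ) (K : ℝ → ℝ) (r : ℝ) : ℝ :=
  (-radialExponent N p) ^ (-p) * (r ^ ((N - 1) * p / (p - 1)) * K r)

/-- `D` is the shooting problem to which the substitution `t = r ^ radialExponent N p` reduces the
radial problem with nonlinearity `f` and weight `K` on `[R, ∞)`. -/
structure IsRadialReduction (D : ShootingData) (N p R : ℝ) (f K : ℝ → ℝ) : Prop where
  one_lt_p : 1 < p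
  p_lt_N : p < N
  R_pos : 0 < R
  κ_eq : D.κ = 1 / (p - 1)
  T_eq : D.T = R ^ radialExponent N p
  f_eq : D.f = f
  h_eq : ∀ r ∈ Ici R, D.h (r ^ radialExponent N p) = radialWeight N p K r

section Reduction

variable {N p R m α₁ K₁ : ℝ} {K : ℝ → ℝ}

lemma radialExponent_neg (hp : 1 < p) (hpN : p < N) : radialExponent N p < 0 :=
  div_neg_of_neg_of_pos (sub_neg.2 hpN) (sub_pos.2 hp)

lemma continuousOn_radialWeight (hR : 0 < R) (hK : ContinuousOn K (Ici R)) :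
    ContinuousOn (radialWeight N p K) (Ici R) :=
  continuousOn_const.mul
    ((continuousOn_id.rpow_const fun _ hr => Or.inl (hR.trans_le hr).ne').mul hK)

lemma radialWeight_pos (hp : 1 < p) (hpN : p < N) {r : ℝ} (hr : 0 < r) (hK : 0 < K r) :
    0 < radialWeight N p K r := by
  have he := neg_pos.2 (radialExponent_neg hp hpN)
  unfold radialWeight
  positivity

lemma hasDerivAt_radialWeight {K' r : ℝ} (hr : 0 < r) (hK : HasDerivAt K K' r) :
    HasDerivAt (radialWeight N p K) ((-radialExponent N p) ^ (-p) *
      (r ^ ((N - 1) * p / (p - 1) - 1) * ((N - 1) * p / (p - 1) * K r + r * K'))) r := by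
  refine (((Real.hasDerivAt_rpow_const (Or.inl hr.ne')).mul hK).const_mul _).congr_deriv ?_
  have hpow : r ^ ((N - 1) * p / (p - 1)) = r ^ ((N - 1) * p / (p - 1) - 1) * r := by
    rw [Real.rpow_sub_one hr.ne', div_mul_cancel₀ _ hr.ne']
  rw [hpow]
  ring

lemma deriv_radialWeight_nonneg (hp : 1 < p) (hpN : p < N) {K' r : ℝ} (hr : 0 < r)
    (hK : HasDerivAt K K' r) (hKpos : 0 < K r)
    (hK' : -((N - 1) * p / (p - 1)) ≤ r * K' / K r) : 0 ≤ deriv (radialWeight N p K) r := by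
  rw [(hasDerivAt_radialWeight hr hK).deriv]
  rw [le_div_iff₀ hKpos] at hK'
  have he := neg_pos.2 (radialExponent_neg hp hpN)
  have hbracket : 0 ≤ (N - 1) * p / (p - 1) * K r + r * K' := by linarith
  positivity

/-- The quotient is the exponent `q` in the bound `O(t ^ (-q))` of the weight at `t = 0`. -/
lemma sub_div_radialExponent_add_lt_one (hp : 1 < p) (hpN : p < N)
    (hα₁ : N + m * (N - p) / (p - 1) < α₁) :
    (α₁ - (N - 1) * p / (p - 1)) / radialExponent N p + m < 1 := by
  have hp₁ : p - 1 ≠ 0 := (sub_pos.2 hp).ne'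
  have hweight : (N - 1) * p / (p - 1) = N - radialExponent N p := by
    unfold radialExponent
    field_simp
    ring
  have hexp : m * (N - p) / (p - 1) = -m * radialExponent N p := by
    unfold radialExponent
    ring
  rw [← lt_sub_iff_add_lt, div_lt_iff_of_neg (radialExponent_neg hp hpN), hweight]
  rw [hexp] at hα₁
  linarith

lemma rpow_neg_le_mul_rpow_neg {t T q q₁ : ℝ} (ht : 0 < t) (htT : t ≤ T) (hq : q₁ ≤ q) :
    t ^ (-q₁) ≤ T ^ (q - q₁) * t ^ (-q) := by
  calc t ^ (-q₁) = t ^ (q - q₁) * t ^ (-q) := by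
        rw [← Real.rpow_add ht, sub_add_eq_add_sub, add_neg_cancel, zero_sub]
    _ ≤ T ^ (q - q₁) * t ^ (-q) := by gcongr

lemma radialWeight_rpow_inv_le {t T q : ℝ} (hp : 1 < p) (hpN : p < N) (hK₁ : 0 ≤ K₁)
    (ht : t ∈ Ioc 0 T)
    (hK : K (t ^ (radialExponent N p)⁻¹) ≤ K₁ / (t ^ (radialExponent N p)⁻¹) ^ α₁)
    (hq : (α₁ - (N - 1) * p / (p - 1)) / radialExponent N p ≤ q) :
    radialWeight N p K (t ^ (radialExponent N p)⁻¹) ≤ (-radialExponent N p) ^ (-p) * K₁ *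
      T ^ (q - (α₁ - (N - 1) * p / (p - 1)) / radialExponent N p) * t ^ (-q) := by
  have he := neg_pos.2 (radialExponent_neg hp hpN)
  set s := (N - 1) * p / (p - 1) with hs
  set e := radialExponent N p with he_def
  have hr : 0 < t ^ e⁻¹ := Real.rpow_pos_of_pos ht.1 _
  have hpow : t ^ (-((α₁ - s) / e)) = (t ^ e⁻¹) ^ s / (t ^ e⁻¹) ^ α₁ := by
    rw [← Real.rpow_sub hr, ← Real.rpow_mul ht.1.le]
    ring_nf
  calc radialWeight N p K (t ^ e⁻¹)
      ≤ (-e) ^ (-p) * ((t ^ e⁻¹) ^ s * (K₁ / (t ^ e⁻¹) ^ α₁)) := by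
        unfold radialWeight
        rw [← he_def, ← hs]
        gcongr
    _ = (-e) ^ (-p) * K₁ * t ^ (-((α₁ - s) / e)) := by rw [hpow]; ring
    _ ≤ (-e) ^ (-p) * K₁ * (T ^ (q - (α₁ - s) / e) * t ^ (-q)) := by
        gcongr
        exact rpow_neg_le_mul_rpow_neg ht.1 ht.2 hq
    _ = _ := by ring

lemma le_rpow_inv_radialExponent {t : ℝ} (hp : 1 < p) (hpN : p < N) (hR : 0 < R)
    (ht : t ∈ Ioc 0 (R ^ radialExponent N p)) : R ≤ t ^ (radialExponent N p)⁻¹ :=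
  (Real.le_rpow_inv_iff_of_neg hR ht.1 (radialExponent_neg hp hpN)).2 ht.2

lemma lt_rpow_inv_radialExponent {t : ℝ} (hp : 1 < p) (hpN : p < N) (hR : 0 < R)
    (ht : t ∈ Ioo 0 (R ^ radialExponent N p)) : R < t ^ (radialExponent N p)⁻¹ :=
  (Real.lt_rpow_inv_iff_of_neg hR ht.1 (radialExponent_neg hp hpN)).2 ht.2

lemma differentiableAt_radialWeight_rpow_inv {t : ℝ} (ht : 0 < t)
    (hK : DifferentiableAt ℝ K (t ^ (radialExponent N p)⁻¹)) :
    DifferentiableAt ℝ (fun t => radialWeight N p K (t ^ (radialExponent N p)⁻¹)) t :=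
  DifferentiableAt.comp (g := radialWeight N p K) t
    (hasDerivAt_radialWeight (Real.rpow_pos_of_pos ht _) hK.hasDerivAt).differentiableAt
    (Real.differentiableAt_rpow_const_of_ne _ ht.ne')

lemma deriv_radialWeight_rpow_inv_nonpos {K' t : ℝ} (hp : 1 < p) (hpN : p < N) (ht : 0 < t)
    (hK : HasDerivAt K K' (t ^ (radialExponent N p)⁻¹))
    (hKpos : 0 < K (t ^ (radialExponent N p)⁻¹))
    (hK' : -((N - 1) * p / (p - 1)) ≤
      t ^ (radialExponent N p)⁻¹ * K' / K (t ^ (radialExponent N p)⁻¹)) :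
    deriv (fun t => radialWeight N p K (t ^ (radialExponent N p)⁻¹)) t ≤ 0 := by
  have hr : 0 < t ^ (radialExponent N p)⁻¹ := Real.rpow_pos_of_pos ht _
  have hcomp := HasDerivAt.comp (h₂ := radialWeight N p K) t
    (hasDerivAt_radialWeight hr hK).differentiableAt.hasDerivAt
    (Real.hasDerivAt_rpow_const (Or.inl ht.ne'))
  refine hcomp.deriv.trans_le (mul_nonpos_of_nonneg_of_nonpos
    (deriv_radialWeight_nonneg hp hpN hr hK hKpos hK') ?_)
  exact mul_nonpos_of_nonpos_of_nonneg (inv_nonpos.2 (radialExponent_neg hp hpN).le)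
    (Real.rpow_nonneg ht.le _)

end Reduction

lemma exists_isRadialReduction {N p R m α₁ β K₁ : ℝ} {f K : ℝ → ℝ} (hp : 1 < p) (hpN : p < N)
    (hR : 0 < R) (hm : 0 < m) (hm₁ : m < 1) (hα₁ : N + m * (N - p) / (p - 1) < α₁)
    (hf : OddLocLipschitz f) (hfO : f =O[𝓝[>] 0] fun u => u ^ (-m))
    (hf_top : Tendsto (fun u => f u / u ^ (p - 1)) atTop atTop) (hβ : 0 < β)
    (hf_nonpos : ∀ u ∈ Ioc 0 β, f u ≤ 0) (hf_nonneg : ∀ u ∈ Ici β, 0 ≤ f u)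
    (hK : DifferentiableOn ℝ K (Ici R)) (hKpos : ∀ r ∈ Ici R, 0 < K r)
    (hK' : ∀ r ∈ Ici R, -((N - 1) * p / (p - 1)) ≤ r * derivWithin K (Ici R) r / K r)
    (hK₁ : ∀ r ∈ Ici R, K r ≤ K₁ / r ^ α₁) : ∃ D, IsRadialReduction D N p R f K := by
  obtain ⟨C, hC, hCf⟩ := hf.exists_forall_abs_le hfO β
  have he := radialExponent_neg hp hpN
  have hq := sub_div_radialExponent_add_lt_one hp hpN hα₁
  set e := radialExponent N p with he_def
  set q₁ := (α₁ - (N - 1) * p / (p - 1)) / e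
  have he' := neg_pos.2 he
  have hT : 0 < R ^ e := Real.rpow_pos_of_pos hR _
  have hK₁pos : 0 < K₁ :=
    (div_pos_iff_of_pos_right (Real.rpow_pos_of_pos hR _)).1
      ((hKpos R self_mem_Ici).trans_le (hK₁ R self_mem_Ici))
  have hle : ∀ t ∈ Ioc 0 (R ^ e), R ≤ t ^ e⁻¹ := fun t ht =>
    le_rpow_inv_radialExponent hp hpN hR ht
  have hlt : ∀ t ∈ Ioo 0 (R ^ e), R < t ^ e⁻¹ := fun t ht =>
    lt_rpow_inv_radialExponent hp hpN hR ht
  have hKd : ∀ r ∈ Ioi R, HasDerivAt K (derivWithin K (Ici R) r) r := fun r hr =>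
    (hK r (mem_Ioi.1 hr).le).hasDerivWithinAt.hasDerivAt (Ici_mem_nhds hr)
  let D : ShootingData := {
    κ := 1 / (p - 1), m := m, q := max 0 q₁, T := R ^ e, β := β
    A := (-e) ^ (-p) * K₁ * (R ^ e) ^ (max 0 q₁ - q₁), C := C, f := f
    h := fun t => radialWeight N p K (t ^ e⁻¹)
    h' := deriv fun t => radialWeight N p K (t ^ e⁻¹)
    κ_pos := one_div_pos.2 (sub_pos.2 hp)
    m_pos := hm
    q_nonneg := le_max_left _ _
    q_add_m_lt_one := by
      rw [max_add, max_lt_iff, zero_add]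
      exact ⟨hm₁, hq⟩
    T_pos := hT
    β_pos := hβ
    A_pos := by positivity
    C_pos := hC
    f_odd := hf.1
    f_lip := hf.2.mono fun _ hx => ne_of_gt hx
    f_nonpos := fun u hu huβ => hf_nonpos u ⟨hu, huβ⟩
    f_nonneg := hf_nonneg
    f_bound := fun u hu huβ => by
      simpa only [abs_of_pos hu] using hCf u hu.ne' (by rwa [abs_of_pos hu])
    f_super := by rwa [one_div_one_div]
    h_pos := fun t ht => radialWeight_pos hp hpN (hR.trans_le (hle t ht)) (hKpos _ (hle t ht))
    h_cont := (continuousOn_radialWeight hR hK.continuousOn).comp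
      (continuousOn_id.rpow_const fun t ht => Or.inl ht.1.ne') hle
    h_deriv := fun t ht =>
      (differentiableAt_radialWeight_rpow_inv ht.1 (hKd _ (hlt t ht)).differentiableAt).hasDerivAt
    h'_nonpos := fun t ht => deriv_radialWeight_rpow_inv_nonpos hp hpN ht.1 (hKd _ (hlt t ht))
      (hKpos _ (hlt t ht).le) (hK' _ (hlt t ht).le)
    h_bound := fun t ht => radialWeight_rpow_inv_le hp hpN hK₁pos.le ht (hK₁ _ (hle t ht))
      (le_max_right _ _) }
  exact ⟨D, hp, hpN, hR, rfl, rfl, rfl, fun r hr => by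
    simp only [D, ← he_def, Real.rpow_rpow_inv (hR.trans_le hr).le he.ne]⟩

lemma pPhi_neg (p x : ℝ) : pPhi p (-x) = -pPhi p x := by
  rw [pPhi, pPhi, abs_neg, mul_neg]

lemma pPhi_mul_of_pos {b : ℝ} (p x : ℝ) (hb : 0 < b) :
    pPhi p (x * b) = pPhi p x * b ^ (p - 1) := by
  have hpow : b ^ (p - 1) = b ^ (p - 2) * b := by
    rw [← Real.rpow_add_one hb.ne']
    ring_nf
  rw [pPhi, pPhi, abs_mul, abs_of_pos hb, Real.mul_rpow (abs_nonneg _) hb.le, hpow]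
  ring

lemma pPhi_signedPow {p : ℝ} (hp : 1 < p) (x : ℝ) : pPhi p (signedPow (1 / (p - 1)) x) = x := by
  wlog hx : 0 ≤ x generalizing x
  · rw [← neg_inj, ← pPhi_neg, ← signedPow_neg]
    exact this (-x) (by linarith)
  have hp₁ : 0 < p - 1 := sub_pos.2 hp
  rw [signedPow_of_nonneg (one_div_pos.2 hp₁) hx]
  rcases hx.eq_or_lt with rfl | hx
  · rw [Real.zero_rpow (one_div_pos.2 hp₁).ne', pPhi, mul_zero]
  · have hpow : 0 < x ^ (1 / (p - 1)) := Real.rpow_pos_of_pos hx _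
    have hexp : 1 / (p - 1) * (p - 2 + 1) = 1 := by
      field_simp
      ring
    rw [pPhi, abs_of_pos hpow, ← Real.rpow_add_one hpow.ne', ← Real.rpow_mul hx.le, hexp,
      Real.rpow_one]

section Integrability

open Asymptotics

variable {u : ℝ → ℝ} {m d x : ℝ} {S : Set ℝ}

lemma integrableAtFilter_abs_sub_rpow (hm : m < 1) (x : ℝ) :
    IntegrableAtFilter (fun r : ℝ => |r - x| ^ (-m)) (𝓝 x) := by
  have hzero : LocallyIntegrable fun r : ℝ => |r| ^ (-m) := by
    refine locallyIntegrable_of_norm_le_rpow (C := 1) (α := m) (by simp) (by simpa using hm)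
      (Eventually.of_forall fun r => ?_)
      (continuous_abs.measurable.pow_const _).aestronglyMeasurable
    rw [one_mul, Real.norm_of_nonneg (Real.rpow_nonneg (abs_nonneg _) _), Real.norm_eq_abs]
  have hmap := (locallyIntegrable_map_homeomorph (μ := volume) (Homeomorph.subRight x)
    (f := fun r : ℝ => |r| ^ (-m))).1
  rw [Homeomorph.coe_subRight, (measurePreserving_sub_right volume x).map_eq] at hmap
  exact hmap hzero x

lemma isTheta_sub_of_eq_zero (hu : HasDerivWithinAt u d S x) (hx : u x = 0) (hd : d ≠ 0) :
    u =Θ[𝓝[S] x] fun r => r - x := by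
  have hsub := hu.isTheta_sub hd
  rw [prod_pure] at hsub
  exact ⟨by simpa [hx, Function.comp_def] using hsub.1.comp_tendsto tendsto_map,
    by simpa [hx, Function.comp_def] using hsub.2.comp_tendsto tendsto_map⟩

/-- At a simple zero `x` of `u` the singularity of `|u| ^ (-m)` is that of `|r - x| ^ (-m)`. -/
lemma isBigO_one_div_abs_rpow_of_eq_zero (hm : 0 ≤ m) (hu : HasDerivWithinAt u d S x)
    (hx : u x = 0) (hd : d ≠ 0) :
    (fun r => 1 / |u r| ^ m) =O[𝓝[S] x] fun r => |r - x| ^ (-m) := by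
  refine ((isTheta_sub_of_eq_zero hu hx hd).inv.isBigO.abs_abs.rpow hm
    (Eventually.of_forall fun _ => abs_nonneg _)).congr (fun r => ?_) fun r => ?_
  · rw [abs_inv, Real.inv_rpow (abs_nonneg _), one_div]
  · rw [abs_inv, Real.inv_rpow (abs_nonneg _), Real.rpow_neg (abs_nonneg _)]

lemma locallyIntegrableOn_one_div_abs_rpow {u' : ℝ → ℝ} (hm : 0 ≤ m) (hm₁ : m < 1)
    (hS : MeasurableSet S) (hu : ∀ r ∈ S, HasDerivWithinAt u (u' r) S r)
    (hu' : ∀ r ∈ S, u r = 0 → u' r ≠ 0) : LocallyIntegrableOn (fun r => 1 / |u r| ^ m) S := by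
  have hcont : ContinuousOn u S := fun r hr => (hu r hr).continuousWithinAt
  intro x hx
  have hmeas : StronglyMeasurableAtFilter (fun r => 1 / |u r| ^ m) (𝓝[S] x) volume :=
    ⟨S, self_mem_nhdsWithin, (((continuous_abs.measurable.pow_const m).const_div
      1).comp_aemeasurable (hcont.aemeasurable hS)).aestronglyMeasurable⟩
  have := hS.nhdsWithin_isMeasurablyGenerated x
  by_cases h0 : u x = 0
  · exact (isBigO_one_div_abs_rpow_of_eq_zero hm (hu x hx) h0 (hu' x hx h0)).integrableAtFilter
      hmeas ((integrableAtFilter_abs_sub_rpow hm₁ x).filter_mono nhdsWithin_le_nhds)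
  · have hne : |u x| ^ m ≠ 0 := (Real.rpow_pos_of_pos (abs_pos.2 h0) m).ne'
    exact Tendsto.integrableAtFilter hmeas (volume.finiteAt_nhdsWithin x S)
      (tendsto_const_nhds.div ((hcont x hx).abs.rpow_const (Or.inr hm)) hne)

end Integrability

lemma integrableOn_mul_comp_of_abs_le {a b m C Y : ℝ} {ρ f u : ℝ → ℝ} (hf : Measurable f)
    (hC : ∀ y, y ≠ 0 → |y| ≤ Y → |f y| ≤ C * |y| ^ (-m)) (hρ : ContinuousOn ρ (Icc a b))
    (hu : ContinuousOn u (Icc a b)) (huY : ∀ r ∈ Icc a b, |u r| ≤ Y)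
    (hae : ∀ᵐ r ∂volume.restrict (Icc a b), u r ≠ 0)
    (hint : IntegrableOn (fun r => 1 / |u r| ^ m) (Icc a b)) :
    IntegrableOn (fun r => ρ r * f (u r)) (Icc a b) := by
  refine IntegrableOn.continuousOn_mul hρ (Integrable.mono' (hint.const_mul C)
    (hf.comp_aemeasurable (hu.aemeasurable measurableSet_Icc)).aestronglyMeasurable ?_)
    isCompact_Icc
  filter_upwards [ae_restrict_mem measurableSet_Icc, hae] with r hr hur
  rw [one_div, ← Real.rpow_neg (abs_nonneg _)]
  exact hC _ hur (huY r hr)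

lemma OddLocLipschitz.intervalIntegrable_mul_comp {m R r : ℝ} {f ρ u : ℝ → ℝ}
    (hf : OddLocLipschitz f) (hfO : f =O[𝓝[>] 0] fun u => u ^ (-m)) (hr : R ≤ r)
    (hρ : ContinuousOn ρ (Ici R)) (hu : ContinuousOn u (Ici R))
    (hae : ∀ᵐ r ∂volume.restrict (Ici R), u r ≠ 0)
    (hloc : LocallyIntegrableOn (fun r => 1 / |u r| ^ m) (Ici R)) :
    IntervalIntegrable (fun t => ρ t * f (u t)) volume R r := by
  have hsub : Icc R r ⊆ Ici R := Icc_subset_Ici_self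
  obtain ⟨Y, hY⟩ := isCompact_Icc.exists_bound_of_continuousOn (hu.mono hsub)
  obtain ⟨C, -, hC⟩ := hf.exists_forall_abs_le hfO Y
  rw [intervalIntegrable_iff_integrableOn_Icc_of_le hr]
  exact integrableOn_mul_comp_of_abs_le
    (measurable_of_continuousOn_compl_singleton 0 hf.2.continuousOn) hC (hρ.mono hsub)
    (hu.mono hsub) hY (ae_restrict_of_ae_restrict_of_subset hsub hae)
    (hloc.integrableOn_compact_subset hsub isCompact_Icc)

/-- The function of the radial variable corresponding to a solution `V` of the shooting problem. -/
noncomputable def radialProfile (N p : ℝ) (V : ℝ → ℝ) (r : ℝ) : ℝ := V (r ^ radialExponent N p)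

/-- The derivative of `radialProfile N p V` when `V' = signedPow (1 / (p - 1)) U`. -/
noncomputable def radialSlope (N p : ℝ) (U : ℝ → ℝ) (r : ℝ) : ℝ :=
  signedPow (1 / (p - 1)) (U (r ^ radialExponent N p)) *
    (radialExponent N p * r ^ (radialExponent N p - 1))

lemma rpow_mul_pPhi_radialSlope {N p r : ℝ} (hp : 1 < p) (hpN : p < N) (hr : 0 < r)
    (U : ℝ → ℝ) : r ^ (N - 1) * pPhi p (radialSlope N p U r) =
      -((-radialExponent N p) ^ (p - 1) * U (r ^ radialExponent N p)) := by
  have he := neg_pos.2 (radialExponent_neg hp hpN)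
  have hexp : (radialExponent N p - 1) * (p - 1) = -(N - 1) := by
    have hp₁ : p - 1 ≠ 0 := (sub_pos.2 hp).ne'
    unfold radialExponent
    field_simp
    ring
  unfold radialSlope
  set e := radialExponent N p
  have hpow : 0 < r ^ (e - 1) := Real.rpow_pos_of_pos hr _
  have hcancel : r ^ (N - 1) * r ^ (-(N - 1)) = 1 := by
    rw [← Real.rpow_add hr, add_neg_cancel, Real.rpow_zero]
  calc r ^ (N - 1) * pPhi p (signedPow (1 / (p - 1)) (U (r ^ e)) * (e * r ^ (e - 1)))
      = -(r ^ (N - 1) * pPhi p (signedPow (1 / (p - 1)) (U (r ^ e)) * (-e * r ^ (e - 1)))) := by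
        rw [neg_mul, mul_neg, pPhi_neg, mul_neg, neg_neg]
    _ = -(r ^ (N - 1) * (U (r ^ e) * ((-e) ^ (p - 1) * r ^ (-(N - 1))))) := by
        rw [pPhi_mul_of_pos _ _ (mul_pos he hpow), pPhi_signedPow hp,
          Real.mul_rpow he.le hpow.le, ← Real.rpow_mul hr.le, hexp]
    _ = -((-e) ^ (p - 1) * U (r ^ e)) := by
        linear_combination (-(U (r ^ e) * (-e) ^ (p - 1))) * hcancel

/-- The powers of `r` and of the exponent in `radialWeight` are those making this hold. -/
lemma radialWeight_mul_eq {N p r : ℝ} (hp : 1 < p) (hpN : p < N) (hr : 0 < r) (K : ℝ → ℝ) :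
    (-radialExponent N p) ^ (p - 1) * (radialWeight N p K r *
      (-radialExponent N p * r ^ (radialExponent N p - 1))) = r ^ (N - 1) * K r := by
  have he := neg_pos.2 (radialExponent_neg hp hpN)
  have hconst : (-radialExponent N p) ^ (p - 1) * (-radialExponent N p) ^ (-p) *
      (-radialExponent N p) = 1 := by
    rw [← Real.rpow_add he, ← Real.rpow_add_one he.ne']
    ring_nf
    exact Real.rpow_zero _
  have hpow : r ^ ((N - 1) * p / (p - 1)) * r ^ (radialExponent N p - 1) = r ^ (N - 1) := by
    have hp₁ : p - 1 ≠ 0 := (sub_pos.2 hp).ne'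
    rw [← Real.rpow_add hr, radialExponent]
    congr 1
    field_simp
    ring
  rw [← hpow, radialWeight]
  linear_combination (r ^ ((N - 1) * p / (p - 1)) * r ^ (radialExponent N p - 1) * K r) * hconst

namespace IsRadialReduction

variable {D : ShootingData} {N p R r : ℝ} {f K V U : ℝ → ℝ} {n : ℕ}
  (H : IsRadialReduction D N p R f K)
include H

lemma exponent_neg : radialExponent N p < 0 := radialExponent_neg H.one_lt_p H.p_lt_N

lemma rpow_mem_Ioc (hr : r ∈ Ici R) : r ^ radialExponent N p ∈ Ioc 0 D.T := by
  rw [H.T_eq]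
  exact ⟨Real.rpow_pos_of_pos (H.R_pos.trans_le hr) _,
    Real.rpow_le_rpow_of_nonpos H.R_pos hr H.exponent_neg.le⟩

lemma rpow_lt_T (hr : R < r) : r ^ radialExponent N p < D.T := by
  rw [H.T_eq]
  exact Real.rpow_lt_rpow_of_neg H.R_pos hr H.exponent_neg

lemma hasDerivAt_rpow (hr : r ∈ Ici R) : HasDerivAt (fun r : ℝ => r ^ radialExponent N p)
    (radialExponent N p * r ^ (radialExponent N p - 1)) r :=
  Real.hasDerivAt_rpow_const (Or.inl (H.R_pos.trans_le hr).ne')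

lemma continuousOn_rpow (a : ℝ) : ContinuousOn (fun r : ℝ => r ^ a) (Ici R) :=
  continuousOn_id.rpow_const fun _ hr => Or.inl (H.R_pos.trans_le hr).ne'

variable (S : D.IsSingularSolution n V U)
include S

lemma hasDerivWithinAt_radialProfile (hr : r ∈ Ici R) :
    HasDerivWithinAt (radialProfile N p V) (radialSlope N p U r) (Ici R) r := by
  rw [radialSlope, ← H.κ_eq]
  exact (S.dV _ (H.rpow_mem_Ioc hr)).comp r (H.hasDerivAt_rpow hr).hasDerivWithinAt
    fun _ hx => Ioc_subset_Icc_self (H.rpow_mem_Ioc hx)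

lemma derivWithin_radialProfile (hr : r ∈ Ici R) :
    derivWithin (radialProfile N p V) (Ici R) r = radialSlope N p U r :=
  (H.hasDerivWithinAt_radialProfile S hr).derivWithin (uniqueDiffOn_Ici R r hr)

lemma continuousOn_radialProfile : ContinuousOn (radialProfile N p V) (Ici R) :=
  fun _ hr => (H.hasDerivWithinAt_radialProfile S hr).continuousWithinAt

lemma continuousOn_U_comp_rpow : ContinuousOn (fun r => U (r ^ radialExponent N p)) (Ici R) :=
  S.continuousOn_U.comp (H.continuousOn_rpow _) fun _ hr => H.rpow_mem_Ioc hr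

lemma contDiffOn_radialProfile : ContDiffOn ℝ 1 (radialProfile N p V) (Ici R) := by
  rw [contDiffOn_one_iff_derivWithin (uniqueDiffOn_Ici R)]
  have hslope : ContinuousOn (radialSlope N p U) (Ici R) :=
    ((continuous_signedPow (one_div_pos.2 (sub_pos.2 H.one_lt_p))).comp_continuousOn
      (H.continuousOn_U_comp_rpow S)).mul (continuousOn_const.mul (H.continuousOn_rpow _))
  exact ⟨fun r hr => (H.hasDerivWithinAt_radialProfile S hr).differentiableWithinAt,
    hslope.congr fun r hr => H.derivWithin_radialProfile S hr⟩

lemma radialSlope_ne_zero (hr : r ∈ Ici R) (hV : radialProfile N p V r = 0) :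
    radialSlope N p U r ≠ 0 := by
  intro h
  have hflux := rpow_mul_pPhi_radialSlope H.one_lt_p H.p_lt_N (H.R_pos.trans_le hr) U
  rw [h, pPhi, mul_zero, mul_zero, eq_comm, neg_eq_zero] at hflux
  exact (mul_eq_zero.1 hflux).elim
    (Real.rpow_pos_of_pos (neg_pos.2 H.exponent_neg) (p - 1)).ne'
    (S.U_ne_zero _ (H.rpow_mem_Ioc hr) hV)

omit S in
lemma setOf_radialProfile_eq_zero (V : ℝ → ℝ) : {r | R < r ∧ radialProfile N p V r = 0} =
    (fun t => t ^ (radialExponent N p)⁻¹) '' {t | t ∈ Ioo 0 D.T ∧ V t = 0} := by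
  have he := H.exponent_neg
  ext r
  constructor
  · rintro ⟨hr, hV⟩
    exact ⟨r ^ radialExponent N p, ⟨⟨(H.rpow_mem_Ioc hr.le).1, H.rpow_lt_T hr⟩, hV⟩,
      Real.rpow_rpow_inv (H.R_pos.trans hr).le he.ne⟩
  · rintro ⟨t, ⟨ht, hV⟩, rfl⟩
    refine ⟨(Real.lt_rpow_inv_iff_of_neg H.R_pos ht.1 he).2 (H.T_eq ▸ ht.2), ?_⟩
    rwa [radialProfile, Real.rpow_inv_rpow ht.1.le he.ne]

lemma encard_zeros_radialProfile : {r | R < r ∧ radialProfile N p V r = 0}.encard = n := by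
  rw [H.setOf_radialProfile_eq_zero V, InjOn.encard_image, S.encard]
  exact (Real.strictAntiOn_rpow_Ioi_of_exponent_neg (inv_lt_zero.2 H.exponent_neg)).injOn.mono
    fun _ ht => ht.1.1

lemma countable_zeros_radialProfile :
    (insert R {r | R < r ∧ radialProfile N p V r = 0}).Countable := by
  refine (Finite.insert R ?_).countable
  rw [← encard_ne_top_iff, H.encard_zeros_radialProfile S]
  exact ENat.natCast_ne_top n

lemma ae_radialProfile_ne_zero : ∀ᵐ r ∂volume.restrict (Ici R), radialProfile N p V r ≠ 0 := by
  filter_upwards [ae_restrict_of_ae ((H.countable_zeros_radialProfile S).ae_notMem _),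
    ae_restrict_mem measurableSet_Ici] with r hr hrR hV
  rcases (mem_Ici.1 hrR).eq_or_lt with h | h
  · exact hr (Or.inl h.symm)
  · exact hr (Or.inr ⟨h, hV⟩)

lemma hasDerivAt_flux (hr : R < r) (hV : radialProfile N p V r ≠ 0) :
    HasDerivAt (fun r => (-radialExponent N p) ^ (p - 1) * U (r ^ radialExponent N p))
      (r ^ (N - 1) * K r * f (radialProfile N p V r)) r := by
  have hmem := H.rpow_mem_Ioc hr.le
  have hU := (S.dU _ hmem hV).hasDerivAt (Icc_mem_nhds hmem.1 (H.rpow_lt_T hr))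
  refine ((hU.comp r (H.hasDerivAt_rpow hr.le)).const_mul _).congr_deriv ?_
  rw [H.h_eq r hr.le, H.f_eq, radialProfile,
    ← radialWeight_mul_eq H.one_lt_p H.p_lt_N (H.R_pos.trans hr)]
  ring

lemma integral_eq (hr : R ≤ r) (hint : IntervalIntegrable
      (fun t => t ^ (N - 1) * K t * f (radialProfile N p V t)) volume R r) :
    r ^ (N - 1) * pPhi p (derivWithin (radialProfile N p V) (Ici R) r) =
      R ^ (N - 1) * pPhi p (derivWithin (radialProfile N p V) (Ici R) R) -
        ∫ t in R..r, t ^ (N - 1) * K t * f (radialProfile N p V t) := by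
  have hflux : ∀ r ∈ Ici R, r ^ (N - 1) * pPhi p (derivWithin (radialProfile N p V) (Ici R) r) =
      -((-radialExponent N p) ^ (p - 1) * U (r ^ radialExponent N p)) := fun r hr => by
    rw [H.derivWithin_radialProfile S hr,
      rpow_mul_pPhi_radialSlope H.one_lt_p H.p_lt_N (H.R_pos.trans_le hr)]
  have hFTC := integral_eq_of_hasDerivAt_off_countable
    (fun r => (-radialExponent N p) ^ (p - 1) * U (r ^ radialExponent N p)) _
    (H.countable_zeros_radialProfile S)
    ((continuousOn_const.mul (H.continuousOn_U_comp_rpow S)).mono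
      ((uIcc_of_le hr).trans_subset Icc_subset_Ici_self))
    (fun x hx => by
      rw [min_eq_left hr, max_eq_right hr] at hx
      exact H.hasDerivAt_flux S hx.1.1 fun h => hx.2 (Or.inr ⟨hx.1.1, h⟩)) hint
  rw [hflux r hr, hflux R self_mem_Ici, hFTC]
  ring

lemma tendsto_radialProfile : Tendsto (radialProfile N p V) atTop (𝓝 0) := by
  have hpow : Tendsto (fun r : ℝ => r ^ radialExponent N p) atTop (𝓝[Icc 0 D.T] 0) := by
    refine tendsto_nhdsWithin_iff.2 ⟨?_, ?_⟩
    · simpa using tendsto_rpow_neg_atTop (neg_pos.2 H.exponent_neg)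
    · filter_upwards [eventually_ge_atTop R] with r hr
      exact Ioc_subset_Icc_self (H.rpow_mem_Ioc hr)
  have hV := (S.continuousOn_V 0 ⟨le_rfl, D.T_pos.le⟩).tendsto.comp hpow
  rwa [S.V_zero] at hV

end IsRadialReduction

lemma IsRadialReduction.isRadialSolution {D : ShootingData} {N n : ℕ} {p R m : ℝ}
    {f K V U : ℝ → ℝ} (H : IsRadialReduction D N p R f K) (S : D.IsSingularSolution n V U)
    (hm : 0 ≤ m) (hm₁ : m < 1) (hf : OddLocLipschitz f)
    (hfO : f =O[𝓝[>] 0] fun u => u ^ (-m)) (hK : ContinuousOn K (Ici R)) :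
    IsRadialSolution N p R m f K (radialProfile N p V) := by
  have hae := H.ae_radialProfile_ne_zero S
  have hloc := locallyIntegrableOn_one_div_abs_rpow hm hm₁ measurableSet_Ici
    (fun r hr => H.hasDerivWithinAt_radialProfile S hr) fun r hr => H.radialSlope_ne_zero S hr
  have hint : ∀ r ∈ Ici R, IntervalIntegrable
      (fun t => t ^ ((N : ℝ) - 1) * K t * f (radialProfile N p V t)) volume R r := fun r hr =>
    hf.intervalIntegrable_mul_comp hfO hr ((H.continuousOn_rpow _).mul hK)
      (H.continuousOn_radialProfile S) hae hloc
  exact ⟨H.contDiffOn_radialProfile S, hae, hloc, hint,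
    fun r hr => H.integral_eq S hr (hint r hr), by rw [radialProfile, ← H.T_eq, S.V_T],
    H.tendsto_radialProfile S⟩

theorem theorem1_general {N : ℕ} {p R m α₁ β K₁ : ℝ} {f K : ℝ → ℝ} (hp : 1 < p) (hpN : p < N)
    (hR : 0 < R) (hm : 0 < m) (hm₁ : m < 1) (hα₁ : N + m * (N - p) / (p - 1) < α₁)
    (hf : OddLocLipschitz f) (hfO : f =O[𝓝[>] 0] fun u => u ^ (-m))
    (hf_top : Tendsto (fun u => f u / u ^ (p - 1)) atTop atTop) (hβ : 0 < β)
    (hf_nonpos : ∀ u ∈ Ioc 0 β, f u ≤ 0) (hf_nonneg : ∀ u ∈ Ici β, 0 ≤ f u)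
    (hK : DifferentiableOn ℝ K (Ici R)) (hKpos : ∀ r ∈ Ici R, 0 < K r)
    (hK' : ∀ r ∈ Ici R, -((N - 1) * p / (p - 1)) ≤ r * derivWithin K (Ici R) r / K r)
    (hK₁ : ∀ r ∈ Ici R, K r ≤ K₁ / r ^ α₁) :
    ∃ n₀ : ℕ, ∀ n ≥ n₀, ∃ u : ℝ → ℝ, IsRadialSolution N p R m f K u ∧
      {r | R < r ∧ u r = 0}.encard = n := by
  obtain ⟨D, H⟩ := exists_isRadialReduction hp hpN hR hm hm₁ hα₁ hf hfO hf_top hβ hf_nonpos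
    hf_nonneg hK hKpos hK' hK₁
  obtain ⟨n₀, hn₀⟩ := D.exists_isSingularSolution
  refine ⟨n₀, fun n hn => ?_⟩
  obtain ⟨V, U, S⟩ := hn₀ n hn
  exact ⟨_, H.isRadialSolution S hm.le hm₁ hf hfO hK.continuousOn, H.encard_zeros_radialProfile S⟩

theorem theorem1 (N : ℕ) (hN : 2 < N) (p : ℝ) (hp : 1 < p) (hpN : p < (N : ℝ))
    (R : ℝ) (hR : 0 < R)
    (l m α α₁ : ℝ) (hl : p - 1 < l) (hm₀ : 0 < m) (hm₁ : m < 1)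
    (hα₁ : (N : ℝ) + m * ((N : ℝ) - p) / (p - 1) < α₁) (hαα : α₁ ≤ α)
    (hα : α < 2 * ((N : ℝ) - 1))
    (f K : ℝ → ℝ) (hf : OddLocLipschitz f) (H1 : PowerAtInfinity f l)
    (H2 : SingularAtZero f m) (H3 : UniquePositiveZero f)
    (H4 : WeightCondition N p R α α₁ K) :
    ∃ n₀ : ℕ, ∀ n : ℕ, n₀ ≤ n →
      ∃ u : ℝ → ℝ, IsRadialSolution N p R m f K u ∧
        {r : ℝ | R < r ∧ u r = 0}.encard = (n : ℕ∞) := by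
  obtain ⟨hK, hKpos, hK', _, _, -, -, hKb⟩ := H4
  obtain ⟨β, hβ, hf_nonpos, hf_nonneg⟩ := H3.exists_sign_change
  exact theorem1_general hp hpN hR hm₀ hm₁ hα₁ hf (H2.isBigO hm₀.le) (H1.tendsto_div_rpow hl) hβ
    hf_nonpos hf_nonneg (hK.differentiableOn one_ne_zero) hKpos (fun r hr => (hK' r hr).le)
    fun r hr => (hKb r hr).2
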